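/- Write $\mathbb S^1=\mathbb R/2\pi\mathbb Z$. For an integer $k\ge 0$, $C^k(\mathbb S^1)$ carries the norm $\sum_{l\le k}\sup|\partial_\theta^l u|$; for $\alpha=k+\gamma$ with $0<\gamma<1$, $C^\alpha=C^{k,\gamma}$ carries the norm $\|u\|_{C^k}+\sup_{0<|\theta-\theta'|<1}|\partial_\theta^ku(\theta)-\partial_\theta^ku(\theta')|/|\theta-\theta'|^\gamma$. Functions take values in $\mathbb R^2$. With $\Delta X=X(\theta)-X(\theta')$, $X'=X(\theta')$, let $$\Lambda X=-\tfrac14\mathcal H\partial_\theta X,\qquad (\mathcal Hw)(\theta)=\frac1{2\pi}\,\mathrm{p.v.}\!\int_{\mathbb S^1}\cot\frac{\theta-\theta'}2\,w(\theta')\,d\theta',$$ $$\mathcal R(X)=-\frac1{4\pi}\int_{\mathbb S^1}\Big(\Big(\frac{\Delta X\cdot\partial_{\theta'}X'}{|\Delta X|^2}-\frac12\cot\frac{\theta-\theta'}2\Big)I+\partial_{\theta'}\frac{\Delta X\otimes\Delta X}{|\Delta X|^2}\Big)\partial_{\theta'}X'\,d\theta',$$ so that $\partial_tX=\Lambda X+\mathcal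 R(X)$ is the Peskin evolution equation. Let $e_r=(\cos\theta,\sin\theta)$, $e_t=(-\sin\theta,\cos\theta)$, $e_x=(1,0)$, $e_y=(0,1)$, $\langle v,w\rangle=\int_{\mathbb S^1}v\cdot w\,d\theta$, $\mathcal Pw=\frac1{2\pi}\sum_{\ell\in\{r,t,x,y\}}\langle w,e_\ell\rangle e_\ell$, $\Pi=1-\mathcal P$, and let $R_\theta$ be multiplication by the matrix of counter-clockwise rotation by $\theta$. 1. (Linearization.) Let $0<\gamma<1$, $Y\in C^{1,\gamma}(\mathbb S^1)$, and let $Z=Ae_r+Be_t+C_1e_x+C_2e_y$ with $A^2+B^2>0$. The principal value defining $\mathcal H\partial_\theta Y$ exists at every point, and the derivative $\frac{d}{d\varepsilon}\big(\Lambda(Z+\varepsilon Y)+\mathcal R(Z+\varepsilon Y)\big)\big|_{\varepsilon=0}$ exists in the sup norm, and equals $\mathcal LY:=R_\theta\Lambda R_\theta^{-1}\Pi Y$; in particular it does not depend on $Z$. 2. (Spectrum.) For each integer $k\ge0$, the space of $Y\in C^{1,\gamma}(\mathbb S^1)$ with $\mathcal LY=-\frac k4Y$ is spanned by: $e_r,e_t,e_x,e_y$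 if $k=0$; $(\cos2\theta,\sin2\theta)$ and $(-\sin2\theta,\cos2\theta)$ if $k=1$; $\cos(k\theta)e_r,\ \sin(k\theta)e_r,\ \cos(k\theta)e_t,\ \sin(k\theta)e_t$ if $k\ge2$. In particular $\ker\mathcal L$ is the four-dimensional span of $e_r,e_t,e_x,e_y$. Let $\mathcal L$ also denote the closed operator on $L^2(\mathbb S^1;\mathbb R^2)$ whose graph is the closure of the graph of $\mathcal L$ on $\bigcup_{0<\gamma<1}C^{1,\gamma}(\mathbb S^1)$. The eigenspaces of this operator for the $-\frac k4$ are the same spans, of dimension $4,2,4,4,4,\dots$; the listed eigenfunctions form a complete orthogonal set in $L^2(\mathbb S^1;\mathbb R^2)$; and the spectrum of (the complexification of) $\mathcal L$ is exactly $\{-\frac k4: k=0,1,2,\dots\}$. 3. (Decay.) $\mathcal L$ generates a unique strongly continuous semigroup $e^{t\mathcal L}$, $t\ge0$, on $L^2(\mathbb S^1;\mathbb R^2)$. For all $\alpha\ge0$ and $\beta$ with $0\le\beta-\alpha\le1$ there is a constant $C$ depending only on $\alpha$ and $\beta$ such that for all $w\in C^\alpha(\mathbb S^1)$ and all $t>0$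 one has $\Pi w\in C^\alpha(\mathbb S^1)$, $e^{t\mathcal L}\Pi w\in C^\beta(\mathbb S^1)$ and $$\|e^{t\mathcal L}\Pi w\|_{C^\beta}\le Ce^{-t/4}\Big(\frac1{t^{\beta-\alpha}}+1\Big)\|\Pi w\|_{C^\alpha}.$$ -/

import Mathlib

open MeasureTheory Filter Topology Set

open scoped ENNReal NNReal

namespace Peskin

noncomputable section

/-- The plane with its Euclidean norm. Functions on the circle `ℝ / 2πℤ` are `2π`-periodic
functions on `ℝ`. -/
abbrev Plane : Type := EuclideanSpace ℝ (Fin 2)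

/-! ### Hölder spaces on the circle -/

/-- The Hölder seminorm `sup_{0 < |θ - θ'| < 1} |u θ - u θ'| / |θ - θ'| ^ γ`. -/
def holderSeminorm (γ : ℝ) (u : ℝ → Plane) : ℝ≥0∞ :=
  ⨆ (θ : ℝ) (θ' : ℝ) (_ : 0 < |θ - θ'| ∧ |θ - θ'| < 1),
    ‖u θ - u θ'‖ₑ / ENNReal.ofReal (|θ - θ'| ^ γ)

/-- The norm of `C^α`, `α ≥ 0`: with `k = ⌊α⌋`, the sum of the sup norms of the derivatives of
order at most `k` and, if `α` is not an integer, the Hölder seminorm of exponent `α - k` of the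
`k`-th derivative. -/
def holderNorm (α : ℝ) (u : ℝ → Plane) : ℝ≥0∞ :=
  (∑ l ∈ Finset.range (⌊α⌋₊ + 1), ⨆ θ : ℝ, ‖iteratedDeriv l u θ‖ₑ) +
    (if α = (⌊α⌋₊ : ℝ) then 0 else holderSeminorm (α - ⌊α⌋₊) (iteratedDeriv ⌊α⌋₊ u))

/-- `u ∈ C^α(S¹; ℝ²)`: this is `C^k` for an integer `α = k`, and `C^{k,γ}` for `α = k + γ`,
`0 < γ < 1`. -/
def MemHolder (α : ℝ) (u : ℝ → Plane) : Prop :=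
  Function.Periodic u (2 * Real.pi) ∧ ContDiff ℝ (⌊α⌋₊ : ℕ) u ∧ holderNorm α u < ⊤

/-! ### The Hilbert transform and the evolution equation -/

/-- `v` is the value at `θ` of the Hilbert transform
`(1 / 2π) p.v. ∫ cot((θ - θ') / 2) w(θ') dθ'`. -/
def HasHilbertAt (w : ℝ → Plane) (θ : ℝ) (v : Plane) : Prop :=
  Tendsto (fun δ : ℝ => (1 / (2 * Real.pi)) •
      ((∫ θ' in (θ - Real.pi)..(θ - δ), Real.cot ((θ - θ') / 2) • w θ') +
        ∫ θ' in (θ + δ)..(θ + Real.pi), Real.cot ((θ - θ') / 2) • w θ'))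
    (𝓝[>] 0) (𝓝 v)

/-- The Hilbert transform, acting componentwise. -/
def hilbert (w : ℝ → Plane) (θ : ℝ) : Plane :=
  limUnder (𝓝[>] (0 : ℝ)) (fun δ : ℝ => (1 / (2 * Real.pi)) •
      ((∫ θ' in (θ - Real.pi)..(θ - δ), Real.cot ((θ - θ') / 2) • w θ') +
        ∫ θ' in (θ + δ)..(θ + Real.pi), Real.cot ((θ - θ') / 2) • w θ'))

/-- `Λ X = -(1/4) H (∂_θ X)`. -/
def Lam (X : ℝ → Plane) (θ : ℝ) : Plane :=
  (-(1 / 4 : ℝ)) • hilbert (deriv X) θ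

/-- `((ΔX ⊗ ΔX) / |ΔX|²) p` with `ΔX = X θ - X θ'`. -/
def tensorTerm (X : ℝ → Plane) (θ θ' : ℝ) (p : Plane) : Plane :=
  (inner ℝ (X θ - X θ') p / ‖X θ - X θ'‖ ^ 2) • (X θ - X θ')

/-- The remainder
`R(X) = -(1/4π) ∫ ((ΔX · ∂X' / |ΔX|² - (1/2) cot((θ - θ')/2)) I + ∂_θ'(ΔX ⊗ ΔX / |ΔX|²)) ∂X' dθ'`.
In the second term the matrix is differentiated in `θ'` and then applied to `∂X' = ∂X(θ')`. -/
def remainder (X : ℝ → Plane) (θ : ℝ) : Plane :=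
  (-(1 / (4 * Real.pi))) • ∫ θ' in (0 : ℝ)..(2 * Real.pi),
    ((inner ℝ (X θ - X θ') (deriv X θ') / ‖X θ - X θ'‖ ^ 2
        - (1 / 2) * Real.cot ((θ - θ') / 2)) • deriv X θ'
      + deriv (fun σ => tensorTerm X θ σ (deriv X θ')) θ')

/-- The right-hand side of the evolution equation `∂_t X = Λ X + R(X)`. -/
def velocity (X : ℝ → Plane) (θ : ℝ) : Plane := Lam X θ + remainder X θ

/-- `W` is the linearization of `Λ + R` at `X` in the direction `Y`, that is the derivative of
`ε ↦ Λ(X + ε Y) + R(X + ε Y)` at `ε = 0`, taken in the sup norm. -/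
def HasLinearization (X Y W : ℝ → Plane) : Prop :=
  TendstoUniformly
    (fun (ε : ℝ) (θ : ℝ) => ε⁻¹ • (velocity (fun s => X s + ε • Y s) θ - velocity X θ))
    W (𝓝[≠] 0)

/-! ### Circles, the projections and the rotation -/

/-- `e_r`, also the unit circle. -/
def er (θ : ℝ) : Plane := !₂[Real.cos θ, Real.sin θ]

/-- `e_t`. -/
def et (θ : ℝ) : Plane := !₂[-Real.sin θ, Real.cos θ]

/-- `e_x`. -/
def ex (_ : ℝ) : Plane := !₂[1, 0]

/-- `e_y`. -/
def ey (_ : ℝ) : Plane := !₂[0, 1]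

/-- The circle `A e_r + B e_t + C₁ e_x + C₂ e_y` (nondegenerate if `A² + B² > 0`). -/
def circle (A B C₁ C₂ : ℝ) (θ : ℝ) : Plane :=
  A • er θ + B • et θ + C₁ • ex θ + C₂ • ey θ

/-- The pairing `⟨v, w⟩ = ∫ v · w dθ` over the circle. -/
def pairing (v w : ℝ → Plane) : ℝ :=
  ∫ θ in (0 : ℝ)..(2 * Real.pi), (inner ℝ (v θ) (w θ) : ℝ)

/-- The projection `P` onto the span of `e_r, e_t, e_x, e_y`. -/
def projP (w : ℝ → Plane) (θ : ℝ) : Plane :=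
  (1 / (2 * Real.pi)) • (pairing w er • er θ + pairing w et • et θ
    + pairing w ex • ex θ + pairing w ey • ey θ)

/-- The complementary projection `Π = 1 - P`. -/
def projPi (w : ℝ → Plane) (θ : ℝ) : Plane := w θ - projP w θ

/-- Multiplication by the counter-clockwise rotation `R_θ`. -/
def rot (w : ℝ → Plane) (θ : ℝ) : Plane :=
  !₂[Real.cos θ * w θ 0 - Real.sin θ * w θ 1, Real.sin θ * w θ 0 + Real.cos θ * w θ 1]

/-- Multiplication by `R_θ⁻¹`. -/
def rotInv (w : ℝ → Plane) (θ : ℝ) : Plane :=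
  !₂[Real.cos θ * w θ 0 + Real.sin θ * w θ 1, -Real.sin θ * w θ 0 + Real.cos θ * w θ 1]

/-- `R_θ Λ R_θ⁻¹ Π`. -/
def circleOp (Y : ℝ → Plane) : ℝ → Plane := rot (Lam (rotInv (projPi Y)))

/-- The claimed eigenfunctions for the eigenvalue `-k/4`. -/
def modes (k : ℕ) : Set (ℝ → Plane) :=
  if k = 0 then {er, et, ex, ey}
  else if k = 1 then
    {fun θ => !₂[Real.cos (2 * θ), Real.sin (2 * θ)],
      fun θ => !₂[-Real.sin (2 * θ), Real.cos (2 * θ)]}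
  else
    {fun θ => Real.cos (k * θ) • er θ, fun θ => Real.sin (k * θ) • er θ,
      fun θ => Real.cos (k * θ) • et θ, fun θ => Real.sin (k * θ) • et θ}

/-! ### The operator on `L²` and its semigroup -/

/-- Lebesgue measure on one period. -/
def circleMeasure : Measure ℝ := volume.restrict (Ioc 0 (2 * Real.pi))

/-- `L²(S¹; ℝ²)`. -/
abbrev L2 : Type := Lp Plane 2 circleMeasure

open Classical in
/-- The class in `L²(S¹; ℝ²)` of a square integrable function (and `0` for other functions). -/
def toL2 (w : ℝ → Plane) : L2 :=
  if h : MemLp w 2 circleMeasure then h.toLp w else 0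

/-- The graph of `𝓛` as a closed operator on `L²(S¹; ℝ²)`: the closure of the graph of the
linearization at the unit circle, acting on `⋃_{0<γ<1} C^{1,γ}`. -/
def graphL : Set (L2 × L2) :=
  closure {p | ∃ (γ : ℝ) (Y W : ℝ → Plane), 0 < γ ∧ γ < 1 ∧ MemHolder (1 + γ) Y ∧
    HasLinearization er Y W ∧ p.1 =ᵐ[circleMeasure] Y ∧ p.2 =ᵐ[circleMeasure] W}

/-- `z` is in the resolvent set of (the complexification of) the operator with graph `G`: the
operator `z - A` has an everywhere defined bounded inverse `S`. A vector `u + i v` of the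
complexified space is written as the pair `(u, v)`. -/
def InResolventSet {H : Type*} [NormedAddCommGroup H] [NormedSpace ℝ H]
    (G : Set (H × H)) (z : ℂ) : Prop :=
  ∃ S : (H × H) →L[ℝ] (H × H), ∀ u v f g : H,
    (∃ u' v' : H, (u, u') ∈ G ∧ (v, v') ∈ G ∧
        z.re • u - z.im • v - u' = f ∧ z.im • u + z.re • v - v' = g) ↔
      S (f, g) = (u, v)

/-- `T` is the strongly continuous semigroup whose infinitesimal generator has graph `G`. -/
structure IsSemigroupOf {H : Type*} [NormedAddCommGroup H] [NormedSpace ℝ H]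
    (G : Set (H × H)) (T : ℝ≥0 → H →L[ℝ] H) : Prop where
  zero : T 0 = ContinuousLinearMap.id ℝ H
  add : ∀ s t, T (s + t) = (T s).comp (T t)
  continuous : ∀ f : H, Tendsto (fun t => T t f) (𝓝 0) (𝓝 f)
  generator : ∀ f g : H, (f, g) ∈ G ↔
    Tendsto (fun t : ℝ≥0 => (t : ℝ)⁻¹ • (T t f - f)) (𝓝[≠] 0) (𝓝 g)

end

end Peskin

/-! Identify the plane with `ℂ`. Then e_r, e_t, e_x, e_y become e^{iθ}, ie^{iθ}, 1, i, the rotation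
R_θ is multiplication by e^{iθ}, and the projection P keeps exactly the frequencies 0 and 1. The
Hilbert transform has symbol -i sgn m, which follows from cot(φ/2)(e^{iφ} - 1) = i(e^{iφ} + 1).
Conjugation by e^{iθ} shifts the symbol and changes it only at m = 0, 1, where Π intervenes; the
outcome is R_θ Λ R_θ⁻¹ Π Y = -(1/4) H(∂Y - iY) (`toC_circleOp`). So 𝓛 is the Fourier multiplier -λ_m
with λ_m = sgn(m)(m - 1)/4, which is |m - 1|/4 for m ≠ 0 and 0 for m = 0.

Linearization. On a circle, with φ = θ - θ', the tangent at θ' is κ times the chord z, where κ =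
i/(e^{iφ} - 1) = (cot(φ/2) - i)/2 depends on φ alone. In complex form the integrand of the evolution
is a rational function of chord and tangent and their conjugates, and along Z + εY it expands
exactly to second order in ε (`kerC_expansion`). The linear coefficient has three parts: a multiple
of ∂Y', with integral zero; a multiple of cot(φ/2) ΔY, which gives HY; and an exact derivative in φ,
with integral zero (`integral_exactPart`). Every quadratic term carries the factor ∂Y' - κΔY =
O(|φ|^γ), which tames the singular denominators, so the quadratic part is O(|φ|^{γ-1}) uniformly in
θ and in small ε. Hence the difference quotient converges uniformly, to -(1/4)H∂Y + (i/4)HY.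

Spectrum. L² is the real Hilbert sum of copies of `ℂ`, one for each frequency, and the closed graph
is exactly the set of pairs with ĝ(m) = -λ_m f̂(m) (`mem_graphL_iff`): this condition is closed, and
Fourier truncation approximates f and g at the same time. Eigenspaces, completeness and resolvent
are then read off from the multiplier. The value λ_m = k/4 is taken at m = 1 ± k, except that m = 0
belongs to k = 0 and not to k = 1; this accounts for the dimensions 4, 2, 4, 4, ….

Semigroup. Existence is the multiplier e^{-λ_m t}. For uniqueness, any semigroup with this generator
acts on each Fourier mode by the exponential, and the modes span a dense subspace.

Decay. On functions without frequencies 0 and 1, e^{t𝓛} is convolution with e^{iφ}P_r(φ), where r =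
e^{-t/4} and P_r is the Poisson kernel. Split t into a piece τ ≤ 1/2 and the rest. The piece τ
smooths, at the cost (1 - r)^{-(β-α)} with r = e^{-τ/4}, by the classical estimates of P_r and its
derivative. For the rest, with s = e^{-(t-τ)/4}, the kernel e^{iφ}P_s may be replaced by e^{iφ}(P_s
- 1), since frequency 1 is absent; as |P_s - 1| ≤ s(P_s + 1), its mean absolute value is at most 2s,
which is the exponential decay. -/

namespace Peskin

noncomputable section

/-! ### The plane as `ℂ`, and Fourier coefficients -/

/-- The identification of the plane with `ℂ`. -/
def toC : Plane ≃ₗᵢ[ℝ] ℂ := Complex.orthonormalBasisOneI.repr.symm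

theorem toC_apply (v : Plane) : toC v = v 0 + v 1 * Complex.I := by
  simp [toC, ← OrthonormalBasis.sum_repr_symm, Fin.sum_univ_two]

/-- The character `θ ↦ exp (i m θ)`. -/
def chr (m : ℤ) (θ : ℝ) : ℂ := Complex.exp (m * θ * Complex.I)

theorem chr_zero (θ : ℝ) : chr 0 θ = 1 := by simp [chr]

theorem chr_apply_zero (m : ℤ) : chr m 0 = 1 := by simp [chr]

theorem chr_mul (m n : ℤ) (θ : ℝ) : chr m θ * chr n θ = chr (m + n) θ := by
  rw [chr, chr, chr, ← Complex.exp_add]; push_cast; ring_nf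

theorem chr_neg (m : ℤ) (θ : ℝ) : chr m (-θ) = chr (-m) θ := by
  simp [chr]

theorem chr_add (m : ℤ) (θ φ : ℝ) : chr m (θ + φ) = chr m θ * chr m φ := by
  rw [chr, chr, chr, ← Complex.exp_add]; push_cast; ring_nf

theorem chr_sub (m : ℤ) (θ φ : ℝ) : chr m (θ - φ) = chr m θ * chr (-m) φ := by
  rw [sub_eq_add_neg, chr_add, chr_neg]

theorem norm_chr (m : ℤ) (θ : ℝ) : ‖chr m θ‖ = 1 := by
  rw [chr]; exact_mod_cast Complex.norm_exp_ofReal_mul_I (m * θ)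

theorem chr_ne_zero (m : ℤ) (θ : ℝ) : chr m θ ≠ 0 := Complex.exp_ne_zero _

theorem conj_chr (m : ℤ) (θ : ℝ) : (starRingEnd ℂ) (chr m θ) = chr (-m) θ := by
  rw [chr, chr, ← Complex.exp_conj]; simp

theorem contDiff_chr (m : ℤ) {n : WithTop ℕ∞} : ContDiff ℝ n (chr m) := by
  unfold chr
  exact Complex.contDiff_exp.comp
    (((contDiff_const.mul Complex.ofRealCLM.contDiff)).mul contDiff_const)

theorem continuous_chr (m : ℤ) : Continuous (chr m) := (contDiff_chr m (n := 0)).continuous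

theorem hasDerivAt_chr (m : ℤ) (θ : ℝ) :
    HasDerivAt (chr m) (m * Complex.I * chr m θ) θ := by
  have h : HasDerivAt (fun s : ℝ => ((m : ℂ) * s * Complex.I)) (m * 1 * Complex.I) θ :=
    ((Complex.ofRealCLM.hasDerivAt (x := θ)).const_mul (m : ℂ)).mul_const _
  have := h.cexp
  rw [mul_one, mul_comm] at this
  exact this

theorem chr_periodic (m : ℤ) : Function.Periodic (chr m) (2 * Real.pi) := by
  intro θ
  rw [chr, chr, Complex.exp_eq_exp_iff_exists_int]
  exact ⟨m, by push_cast; ring⟩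

theorem chr_one (θ : ℝ) : chr 1 θ = Real.cos θ + Real.sin θ * Complex.I := by
  rw [chr]; push_cast; rw [one_mul, Complex.exp_mul_I]

theorem chr_eq_cos_sin (m : ℤ) (θ : ℝ) :
    chr m θ = Real.cos (m * θ) + Real.sin (m * θ) * Complex.I := by
  rw [chr]; push_cast; rw [Complex.exp_mul_I]

theorem integral_chr (m : ℤ) :
    ∫ θ in (0 : ℝ)..(2 * Real.pi), chr m θ = if m = 0 then (2 * Real.pi : ℂ) else 0 := by
  split_ifs with h
  · subst h; simp [chr]
  · have hm : (m : ℂ) * Complex.I ≠ 0 := by simp [h]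
    have hd : ∀ θ ∈ uIcc (0 : ℝ) (2 * Real.pi),
        HasDerivAt (fun s => (m * Complex.I)⁻¹ * chr m s) (chr m θ) θ := by
      intro θ _
      have := (hasDerivAt_chr m θ).const_mul ((m * Complex.I)⁻¹)
      rwa [← mul_assoc, inv_mul_cancel₀ hm, one_mul] at this
    rw [intervalIntegral.integral_eq_sub_of_hasDerivAt hd
      ((continuous_chr m).intervalIntegrable _ _)]
    have := chr_periodic m 0
    rw [zero_add] at this
    rw [this, sub_self]

/-- The Fourier coefficient of a `2π`-periodic function. -/
def coeffC (f : ℝ → ℂ) (m : ℤ) : ℂ :=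
  (2 * Real.pi : ℂ)⁻¹ * ∫ θ in (0 : ℝ)..(2 * Real.pi), chr (-m) θ * f θ

theorem two_pi_ne : (2 * Real.pi : ℂ) ≠ 0 := by
  exact_mod_cast Real.two_pi_pos.ne'

theorem coeffC_chr (c : ℂ) (m n : ℤ) :
    coeffC (fun θ => c * chr n θ) m = if n = m then c else 0 := by
  have : ∀ θ, chr (-m) θ * (c * chr n θ) = c * chr (n - m) θ := fun θ => by
    rw [mul_left_comm, chr_mul, neg_add_eq_sub]
  simp_rw [coeffC, this, intervalIntegral.integral_const_mul, integral_chr, sub_eq_zero]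
  split_ifs
  · field_simp [two_pi_ne]
  · simp

theorem coeffC_add {f g : ℝ → ℂ} (hf : IntervalIntegrable f volume 0 (2 * Real.pi))
    (hg : IntervalIntegrable g volume 0 (2 * Real.pi)) (m : ℤ) :
    coeffC (fun θ => f θ + g θ) m = coeffC f m + coeffC g m := by
  simp_rw [coeffC, mul_add]
  rw [intervalIntegral.integral_add (hf.continuousOn_mul (continuous_chr _).continuousOn)
    (hg.continuousOn_mul (continuous_chr _).continuousOn), mul_add]

theorem coeffC_sub {f g : ℝ → ℂ} (hf : IntervalIntegrable f volume 0 (2 * Real.pi))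
    (hg : IntervalIntegrable g volume 0 (2 * Real.pi)) (m : ℤ) :
    coeffC (fun θ => f θ - g θ) m = coeffC f m - coeffC g m := by
  simp_rw [coeffC, mul_sub]
  rw [intervalIntegral.integral_sub (hf.continuousOn_mul (continuous_chr _).continuousOn)
    (hg.continuousOn_mul (continuous_chr _).continuousOn), mul_sub]

theorem coeffC_const_mul (c : ℂ) (f : ℝ → ℂ) (m : ℤ) :
    coeffC (fun θ => c * f θ) m = c * coeffC f m := by
  simp_rw [coeffC, mul_left_comm _ c, intervalIntegral.integral_const_mul]
  ring

theorem coeffC_eq_fourierCoeffOn (f : ℝ → ℂ) (m : ℤ) :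
    coeffC f m = fourierCoeffOn Real.two_pi_pos f m := by
  rw [fourierCoeffOn_eq_integral, coeffC, Complex.real_smul]
  congr 1
  · push_cast; simp
  · refine intervalIntegral.integral_congr fun θ _ => ?_
    simp only [smul_eq_mul]
    congr 1
    rw [fourier_coe_apply, chr]
    congr 1
    have := two_pi_ne
    push_cast
    field_simp
    ring

theorem hasSum_sq_coeffC {f : ℝ → ℂ} (hf : MemLp f 2 circleMeasure) :
    HasSum (fun m => ‖coeffC f m‖ ^ 2)
      ((2 * Real.pi)⁻¹ * ∫ θ in (0 : ℝ)..(2 * Real.pi), ‖f θ‖ ^ 2) := by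
  have := hasSum_sq_fourierCoeffOn Real.two_pi_pos hf
  simpa only [coeffC_eq_fourierCoeffOn, sub_zero, smul_eq_mul] using this

instance : IsFiniteMeasure circleMeasure := by unfold circleMeasure; infer_instance

theorem Continuous.memLp_circle {E : Type*} [NormedAddCommGroup E] [SecondCountableTopology E]
    [MeasurableSpace E] [BorelSpace E] {f : ℝ → E}
    (hf : Continuous f) (p : ℝ≥0∞) : MemLp f p circleMeasure := by
  obtain ⟨C, hC⟩ := (isCompact_Icc (a := (0 : ℝ)) (b := 2 * Real.pi)).exists_bound_of_continuousOn
    hf.continuousOn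
  refine MemLp.of_bound hf.aestronglyMeasurable C ?_
  exact (ae_restrict_iff' measurableSet_Ioc).2 (ae_of_all _ fun x hx => hC x ⟨hx.1.le, hx.2⟩)

/-- A continuous periodic function is determined by its Fourier coefficients. -/
theorem eq_of_coeffC_eq {f g : ℝ → ℂ} (hf : Continuous f) (hg : Continuous g)
    (hfp : Function.Periodic f (2 * Real.pi)) (hgp : Function.Periodic g (2 * Real.pi))
    (h : ∀ m, coeffC f m = coeffC g m) : f = g := by
  -- Parseval for `f - g` makes the integral of its squared norm vanish; continuity turns almost
  -- everywhere into everywhere on one period, and periodicity does the rest.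
  have hs := hasSum_sq_coeffC (Continuous.memLp_circle (hf.sub hg) 2)
  have h0 : ∀ m, coeffC (f - g) m = 0 := fun m => by
    have := coeffC_sub (hf.intervalIntegrable 0 (2 * Real.pi)) (hg.intervalIntegrable _ _) m
    rw [h, sub_self] at this
    exact this
  simp only [h0, norm_zero, ne_eq, OfNat.ofNat_ne_zero, not_false_eq_true, zero_pow] at hs
  have hz : ∫ θ in (0 : ℝ)..(2 * Real.pi), ‖(f - g) θ‖ ^ 2 = 0 := by
    have := hs.unique hasSum_zero
    have hp := Real.two_pi_pos.ne'
    simpa [Real.pi_ne_zero] using this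
  have hc : Continuous fun θ => ‖(f - g) θ‖ ^ 2 := ((hf.sub hg).norm).pow 2
  rw [intervalIntegral.integral_eq_zero_iff_of_le_of_nonneg_ae Real.two_pi_pos.le
    (ae_of_all _ fun _ => by positivity) (hc.intervalIntegrable _ _)] at hz
  have heq : EqOn (fun θ => ‖(f - g) θ‖ ^ 2) 0 (Icc 0 (2 * Real.pi)) :=
    Measure.eqOn_Icc_of_ae_eq volume Real.two_pi_pos.ne
      (by rwa [← restrict_Ioc_eq_restrict_Icc] ) hc.continuousOn continuousOn_const
  have hper : Function.Periodic (f - g) (2 * Real.pi) := hfp.sub hgp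
  funext θ
  obtain ⟨y, hy, hyx⟩ := hper.exists_mem_Ico₀ Real.two_pi_pos θ
  have h1 : ‖(f - g) y‖ ^ 2 = 0 := heq ⟨hy.1, hy.2.le⟩
  have h2 : (f - g) θ = 0 := by rw [hyx]; simpa using h1
  exact sub_eq_zero.1 h2

/-! ### `L²` of the circle as a Hilbert sum -/

/-- The function `θ ↦ c exp (i m θ)`, with values in the plane. -/
def mode (m : ℤ) (c : ℂ) (θ : ℝ) : Plane := toC.symm (c * chr m θ)

theorem toC_mode (m : ℤ) (c : ℂ) (θ : ℝ) : toC (mode m c θ) = c * chr m θ := by simp [mode]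

theorem contDiff_mode (m : ℤ) (c : ℂ) {n : WithTop ℕ∞} : ContDiff ℝ n (mode m c) :=
  toC.symm.toContinuousLinearEquiv.contDiff.comp (contDiff_const.mul (contDiff_chr m))

theorem continuous_mode (m : ℤ) (c : ℂ) : Continuous (mode m c) :=
  (contDiff_mode m c (n := 0)).continuous

theorem mode_periodic (m : ℤ) (c : ℂ) : Function.Periodic (mode m c) (2 * Real.pi) := fun θ => by
  rw [mode, chr_periodic, mode]

theorem memLp_mode (m : ℤ) (c : ℂ) : MemLp (mode m c) 2 circleMeasure :=
  Continuous.memLp_circle (continuous_mode m c) 2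

theorem toL2_of_memLp {w : ℝ → Plane} (h : MemLp w 2 circleMeasure) : toL2 w = h.toLp w := by
  rw [toL2, dif_pos h]

theorem coeFn_toL2 {w : ℝ → Plane} (h : MemLp w 2 circleMeasure) : toL2 w =ᵐ[circleMeasure] w := by
  rw [toL2_of_memLp h]; exact h.coeFn_toLp

theorem toL2_add {u v : ℝ → Plane} (hu : MemLp u 2 circleMeasure) (hv : MemLp v 2 circleMeasure) :
    toL2 (u + v) = toL2 u + toL2 v := by
  rw [toL2_of_memLp hu, toL2_of_memLp hv, toL2_of_memLp (hu.add hv)]; rfl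

theorem toL2_smul {u : ℝ → Plane} (hu : MemLp u 2 circleMeasure) (a : ℝ) :
    toL2 (a • u) = a • toL2 u := by
  rw [toL2_of_memLp hu, toL2_of_memLp (hu.const_smul a)]; rfl

theorem inner_toC (v w : Plane) : inner ℝ v w = ((starRingEnd ℂ) (toC v) * toC w).re := by
  rw [← toC.inner_map_map, Complex.inner, mul_comm]

theorem coeffC_congr {f g : ℝ → ℂ} (h : f =ᵐ[circleMeasure] g) (m : ℤ) :
    coeffC f m = coeffC g m := by
  rw [coeffC, coeffC]
  congr 1
  rw [intervalIntegral.integral_of_le Real.two_pi_pos.le,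
    intervalIntegral.integral_of_le Real.two_pi_pos.le]
  refine integral_congr_ae ?_
  filter_upwards [h] with x hx
  rw [hx]

theorem coeffC_eq_integral (f : ℝ → ℂ) (m : ℤ) :
    coeffC f m = (2 * Real.pi : ℂ)⁻¹ * ∫ θ, chr (-m) θ * f θ ∂circleMeasure := by
  rw [coeffC, intervalIntegral.integral_of_le Real.two_pi_pos.le, circleMeasure]

theorem memLp_toC (f : L2) : MemLp (fun θ => toC (f θ)) 2 circleMeasure :=
  (toC.toContinuousLinearEquiv : Plane →L[ℝ] ℂ).comp_memLp' (Lp.memLp f)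

/-- The real inner product with a mode is the real part of the complex pairing, so letting `c` vary
over `ℂ` recovers the whole complex coefficient. The factor 2π undoes the normalization of `coeffC`.
-/
theorem inner_toL2_mode (m : ℤ) (c : ℂ) (f : L2) :
    inner ℝ (toL2 (mode m c)) f =
      2 * Real.pi * inner ℝ c (coeffC (fun θ => toC (f θ)) m) := by
  have hint : Integrable (fun θ => chr (-m) θ * toC (f θ)) circleMeasure := by
    refine ((memLp_toC f).integrable (by norm_num)).bdd_mul
      (continuous_chr _).aestronglyMeasurable (c := 1) (ae_of_all _ fun x => (norm_chr _ _).le)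
  have h1 : inner ℝ (toL2 (mode m c)) f =
      ∫ θ, ((starRingEnd ℂ c) * (chr (-m) θ * toC (f θ))).re ∂circleMeasure := by
    rw [L2.inner_def]
    refine integral_congr_ae ?_
    filter_upwards [coeFn_toL2 (memLp_mode m c)] with θ hθ
    rw [inner_toC, hθ, toC_mode, map_mul, conj_chr, mul_assoc]
  have h2 := Complex.reCLM.integral_comp_comm (hint.const_mul (starRingEnd ℂ c))
  simp only [Complex.reCLM_apply] at h2
  rw [h1, h2, integral_const_mul, Complex.inner, coeffC_eq_integral]
  have : (∫ θ, chr (-m) θ * toC (f θ) ∂circleMeasure) = ((2 * Real.pi : ℝ) : ℂ) *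
      ((2 * Real.pi : ℂ)⁻¹ * ∫ θ, chr (-m) θ * toC (f θ) ∂circleMeasure) := by
    push_cast
    rw [← mul_assoc, mul_inv_cancel₀ two_pi_ne, one_mul]
  conv_lhs => rw [this]
  rw [mul_left_comm, Complex.re_ofReal_mul, mul_comm (starRingEnd ℂ c)]

theorem coeffC_toL2 {w : ℝ → Plane} (h : MemLp w 2 circleMeasure) (m : ℤ) :
    coeffC (fun θ => toC (toL2 w θ)) m = coeffC (fun θ => toC (w θ)) m := by
  refine coeffC_congr ?_ m
  filter_upwards [coeFn_toL2 h] with x hx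
  rw [hx]

theorem coeffC_toL2_mode (m n : ℤ) (c : ℂ) :
    coeffC (fun θ => toC (toL2 (mode n c) θ)) m = if n = m then c else 0 := by
  rw [coeffC_toL2 (memLp_mode n c)]
  simp_rw [toC_mode]
  exact coeffC_chr c m n

theorem mode_add (m : ℤ) (c d : ℂ) : mode m (c + d) = mode m c + mode m d := by
  funext θ; simp [mode, add_mul]

theorem mode_smul (m : ℤ) (a : ℝ) (c : ℂ) : mode m (a • c) = a • mode m c := by
  funext θ
  simp only [mode, Pi.smul_apply]
  rw [smul_mul_assoc, map_smul]

/-- The `m`-th Fourier mode as an isometric embedding of `ℂ`. -/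
def modeIso (m : ℤ) : ℂ →ₗᵢ[ℝ] L2 where
  toFun c := (Real.sqrt (2 * Real.pi))⁻¹ • toL2 (mode m c)
  map_add' c d := by rw [mode_add, toL2_add (memLp_mode _ _) (memLp_mode _ _), smul_add]
  map_smul' a c := by
    rw [mode_smul, toL2_smul (memLp_mode _ _), smul_comm]; rfl
  norm_map' c := by
    have h : ‖(Real.sqrt (2 * Real.pi))⁻¹ • toL2 (mode m c)‖ ^ 2 = ‖c‖ ^ 2 := by
      rw [norm_smul, mul_pow, ← real_inner_self_eq_norm_sq (toL2 _), inner_toL2_mode,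
        coeffC_toL2_mode, if_pos rfl, real_inner_self_eq_norm_sq, Real.norm_eq_abs, sq_abs,
        inv_pow, Real.sq_sqrt Real.two_pi_pos.le, ← mul_assoc,
        inv_mul_cancel₀ Real.two_pi_pos.ne', one_mul]
    exact (pow_left_inj₀ (norm_nonneg _) (norm_nonneg _) two_ne_zero).1 h

theorem modeIso_apply (m : ℤ) (c : ℂ) :
    modeIso m c = (Real.sqrt (2 * Real.pi))⁻¹ • toL2 (mode m c) := rfl

theorem eq_zero_of_coeffC_eq_zero {f : L2} (h : ∀ m, coeffC (fun θ => toC (f θ)) m = 0) :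
    f = 0 := by
  have hs := hasSum_sq_coeffC (memLp_toC f)
  simp only [h, norm_zero, ne_eq, OfNat.ofNat_ne_zero, not_false_eq_true, zero_pow] at hs
  have h0 := hs.unique hasSum_zero
  simp only [LinearIsometryEquiv.norm_map, mul_eq_zero, inv_eq_zero,
    Real.two_pi_pos.ne', false_or] at h0
  have : ‖f‖ ^ 2 = 0 := by
    rw [← real_inner_self_eq_norm_sq, L2.inner_def]
    simp only [real_inner_self_eq_norm_sq]
    rw [intervalIntegral.integral_of_le Real.two_pi_pos.le] at h0
    exact h0
  simpa using this

/-- Each summand is `ℂ` as a real plane, so no complex structure on `L2` is needed. Orthogonality is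
that of the characters; density holds because a vector orthogonal to all modes has zero coefficients
and hence, by Parseval, zero norm. -/
theorem isHilbertSum_modeIso : IsHilbertSum ℝ (fun _ : ℤ => ℂ) modeIso := by
  refine IsHilbertSum.mk ?_ ?_
  · intro m n hmn c d
    simp [modeIso_apply, inner_smul_left, inner_smul_right, inner_toL2_mode, coeffC_toL2_mode,
      hmn.symm]
  · rw [top_le_iff, Submodule.topologicalClosure_eq_top_iff, Submodule.eq_bot_iff]
    intro f hf
    refine eq_zero_of_coeffC_eq_zero fun m => ?_
    rw [Submodule.mem_orthogonal] at hf
    refine ext_inner_left ℝ fun c => ?_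
    have h := hf (modeIso m c) (Submodule.mem_iSup_of_mem m ⟨c, rfl⟩)
    rw [modeIso_apply, inner_smul_left, inner_toL2_mode] at h
    simpa [Real.sqrt_eq_zero', Real.pi_pos.not_ge, Real.pi_ne_zero] using h

/-- The isometry of `L²` with the square summable sequences. -/
def toSeq : L2 ≃ₗᵢ[ℝ] lp (fun _ : ℤ => ℂ) 2 := isHilbertSum_modeIso.linearIsometryEquiv

/-- The Fourier coefficient of an element of `L²`. -/
def coef (f : L2) (m : ℤ) : ℂ := coeffC (fun θ => toC (f θ)) m

/-- The abstract isometry is only useful once its coordinates are known to be the Fourier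
coefficients; the factor √(2π) comes from the normalization that makes the modes isometric. -/
theorem toSeq_apply (f : L2) (m : ℤ) :
    toSeq f m = (Real.sqrt (2 * Real.pi) : ℝ) • coef f m := by
  classical
  refine ext_inner_left ℝ fun c => ?_
  have h1 : toSeq (modeIso m c) = lp.single 2 m c := by
    rw [← LinearIsometryEquiv.eq_symm_apply, toSeq,
      IsHilbertSum.linearIsometryEquiv_symm_apply_single]
  rw [← lp.inner_single_left (𝕜 := ℝ) m c (toSeq f), ← h1, toSeq.inner_map_map, modeIso_apply,
    inner_smul_left, inner_toL2_mode, inner_smul_right, coef]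
  have : (Real.sqrt (2 * Real.pi))⁻¹ * (2 * Real.pi) = Real.sqrt (2 * Real.pi) := by
    rw [inv_mul_eq_div, Real.div_sqrt]
  rw [← mul_assoc]
  simp only [conj_trivial]
  rw [this]

theorem sqrt_two_pi_pos : 0 < Real.sqrt (2 * Real.pi) := Real.sqrt_pos.2 Real.two_pi_pos

theorem coef_eq (f : L2) (m : ℤ) : coef f m = (Real.sqrt (2 * Real.pi))⁻¹ • toSeq f m := by
  rw [toSeq_apply, smul_smul, inv_mul_cancel₀ sqrt_two_pi_pos.ne', one_smul]

theorem coef_add (f g : L2) (m : ℤ) : coef (f + g) m = coef f m + coef g m := by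
  simp only [coef_eq, map_add, lp.coeFn_add, Pi.add_apply, smul_add]

theorem coef_sub (f g : L2) (m : ℤ) : coef (f - g) m = coef f m - coef g m := by
  simp only [coef_eq, map_sub, lp.coeFn_sub, Pi.sub_apply, smul_sub]

theorem coef_smul (a : ℝ) (f : L2) (m : ℤ) : coef (a • f) m = a • coef f m := by
  simp only [coef_eq, map_smul, lp.coeFn_smul, Pi.smul_apply]
  rw [smul_comm]

theorem coef_zero (m : ℤ) : coef 0 m = 0 := by
  simp [coef_eq]

theorem coef_ext {f g : L2} (h : ∀ m, coef f m = coef g m) : f = g := by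
  apply toSeq.injective
  ext m
  rw [toSeq_apply, toSeq_apply, h]

theorem coef_toL2 {w : ℝ → Plane} (h : MemLp w 2 circleMeasure) (m : ℤ) :
    coef (toL2 w) m = coeffC (fun θ => toC (w θ)) m := coeffC_toL2 h m

theorem coef_toL2_mode (m n : ℤ) (c : ℂ) :
    coef (toL2 (mode n c)) m = if n = m then c else 0 := coeffC_toL2_mode m n c

theorem norm_coef_le (f : L2) (m : ℤ) :
    ‖coef f m‖ ≤ (Real.sqrt (2 * Real.pi))⁻¹ * ‖f‖ := by
  rw [coef_eq, norm_smul, Real.norm_of_nonneg (inv_nonneg.2 sqrt_two_pi_pos.le),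
    ← toSeq.norm_map f]
  exact mul_le_mul_of_nonneg_left (lp.norm_apply_le_norm two_ne_zero _ _)
    (inv_nonneg.2 sqrt_two_pi_pos.le)

/-- The Fourier coefficient as a continuous linear map. -/
def coefCLM (m : ℤ) : L2 →L[ℝ] ℂ :=
  LinearMap.mkContinuous ⟨⟨fun f => coef f m, fun f g => coef_add f g m⟩,
    fun a f => coef_smul a f m⟩ _ fun f => norm_coef_le f m

theorem coefCLM_apply (m : ℤ) (f : L2) : coefCLM m f = coef f m := rfl

theorem continuous_coef (m : ℤ) : Continuous fun f : L2 => coef f m := (coefCLM m).continuous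

theorem hasSum_norm_sq_coef (f : L2) :
    HasSum (fun m => ‖coef f m‖ ^ 2) ((2 * Real.pi)⁻¹ * ‖f‖ ^ 2) := by
  have h := lp.hasSum_norm (p := 2) (by norm_num) (toSeq f)
  simp only [ENNReal.toReal_ofNat, Real.rpow_ofNat, toSeq.norm_map] at h
  refine (h.mul_left ((2 * Real.pi)⁻¹)).congr_fun ?_
  intro m
  rw [coef_eq, norm_smul, mul_pow, Real.norm_eq_abs, sq_abs, inv_pow,
    Real.sq_sqrt Real.two_pi_pos.le]

theorem hasSum_mode (f : L2) : HasSum (fun m => toL2 (mode m (coef f m))) f := by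
  have h := isHilbertSum_modeIso.hasSum_linearIsometryEquiv_symm (toSeq f)
  have h2 : isHilbertSum_modeIso.linearIsometryEquiv.symm (toSeq f) = f :=
    toSeq.symm_apply_apply f
  rw [h2] at h
  refine h.congr_fun fun m => ?_
  rw [toSeq_apply, map_smul, modeIso_apply, smul_smul, mul_inv_cancel₀ sqrt_two_pi_pos.ne',
    one_smul]

theorem inner_eq_tsum_coef (f g : L2) :
    inner ℝ f g = 2 * Real.pi * ∑' m, inner ℝ (coef f m) (coef g m) := by
  rw [← toSeq.inner_map_map, lp.inner_eq_tsum, ← tsum_mul_left]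
  refine tsum_congr fun m => ?_
  rw [toSeq_apply, toSeq_apply, inner_smul_left, inner_smul_right, conj_trivial, ← mul_assoc,
    Real.mul_self_sqrt Real.two_pi_pos.le]

/-- A square summable sequence is a sequence of Fourier coefficients. -/
theorem exists_coef_eq {x : ℤ → ℂ} (hx : Summable fun m => ‖x m‖ ^ 2) :
    ∃ f : L2, ∀ m, coef f m = x m := by
  have hm : Memℓp (fun m => (Real.sqrt (2 * Real.pi) : ℝ) • x m) 2 := by
    refine memℓp_gen ?_
    simp only [norm_smul, ENNReal.toReal_ofNat, Real.rpow_ofNat, mul_pow]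
    exact hx.mul_left _
  refine ⟨toSeq.symm ⟨_, hm⟩, fun m => ?_⟩
  rw [coef_eq, LinearIsometryEquiv.apply_symm_apply]
  exact inv_smul_smul₀ sqrt_two_pi_pos.ne' _

theorem exists_multiplier_apply {a : ℤ → ℝ} {B : ℝ} (ha : ∀ m, |a m| ≤ B) (f : L2) :
    ∃ g : L2, ∀ m, coef g m = a m • coef f m := by
  refine exists_coef_eq ?_
  refine Summable.of_nonneg_of_le (fun _ => by positivity) (fun m => ?_)
    ((hasSum_norm_sq_coef f).summable.mul_left (B ^ 2))
  rw [norm_smul, mul_pow, Real.norm_eq_abs]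
  exact mul_le_mul_of_nonneg_right (pow_le_pow_left₀ (abs_nonneg _) (ha m) 2) (by positivity)

/-- Bounded real sequences are Fourier multipliers. -/
theorem exists_multiplier {a : ℤ → ℝ} {B : ℝ} (ha : ∀ m, |a m| ≤ B) :
    ∃ T : L2 →L[ℝ] L2, ∀ f m, coef (T f) m = a m • coef f m := by
  choose T hT using exists_multiplier_apply ha
  have hB : 0 ≤ B := (abs_nonneg _).trans (ha 0)
  refine ⟨LinearMap.mkContinuous ⟨⟨T, fun f g => coef_ext fun m => ?_⟩,
    fun c f => coef_ext fun m => ?_⟩ B fun f => ?_, hT⟩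
  · rw [hT, coef_add, coef_add, hT, hT, smul_add]
  · simp only [hT, coef_smul, RingHom.id_apply]
    rw [smul_comm]
  · have h1 := hasSum_norm_sq_coef (T f)
    have h2 := (hasSum_norm_sq_coef f).mul_left (B ^ 2)
    have h3 := hasSum_le (fun m => ?_) h1 h2
    · have : ‖T f‖ ^ 2 ≤ (B * ‖f‖) ^ 2 := by
        rw [mul_left_comm, ← mul_pow] at h3
        exact le_of_mul_le_mul_left h3 (inv_pos.2 Real.two_pi_pos)
      exact (pow_le_pow_iff_left₀ (norm_nonneg _) (by positivity) two_ne_zero).1 this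
    · rw [hT, norm_smul, mul_pow, Real.norm_eq_abs]
      exact mul_le_mul_of_nonneg_right (pow_le_pow_left₀ (abs_nonneg _) (ha m) 2) (by positivity)

/-! ### Hölder norms as bounds -/

theorem norm_iteratedDeriv_le {α : ℝ} {u : ℝ → Plane} (h : holderNorm α u < ⊤) {l : ℕ}
    (hl : l ≤ ⌊α⌋₊) (θ : ℝ) : ‖iteratedDeriv l u θ‖ ≤ (holderNorm α u).toReal := by
  rw [← toReal_enorm]
  refine ENNReal.toReal_mono h.ne ?_
  calc ‖iteratedDeriv l u θ‖ₑ ≤ ⨆ θ : ℝ, ‖iteratedDeriv l u θ‖ₑ :=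
        le_iSup (fun θ => ‖iteratedDeriv l u θ‖ₑ) θ
    _ ≤ ∑ l ∈ Finset.range (⌊α⌋₊ + 1), ⨆ θ : ℝ, ‖iteratedDeriv l u θ‖ₑ :=
        Finset.single_le_sum (f := fun l => ⨆ θ : ℝ, ‖iteratedDeriv l u θ‖ₑ)
          (fun _ _ => zero_le) (Finset.mem_range.2 (Nat.lt_succ_of_le hl))
    _ ≤ holderNorm α u := le_self_add

theorem norm_iteratedDeriv_sub_le {α : ℝ} {u : ℝ → Plane} (h : holderNorm α u < ⊤)
    (hα : α ≠ (⌊α⌋₊ : ℝ)) {θ θ' : ℝ} (h0 : 0 < |θ - θ'|) (h1 : |θ - θ'| < 1) :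
    ‖iteratedDeriv ⌊α⌋₊ u θ - iteratedDeriv ⌊α⌋₊ u θ'‖ ≤
      (holderNorm α u).toReal * |θ - θ'| ^ (α - ⌊α⌋₊) := by
  have hp : 0 < |θ - θ'| ^ (α - ⌊α⌋₊) := Real.rpow_pos_of_pos h0 _
  have hle : ‖iteratedDeriv ⌊α⌋₊ u θ - iteratedDeriv ⌊α⌋₊ u θ'‖ₑ /
      ENNReal.ofReal (|θ - θ'| ^ (α - ⌊α⌋₊)) ≤ holderNorm α u := by
    rw [holderNorm, if_neg hα]
    refine le_trans ?_ le_add_self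
    rw [holderSeminorm]
    exact le_iSup_of_le θ (le_iSup_of_le θ' (le_iSup_of_le ⟨h0, h1⟩ le_rfl))
  rw [ENNReal.div_le_iff (by simpa using hp) ENNReal.ofReal_ne_top] at hle
  have := ENNReal.toReal_mono (ENNReal.mul_ne_top h.ne ENNReal.ofReal_ne_top) hle
  rwa [ENNReal.toReal_mul, ENNReal.toReal_ofReal hp.le, toReal_enorm] at this

theorem holderNorm_le_of_bounds {α : ℝ} {u : ℝ → Plane} {M : ℝ} (hM : 0 ≤ M)
    (h1 : ∀ l ≤ ⌊α⌋₊, ∀ θ, ‖iteratedDeriv l u θ‖ ≤ M)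
    (h2 : α ≠ (⌊α⌋₊ : ℝ) → ∀ θ θ' : ℝ, 0 < |θ - θ'| → |θ - θ'| < 1 →
      ‖iteratedDeriv ⌊α⌋₊ u θ - iteratedDeriv ⌊α⌋₊ u θ'‖ ≤ M * |θ - θ'| ^ (α - ⌊α⌋₊)) :
    holderNorm α u ≤ ENNReal.ofReal ((⌊α⌋₊ + 2) * M) := by
  have e1 : ∑ l ∈ Finset.range (⌊α⌋₊ + 1), ⨆ θ : ℝ, ‖iteratedDeriv l u θ‖ₑ ≤
      (⌊α⌋₊ + 1 : ℕ) * ENNReal.ofReal M := by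
    refine (Finset.sum_le_card_nsmul _ _ (ENNReal.ofReal M) fun l hl => ?_).trans_eq ?_
    · refine iSup_le fun θ => ?_
      rw [← ofReal_norm]
      exact ENNReal.ofReal_le_ofReal (h1 l (Nat.le_of_lt_succ (Finset.mem_range.1 hl)) θ)
    · rw [Finset.card_range, nsmul_eq_mul]
  have e2 : (if α = (⌊α⌋₊ : ℝ) then 0 else
      holderSeminorm (α - ⌊α⌋₊) (iteratedDeriv ⌊α⌋₊ u)) ≤ ENNReal.ofReal M := by
    split_ifs with hα
    · exact zero_le
    · refine iSup_le fun θ => iSup_le fun θ' => iSup_le fun h => ?_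
      have hp : 0 < |θ - θ'| ^ (α - ⌊α⌋₊) := Real.rpow_pos_of_pos h.1 _
      rw [ENNReal.div_le_iff (by simpa using hp) ENNReal.ofReal_ne_top, ← ENNReal.ofReal_mul hM,
        ← ofReal_norm]
      exact ENNReal.ofReal_le_ofReal (h2 hα θ θ' h.1 h.2)
  refine (add_le_add e1 e2).trans_eq ?_
  have : ((⌊α⌋₊ : ℝ) + 2) * M = ((⌊α⌋₊ + 1 : ℕ) : ℝ) * M + M := by push_cast; ring
  rw [this, ENNReal.ofReal_add (by positivity) hM, ENNReal.ofReal_mul (by positivity),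
    ENNReal.ofReal_natCast]

/-- Hölder continuity at small distances, together with a bound, gives it at all distances. -/
theorem norm_sub_le_of_local {E : Type*} [NormedAddCommGroup E] {f : ℝ → E} {N a : ℝ}
    (hN : 0 ≤ N) (ha : 0 ≤ a)
    (h0 : ∀ θ, ‖f θ‖ ≤ N)
    (h1 : ∀ θ θ' : ℝ, 0 < |θ - θ'| → |θ - θ'| < 1 → ‖f θ - f θ'‖ ≤ N * |θ - θ'| ^ a)
    (θ θ' : ℝ) : ‖f θ - f θ'‖ ≤ 2 * N * |θ - θ'| ^ a := by
  rcases eq_or_ne θ θ' with rfl | hne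
  · simp only [sub_self, norm_zero]; positivity
  have hpos : 0 < |θ - θ'| := abs_pos.2 (sub_ne_zero.2 hne)
  have hr := Real.rpow_nonneg hpos.le a
  by_cases hlt : |θ - θ'| < 1
  · refine (h1 θ θ' hpos hlt).trans ?_
    nlinarith
  · have : 1 ≤ |θ - θ'| ^ a := Real.one_le_rpow (not_lt.1 hlt) ha
    have h2 := norm_sub_le (f θ) (f θ')
    have := h0 θ
    have := h0 θ'
    nlinarith

theorem floor_one_add {γ : ℝ} (h0 : 0 < γ) (h1 : γ < 1) : ⌊1 + γ⌋₊ = 1 := by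
  rw [Nat.floor_eq_iff (by linarith)]
  norm_num
  exact ⟨h0.le, by linarith⟩

/-- The consequences of `Y ∈ C^{1,γ}` used below. -/
structure HolderOne (γ M : ℝ) (Y : ℝ → Plane) : Prop where
  periodic : Function.Periodic Y (2 * Real.pi)
  contDiff : ContDiff ℝ 1 Y
  nonneg : 0 ≤ M
  norm_le : ∀ θ, ‖Y θ‖ ≤ M
  norm_deriv_le : ∀ θ, ‖deriv Y θ‖ ≤ M
  norm_deriv_sub_le : ∀ θ θ', ‖deriv Y θ - deriv Y θ'‖ ≤ M * |θ - θ'| ^ γ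

theorem MemHolder.exists_holderOne {γ : ℝ} {Y : ℝ → Plane} (h0 : 0 < γ) (h1 : γ < 1)
    (h : MemHolder (1 + γ) Y) : ∃ M, HolderOne γ M Y := by
  obtain ⟨hp, hc, hn⟩ := h
  set N := (holderNorm (1 + γ) Y).toReal with hN
  have hN0 : 0 ≤ N := ENNReal.toReal_nonneg
  have b0 := fun θ => norm_iteratedDeriv_le hn (l := 0) (Nat.zero_le _) θ
  have b1 := fun θ => norm_iteratedDeriv_le hn (l := 1) (floor_one_add h0 h1).ge θ
  have b2 := fun θ θ' => norm_iteratedDeriv_sub_le hn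
    (by rw [floor_one_add h0 h1]; push_cast; linarith) (θ := θ) (θ' := θ')
  rw [floor_one_add h0 h1] at hc b2
  simp only [iteratedDeriv_zero, iteratedDeriv_one, Nat.cast_one, add_sub_cancel_left,
    ← hN] at b0 b1 b2
  refine ⟨2 * N, hp, by exact_mod_cast hc, by positivity, fun θ => (b0 θ).trans (by linarith),
    fun θ => (b1 θ).trans (by linarith), ?_⟩
  exact norm_sub_le_of_local hN0 h0.le b1 b2

/-! ### The cotangent kernel -/

theorem abs_cot_half_le {φ : ℝ} (h0 : 0 < φ) (h1 : φ ≤ Real.pi) :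
    |Real.cot (φ / 2)| ≤ Real.pi * φ⁻¹ := by
  have hs : φ / Real.pi ≤ Real.sin (φ / 2) := by
    have := Real.mul_le_sin (x := φ / 2) (by linarith) (by linarith)
    calc φ / Real.pi = 2 / Real.pi * (φ / 2) := by ring
      _ ≤ _ := this
  have hp : 0 < φ / Real.pi := by positivity
  rw [Real.cot_eq_cos_div_sin, abs_div, abs_of_pos (hp.trans_le hs)]
  calc |Real.cos (φ / 2)| / Real.sin (φ / 2) ≤ 1 / (φ / Real.pi) :=
        div_le_div₀ zero_le_one (Real.abs_cos_le_one _) hp hs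
    _ = Real.pi * φ⁻¹ := by field_simp

theorem sin_half_pos {φ : ℝ} (h0 : 0 < φ) (h1 : φ ≤ Real.pi) : 0 < Real.sin (φ / 2) :=
  Real.sin_pos_of_pos_of_lt_pi (by linarith) (by linarith [Real.pi_pos])

theorem continuousOn_cot_half : ContinuousOn (fun φ : ℝ => Real.cot (φ / 2)) (Ioc 0 Real.pi) := by
  simp only [Real.cot_eq_cos_div_sin]
  exact (by fun_prop : Continuous fun φ : ℝ => Real.cos (φ / 2)).continuousOn.div
    (by fun_prop : Continuous fun φ : ℝ => Real.sin (φ / 2)).continuousOn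
    fun φ h => (sin_half_pos h.1 h.2).ne'

section Hilbert

variable {E : Type*} [NormedAddCommGroup E] [NormedSpace ℝ E]

/-- The Hilbert transform as an absolutely convergent integral. -/
def hilbertInt (w : ℝ → E) (θ : ℝ) : E :=
  (1 / (2 * Real.pi)) • ∫ φ in (0 : ℝ)..Real.pi, Real.cot (φ / 2) • (w (θ - φ) - w (θ + φ))

/-- Folding the principal value about `θ` pairs the odd kernel with `w (θ - φ) - w (θ + φ)`, whose
size φ^γ leaves an integrable singularity φ^{γ-1} out of 1/φ. The constant uses 2^γ ≤ 2. -/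
theorem norm_cot_smul_le {w : ℝ → E} {M γ : ℝ} (hM : 0 ≤ M) (hγ : γ ≤ 1)
    (hw : ∀ θ θ', ‖w θ - w θ'‖ ≤ M * |θ - θ'| ^ γ) (θ : ℝ) {φ : ℝ} (h0 : 0 < φ)
    (h1 : φ ≤ Real.pi) :
    ‖Real.cot (φ / 2) • (w (θ - φ) - w (θ + φ))‖ ≤ 2 * Real.pi * M * φ ^ (γ - 1) := by
  have e : |θ - φ - (θ + φ)| = 2 * φ := by
    rw [show θ - φ - (θ + φ) = -(2 * φ) by ring, abs_neg, abs_of_pos (by linarith)]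
  have h2 : (2 : ℝ) ^ γ ≤ 2 := by
    simpa using Real.rpow_le_rpow_of_exponent_le (x := 2) (by norm_num) hγ
  have hφ := Real.rpow_nonneg h0.le γ
  rw [norm_smul, Real.norm_eq_abs]
  calc |Real.cot (φ / 2)| * ‖w (θ - φ) - w (θ + φ)‖
      ≤ (Real.pi * φ⁻¹) * (M * (2 * φ) ^ γ) := by
        refine mul_le_mul (abs_cot_half_le h0 h1) ?_ (norm_nonneg _) (by positivity)
        rw [← e]; exact hw _ _
    _ ≤ (Real.pi * φ⁻¹) * (M * (2 * φ ^ γ)) := by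
        rw [Real.mul_rpow (by norm_num) h0.le]
        gcongr
    _ = 2 * Real.pi * M * φ ^ (γ - 1) := by
        rw [Real.rpow_sub_one h0.ne']; ring

theorem intervalIntegrable_rpow_sub_one {γ : ℝ} (hγ : 0 < γ) (C a b : ℝ) :
    IntervalIntegrable (fun φ : ℝ => C * φ ^ (γ - 1)) volume a b :=
  (intervalIntegral.intervalIntegrable_rpow' (by linarith)).const_mul C

theorem intervalIntegrable_cot_smul {w : ℝ → E} {M γ : ℝ} (hM : 0 ≤ M)
    (hγ0 : 0 < γ) (hγ : γ ≤ 1) (hc : Continuous w)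
    (hw : ∀ θ θ', ‖w θ - w θ'‖ ≤ M * |θ - θ'| ^ γ) (θ : ℝ) :
    IntervalIntegrable (fun φ => Real.cot (φ / 2) • (w (θ - φ) - w (θ + φ))) volume 0 Real.pi := by
  have hb := intervalIntegrable_rpow_sub_one hγ0 (2 * Real.pi * M) 0 Real.pi
  refine hb.mono_fun' ?_ ?_
  · rw [uIoc_of_le Real.pi_pos.le]
    exact (continuousOn_cot_half.smul (by fun_prop)).aestronglyMeasurable measurableSet_Ioc
  · rw [uIoc_of_le Real.pi_pos.le]
    exact (ae_restrict_iff' measurableSet_Ioc).2 (ae_of_all _ fun φ h =>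
      norm_cot_smul_le hM hγ hw θ h.1 h.2)

theorem cot_neg (x : ℝ) : Real.cot (-x) = -Real.cot x := by
  simp [Real.cot_eq_cos_div_sin, div_neg]

/-- Substituting θ' = θ - φ and θ' = θ + φ in the two pieces and using that the cotangent is odd
folds them into one integral. -/
theorem truncated_hilbert_eq {w : ℝ → E} (hc : Continuous w) (θ : ℝ) {δ : ℝ} (hδ : 0 < δ)
    (hδ' : δ ≤ Real.pi) :
    (∫ θ' in (θ - Real.pi)..(θ - δ), Real.cot ((θ - θ') / 2) • w θ') +
        ∫ θ' in (θ + δ)..(θ + Real.pi), Real.cot ((θ - θ') / 2) • w θ' =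
      ∫ φ in δ..Real.pi, Real.cot (φ / 2) • (w (θ - φ) - w (θ + φ)) := by
  have hcot : ContinuousOn (fun φ : ℝ => Real.cot (φ / 2)) (uIcc δ Real.pi) :=
    continuousOn_cot_half.mono (by
      rw [uIcc_of_le hδ']; exact fun x hx => ⟨hδ.trans_le hx.1, hx.2⟩)
  have e1 := intervalIntegral.integral_comp_sub_left
    (fun θ' => Real.cot ((θ - θ') / 2) • w θ') θ (a := δ) (b := Real.pi)
  have e2 := intervalIntegral.integral_comp_add_left
    (fun θ' => Real.cot ((θ - θ') / 2) • w θ') θ (a := δ) (b := Real.pi)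
  rw [← e1, ← e2, ← intervalIntegral.integral_add]
  · refine intervalIntegral.integral_congr fun φ _ => ?_
    simp only [sub_sub_cancel, sub_add_cancel_left, neg_div, cot_neg, neg_smul, smul_sub]
    abel
  · simp only [sub_sub_cancel]
    exact (hcot.smul (by fun_prop)).intervalIntegrable
  · simp only [sub_add_cancel_left, neg_div, cot_neg]
    exact (hcot.neg.smul (by fun_prop)).intervalIntegrable

/-- After folding, the principal value is the value at 0 of the primitive of an integrable function,
and such a primitive is continuous. -/
theorem tendsto_truncated_hilbert {w : ℝ → E} {M γ : ℝ} (hM : 0 ≤ M)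
    (hγ0 : 0 < γ) (hγ : γ ≤ 1) (hc : Continuous w)
    (hw : ∀ θ θ', ‖w θ - w θ'‖ ≤ M * |θ - θ'| ^ γ) (θ : ℝ) :
    Tendsto (fun δ : ℝ => (1 / (2 * Real.pi)) •
      ((∫ θ' in (θ - Real.pi)..(θ - δ), Real.cot ((θ - θ') / 2) • w θ') +
        ∫ θ' in (θ + δ)..(θ + Real.pi), Real.cot ((θ - θ') / 2) • w θ'))
    (𝓝[>] 0) (𝓝 (hilbertInt w θ)) := by
  have hint := intervalIntegrable_cot_smul hM hγ0 hγ hc hw θ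
  have hcont := intervalIntegral.continuousOn_primitive_interval_left (a := 0) (b := Real.pi)
    (μ := volume) (f := fun φ => Real.cot (φ / 2) • (w (θ - φ) - w (θ + φ)))
    (by rw [uIcc_of_le Real.pi_pos.le]
        exact (intervalIntegrable_iff_integrableOn_Icc_of_le Real.pi_pos.le).1 hint)
  rw [uIcc_of_le Real.pi_pos.le] at hcont
  have h1 : Tendsto (fun δ => ∫ φ in δ..Real.pi, Real.cot (φ / 2) • (w (θ - φ) - w (θ + φ)))
      (𝓝[>] 0) (𝓝 (∫ φ in (0 : ℝ)..Real.pi, Real.cot (φ / 2) • (w (θ - φ) - w (θ + φ)))) := by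
    have := hcont 0 ⟨le_rfl, Real.pi_pos.le⟩
    refine (this.tendsto).mono_left ?_
    rw [← nhdsWithin_Ioc_eq_nhdsGT Real.pi_pos]
    exact nhdsWithin_mono _ Ioc_subset_Icc_self
  refine (h1.const_smul (1 / (2 * Real.pi))).congr' ?_
  filter_upwards [Ioc_mem_nhdsGT Real.pi_pos] with δ hδ
  rw [truncated_hilbert_eq hc θ hδ.1 hδ.2]

end Hilbert

theorem hasHilbertAt_of_holder {w : ℝ → Plane} {M γ : ℝ} (hM : 0 ≤ M)
    (hγ0 : 0 < γ) (hγ : γ ≤ 1) (hc : Continuous w)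
    (hw : ∀ θ θ', ‖w θ - w θ'‖ ≤ M * |θ - θ'| ^ γ) (θ : ℝ) :
    HasHilbertAt w θ (hilbertInt w θ) := tendsto_truncated_hilbert hM hγ0 hγ hc hw θ

theorem hilbert_eq_hilbertInt {w : ℝ → Plane} {M γ : ℝ} (hM : 0 ≤ M)
    (hγ0 : 0 < γ) (hγ : γ ≤ 1) (hc : Continuous w)
    (hw : ∀ θ θ', ‖w θ - w θ'‖ ≤ M * |θ - θ'| ^ γ) (θ : ℝ) :
    hilbert w θ = hilbertInt w θ := (hasHilbertAt_of_holder hM hγ0 hγ hc hw θ).limUnder_eq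

theorem toC_intervalIntegral (f : ℝ → Plane) (a b : ℝ) :
    toC (∫ x in a..b, f x) = ∫ x in a..b, toC (f x) := by
  have h : ∀ s : Set ℝ, toC (∫ x in s, f x) = ∫ x in s, toC (f x) := fun s =>
    (toC.toContinuousLinearEquiv.integral_comp_comm f).symm
  rw [intervalIntegral, intervalIntegral, map_sub, h, h]

theorem toC_hilbertInt (w : ℝ → Plane) (θ : ℝ) :
    toC (hilbertInt w θ) = hilbertInt (fun s => toC (w s)) θ := by
  simp only [hilbertInt, map_smul, toC_intervalIntegral, map_sub]

/-! ### Bounded Hölder continuous functions -/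

/-- Bounded functions which are Hölder continuous of exponent `γ`. -/
def HolderBdd {E : Type*} [NormedAddCommGroup E] (γ : ℝ) (w : ℝ → E) : Prop :=
  Continuous w ∧ ∃ M, 0 ≤ M ∧ (∀ θ, ‖w θ‖ ≤ M) ∧ ∀ θ θ', ‖w θ - w θ'‖ ≤ M * |θ - θ'| ^ γ

theorem HolderBdd.add {E : Type*} [NormedAddCommGroup E] {γ : ℝ} {v w : ℝ → E}
    (hv : HolderBdd γ v) (hw : HolderBdd γ w) : HolderBdd γ (fun θ => v θ + w θ) := by
  obtain ⟨cv, M, hM, a1, a2⟩ := hv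
  obtain ⟨cw, N, hN, b1, b2⟩ := hw
  refine ⟨cv.add cw, M + N, add_nonneg hM hN, fun θ => ?_, fun θ θ' => ?_⟩
  · exact (norm_add_le _ _).trans (add_le_add (a1 θ) (b1 θ))
  · rw [add_sub_add_comm, add_mul]
    exact (norm_add_le _ _).trans (add_le_add (a2 θ θ') (b2 θ θ'))

theorem HolderBdd.mul {γ : ℝ} {v w : ℝ → ℂ}
    (hv : HolderBdd γ v) (hw : HolderBdd γ w) : HolderBdd γ (fun θ => v θ * w θ) := by
  obtain ⟨cv, M, hM, a1, a2⟩ := hv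
  obtain ⟨cw, N, hN, b1, b2⟩ := hw
  refine ⟨cv.mul cw, 2 * (M * N), by positivity, fun θ => ?_, fun θ θ' => ?_⟩
  · rw [norm_mul]
    have := mul_le_mul (a1 θ) (b1 θ) (norm_nonneg _) hM
    have := mul_nonneg hM hN
    linarith
  · have e : v θ * w θ - v θ' * w θ' = (v θ - v θ') * w θ + v θ' * (w θ - w θ') := by ring
    rw [e]
    refine (norm_add_le _ _).trans ?_
    rw [norm_mul, norm_mul]
    have h1 := mul_le_mul (a2 θ θ') (b1 θ) (norm_nonneg _)
      (mul_nonneg hM (Real.rpow_nonneg (abs_nonneg _) _))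
    have h2 := mul_le_mul (a1 θ') (b2 θ θ') (norm_nonneg _) hM
    linarith

theorem HolderBdd.const {E : Type*} [NormedAddCommGroup E] (γ : ℝ) (c : E) :
    HolderBdd γ (fun _ : ℝ => c) :=
  ⟨continuous_const, ‖c‖, norm_nonneg _, fun _ => le_rfl, fun θ θ' => by
    rw [sub_self, norm_zero]; positivity⟩

theorem HolderBdd.of_lipschitz {E : Type*} [NormedAddCommGroup E] {γ L : ℝ} {w : ℝ → E}
    (hγ0 : 0 ≤ γ) (hγ : γ ≤ 1) (hb : ∀ θ, ‖w θ‖ ≤ L)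
    (hw : ∀ θ θ', ‖w θ - w θ'‖ ≤ L * |θ - θ'|) : HolderBdd γ w := by
  have hL : 0 ≤ L := (norm_nonneg _).trans (hb 0)
  refine ⟨?_, 2 * L, by positivity, fun θ => (hb θ).trans (by linarith),
    norm_sub_le_of_local hL hγ0 hb fun θ θ' h0 h1 => (hw θ θ').trans ?_⟩
  · have : LipschitzWith (Real.toNNReal L) w := LipschitzWith.of_dist_le_mul fun x y => by
      rw [dist_eq_norm, Real.dist_eq, Real.coe_toNNReal _ hL]; exact hw x y
    exact this.continuous
  · gcongr
    simpa using Real.rpow_le_rpow_of_exponent_ge h0 h1.le hγ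

theorem norm_sub_le_of_hasDerivAt {E : Type*} [NormedAddCommGroup E] [NormedSpace ℝ E]
    {f f' : ℝ → E} {L : ℝ}
    (hf : ∀ θ, HasDerivAt f (f' θ) θ) (hL : ∀ θ, ‖f' θ‖ ≤ L) (θ θ' : ℝ) :
    ‖f θ - f θ'‖ ≤ L * |θ - θ'| :=
  Convex.norm_image_sub_le_of_norm_hasDerivWithin_le (s := univ)
    (fun x _ => (hf x).hasDerivWithinAt) (fun x _ => hL x) convex_univ (mem_univ _) (mem_univ _)

theorem holderBdd_chr {γ : ℝ} (hγ0 : 0 ≤ γ) (hγ : γ ≤ 1) (m : ℤ) : HolderBdd γ (chr m) := by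
  refine HolderBdd.of_lipschitz (L := 1 + |(m : ℝ)|) hγ0 hγ (fun θ => ?_) ?_
  · rw [norm_chr]; linarith [abs_nonneg (m : ℝ)]
  · refine norm_sub_le_of_hasDerivAt (hasDerivAt_chr m) fun θ => ?_
    rw [norm_mul, norm_mul, norm_chr, Complex.norm_I, mul_one, mul_one, Complex.norm_intCast]
    linarith

theorem HolderBdd.intervalIntegrable {γ : ℝ} (hγ0 : 0 < γ) (hγ : γ ≤ 1) {w : ℝ → ℂ}
    (hw : HolderBdd γ w) (θ : ℝ) :
    IntervalIntegrable (fun φ => Real.cot (φ / 2) • (w (θ - φ) - w (θ + φ))) volume 0 Real.pi := by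
  obtain ⟨hc, M, hM, -, h⟩ := hw
  exact intervalIntegrable_cot_smul hM hγ0 hγ hc h θ

/-! ### The Hilbert transform of the characters -/

/-- This identity removes the singularity: the difference of two cotangent integrals whose
frequencies differ by one becomes an ordinary trigonometric integral. -/
theorem cot_mul_chr_sub_one {φ : ℝ} (h0 : 0 < φ) (h1 : φ ≤ Real.pi) :
    (Real.cot (φ / 2) : ℂ) * (chr 1 φ - 1) = Complex.I * (chr 1 φ + 1) := by
  have hs : (Real.sin (φ / 2) : ℂ) ≠ 0 := by exact_mod_cast (sin_half_pos h0 h1).ne'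
  have e1 : Real.cos φ = 2 * Real.cos (φ / 2) ^ 2 - 1 := by
    rw [← Real.cos_two_mul]; congr 1; ring
  have e2 : Real.sin φ = 2 * Real.sin (φ / 2) * Real.cos (φ / 2) := by
    rw [← Real.sin_two_mul]; congr 1; ring
  have e3 : (Real.sin (φ / 2) : ℂ) ^ 2 + (Real.cos (φ / 2) : ℂ) ^ 2 = 1 := by
    exact_mod_cast Real.sin_sq_add_cos_sq (φ / 2)
  rw [chr_one, Real.cot_eq_cos_div_sin, e1, e2]
  push_cast at *
  field_simp
  linear_combination (2 * Complex.cos (φ / 2)) * e3 -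
    2 * Complex.sin (φ / 2) ^ 2 * Complex.cos (φ / 2) * Complex.I_sq

theorem cot_mul_chr_neg_sub_one {φ : ℝ} (h0 : 0 < φ) (h1 : φ ≤ Real.pi) :
    (Real.cot (φ / 2) : ℂ) * (chr (-1) φ - 1) = -Complex.I * (chr (-1) φ + 1) := by
  have := congrArg (starRingEnd ℂ) (cot_mul_chr_sub_one h0 h1)
  rwa [map_mul, map_mul, map_sub, map_add, map_one, conj_chr, Complex.conj_ofReal,
    Complex.conj_I] at this

theorem integral_add_neg {h : ℝ → ℂ} (hh : Continuous h) (a : ℝ) :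
    ∫ φ in (0 : ℝ)..a, (h φ + h (-φ)) = ∫ φ in (-a)..a, h φ := by
  rw [intervalIntegral.integral_add (hh.intervalIntegrable _ _)
    ((by fun_prop : Continuous fun φ => h (-φ)).intervalIntegrable _ _),
    intervalIntegral.integral_comp_neg, neg_zero,
    add_comm, intervalIntegral.integral_add_adjacent_intervals (hh.intervalIntegrable _ _)
    (hh.intervalIntegrable _ _)]

theorem integral_sub_left_periodic {E : Type*} [NormedAddCommGroup E] [NormedSpace ℝ E]
    {h : ℝ → E} (hp : Function.Periodic h (2 * Real.pi)) (θ : ℝ) :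
    ∫ φ in (-Real.pi)..Real.pi, h (θ - φ) = ∫ φ in (0 : ℝ)..(2 * Real.pi), h φ := by
  rw [intervalIntegral.integral_comp_sub_left]
  have := hp.intervalIntegral_add_eq (θ - Real.pi) 0
  rw [zero_add] at this
  rw [← this]
  congr 1
  ring

theorem integral_chr_symm (m : ℤ) :
    ∫ φ in (-Real.pi)..Real.pi, chr m φ = if m = 0 then (2 * Real.pi : ℂ) else 0 := by
  have := integral_sub_left_periodic (chr_periodic (-m)) 0
  simp only [zero_sub, chr_neg, neg_neg, integral_chr, neg_eq_zero] at this
  exact this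

/-- The integral which gives the symbol of the Hilbert transform. -/
def hilbertSymbol (m : ℤ) : ℂ :=
  ∫ φ in (0 : ℝ)..Real.pi, Real.cot (φ / 2) • (chr (-m) φ - chr m φ)

theorem intervalIntegrable_hilbertSymbol (m : ℤ) :
    IntervalIntegrable (fun φ => Real.cot (φ / 2) • (chr (-m) φ - chr m φ)) volume 0 Real.pi := by
  have := (holderBdd_chr zero_le_one le_rfl m).intervalIntegrable zero_lt_one le_rfl 0
  simpa only [zero_sub, zero_add, chr_neg] using this

/-- A recursion in place of a direct evaluation: consecutive symbols differ by the integral of two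
characters, so the symbol jumps only between -1, 0 and 1. Together with its vanishing at 0 and its
oddness this gives a multiple of the sign. -/
theorem hilbertSymbol_succ_sub (m : ℤ) : hilbertSymbol (m + 1) - hilbertSymbol m =
    -Complex.I * ((if m + 1 = 0 then (2 * Real.pi : ℂ) else 0) +
      if m = 0 then (2 * Real.pi : ℂ) else 0) := by
  rw [hilbertSymbol, hilbertSymbol, ← intervalIntegral.integral_sub
    (intervalIntegrable_hilbertSymbol _) (intervalIntegrable_hilbertSymbol _)]
  have hc : Continuous fun φ => chr (m + 1) φ + chr m φ :=
    (continuous_chr (m + 1)).add (continuous_chr m)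
  have e : ∫ φ in (0 : ℝ)..Real.pi, (Real.cot (φ / 2) • (chr (-(m + 1)) φ - chr (m + 1) φ) -
      Real.cot (φ / 2) • (chr (-m) φ - chr m φ)) = ∫ φ in (0 : ℝ)..Real.pi,
        -Complex.I * ((chr (m + 1) φ + chr m φ) + (chr (m + 1) (-φ) + chr m (-φ))) := by
    refine intervalIntegral.integral_congr_ae (ae_of_all _ fun φ hφ => ?_)
    rw [uIoc_of_le Real.pi_pos.le] at hφ
    have h1 := cot_mul_chr_sub_one hφ.1 hφ.2
    have h2 := cot_mul_chr_neg_sub_one hφ.1 hφ.2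
    rw [Complex.real_smul, Complex.real_smul, chr_neg, chr_neg, neg_add, ← chr_mul (-m) (-1),
      ← chr_mul m 1]
    linear_combination chr (-m) φ * h2 - chr m φ * h1
  rw [e, intervalIntegral.integral_const_mul, integral_add_neg (h := fun φ => chr (m + 1) φ + chr m φ) hc,
    intervalIntegral.integral_add ((continuous_chr _).intervalIntegrable _ _)
    ((continuous_chr _).intervalIntegrable _ _), integral_chr_symm, integral_chr_symm]

theorem hilbertSymbol_neg (m : ℤ) : hilbertSymbol (-m) = -hilbertSymbol m := by
  rw [hilbertSymbol, hilbertSymbol, ← intervalIntegral.integral_neg]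
  refine intervalIntegral.integral_congr fun φ _ => ?_
  simp only [neg_neg]
  rw [← smul_neg, neg_sub]

theorem hilbertSymbol_natCast_succ (n : ℕ) :
    hilbertSymbol (n + 1) = -(2 * Real.pi * Complex.I) := by
  induction n with
  | zero =>
    have := hilbertSymbol_succ_sub 0
    have h0 : hilbertSymbol 0 = 0 := by simp [hilbertSymbol]
    rw [h0] at this
    norm_num at this
    simp [this]
    ring
  | succ n ih =>
    have := hilbertSymbol_succ_sub (n + 1)
    rw [ih, if_neg (by omega), if_neg (by omega)] at this
    push_cast
    linear_combination this

theorem hilbertSymbol_eq (m : ℤ) : hilbertSymbol m = -(2 * Real.pi * Complex.I) * m.sign := by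
  rcases lt_trichotomy m 0 with h | h | h
  · obtain ⟨n, hn⟩ := Int.eq_ofNat_of_zero_le (a := -m - 1) (by omega)
    have : m = -((n : ℤ) + 1) := by omega
    rw [Int.sign_eq_neg_one_of_neg h, this, hilbertSymbol_neg, hilbertSymbol_natCast_succ]
    push_cast; ring
  · subst h; simp [hilbertSymbol]
  · obtain ⟨n, hn⟩ := Int.eq_ofNat_of_zero_le (a := m - 1) (by omega)
    have : m = (n : ℤ) + 1 := by omega
    rw [Int.sign_eq_one_of_pos h, this, hilbertSymbol_natCast_succ]
    push_cast; ring

theorem hilbertInt_chr (c : ℂ) (m : ℤ) (θ : ℝ) :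
    hilbertInt (fun s => c * chr m s) θ = -Complex.I * m.sign * (c * chr m θ) := by
  have : ∀ φ : ℝ, Real.cot (φ / 2) • (c * chr m (θ - φ) - c * chr m (θ + φ)) =
      (c * chr m θ) * (Real.cot (φ / 2) • (chr (-m) φ - chr m φ)) := fun φ => by
    rw [chr_sub, chr_add, Complex.real_smul, Complex.real_smul]; ring
  simp_rw [hilbertInt, this]
  rw [intervalIntegral.integral_const_mul, ← hilbertSymbol, hilbertSymbol_eq, Complex.real_smul]
  have := two_pi_ne
  push_cast
  field_simp

/-! ### Fourier coefficients of a Hilbert transform -/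

theorem coeffC_comp_sub {u : ℝ → ℂ} (hp : Function.Periodic u (2 * Real.pi)) (m : ℤ) (φ : ℝ) :
    coeffC (fun θ => u (θ - φ)) m = chr (-m) φ * coeffC u m := by
  have hp' : Function.Periodic (fun θ => chr (-m) (θ + φ) * u θ) (2 * Real.pi) := fun θ => by
    simp only [add_right_comm, chr_periodic (-m) (θ + φ), hp θ]
  have e : ∀ θ, chr (-m) θ * u (θ - φ) = (fun s => chr (-m) (s + φ) * u s) (θ - φ) := fun θ => by
    simp
  rw [coeffC, coeffC]
  simp_rw [e]
  rw [intervalIntegral.integral_comp_sub_right (fun s => chr (-m) (s + φ) * u s)]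
  have := hp'.intervalIntegral_add_eq (0 - φ) 0
  rw [zero_add] at this
  rw [show 2 * Real.pi - φ = 0 - φ + 2 * Real.pi by ring, this, mul_left_comm]
  congr 1
  rw [← intervalIntegral.integral_const_mul]
  refine intervalIntegral.integral_congr fun s _ => ?_
  simp only [chr_add]; ring

theorem coeffC_comp_add {u : ℝ → ℂ} (hp : Function.Periodic u (2 * Real.pi)) (m : ℤ) (φ : ℝ) :
    coeffC (fun θ => u (θ + φ)) m = chr m φ * coeffC u m := by
  have := coeffC_comp_sub hp m (-φ)
  simpa [chr_neg] using this

/-- Fubini on the folded kernel, legitimate because of the majorant φ^{γ-1}: translating `u`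
multiplies its coefficient by a character, and what is left is the integral `hilbertSymbol`. -/
theorem coeffC_hilbertInt {γ : ℝ} (hγ0 : 0 < γ) (hγ : γ ≤ 1) {u : ℝ → ℂ} (hu : HolderBdd γ u)
    (hp : Function.Periodic u (2 * Real.pi)) (m : ℤ) :
    coeffC (hilbertInt u) m = -Complex.I * m.sign * coeffC u m := by
  obtain ⟨hc, M, hM, hb, hh⟩ := hu
  set K : ℝ → ℝ → ℂ := fun θ φ => chr (-m) θ * (Real.cot (φ / 2) • (u (θ - φ) - u (θ + φ)))
    with hK
  have hint : Integrable (Function.uncurry K)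
      ((volume.restrict (Ioc 0 (2 * Real.pi))).prod (volume.restrict (Ioc 0 Real.pi))) := by
    have hb := (intervalIntegrable_rpow_sub_one hγ0 (2 * Real.pi * M) 0 Real.pi)
    rw [intervalIntegrable_iff_integrableOn_Ioc_of_le Real.pi_pos.le] at hb
    have hb2 := Integrable.comp_snd hb (volume.restrict (Ioc 0 (2 * Real.pi)))
    rw [Measure.prod_restrict] at hb2 ⊢
    refine hb2.mono' ?_ ?_
    · refine ContinuousOn.aestronglyMeasurable ?_ (measurableSet_Ioc.prod measurableSet_Ioc)
      refine ContinuousOn.mul ((continuous_chr _).comp continuous_fst).continuousOn ?_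
      refine ContinuousOn.smul (continuousOn_cot_half.comp continuousOn_snd fun p hp => hp.2) ?_
      exact (by fun_prop : Continuous fun p : ℝ × ℝ => u (p.1 - p.2) - u (p.1 + p.2)).continuousOn
    · refine (ae_restrict_iff' (measurableSet_Ioc.prod measurableSet_Ioc)).2
        (ae_of_all _ fun p hp => ?_)
      simp only [Function.uncurry, hK]
      rw [norm_mul, norm_chr, one_mul]
      exact norm_cot_smul_le hM hγ hh p.1 hp.2.1 hp.2.2
  have hswap := integral_integral_swap hint
  have h1 : ∫ θ in (0 : ℝ)..(2 * Real.pi), ∫ φ in (0 : ℝ)..Real.pi, K θ φ =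
      ∫ φ in (0 : ℝ)..Real.pi, ∫ θ in (0 : ℝ)..(2 * Real.pi), K θ φ := by
    simpa only [intervalIntegral.integral_of_le Real.pi_pos.le,
      intervalIntegral.integral_of_le Real.two_pi_pos.le] using hswap
  have h2 : ∀ φ, ∫ θ in (0 : ℝ)..(2 * Real.pi), K θ φ =
      (2 * Real.pi * coeffC u m) * (Real.cot (φ / 2) • (chr (-m) φ - chr m φ)) := by
    intro φ
    have e1 := coeffC_comp_sub hp m φ
    have e2 := coeffC_comp_add hp m φ
    have e3 := coeffC_sub (f := fun θ => u (θ - φ)) (g := fun θ => u (θ + φ))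
      ((by fun_prop : Continuous fun θ => u (θ - φ)).intervalIntegrable _ _)
      ((by fun_prop : Continuous fun θ => u (θ + φ)).intervalIntegrable _ _) m
    rw [e1, e2, coeffC] at e3
    simp only [hK, Complex.real_smul]
    simp_rw [mul_left_comm (chr (-m) _)]
    rw [intervalIntegral.integral_const_mul]
    have h0 := two_pi_ne
    rw [inv_mul_eq_iff_eq_mul₀ h0] at e3
    rw [e3]; ring
  have h3 : ∀ θ, chr (-m) θ * hilbertInt u θ =
      (2 * Real.pi : ℂ)⁻¹ * ∫ φ in (0 : ℝ)..Real.pi, K θ φ := by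
    intro θ
    simp only [hK]
    rw [intervalIntegral.integral_const_mul, hilbertInt, Complex.real_smul]
    push_cast; ring
  rw [coeffC]
  simp_rw [h3]
  rw [intervalIntegral.integral_const_mul, h1]
  simp_rw [h2]
  rw [intervalIntegral.integral_const_mul, ← hilbertSymbol, hilbertSymbol_eq]
  have h0 := two_pi_ne
  field_simp

/-! ### The operator `R_θ Λ R_θ⁻¹ Π` in complex notation -/

theorem toC_er (θ : ℝ) : toC (er θ) = chr 1 θ := by
  rw [toC_apply, chr_one]; simp [er]

theorem toC_et (θ : ℝ) : toC (et θ) = Complex.I * chr 1 θ := by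
  rw [toC_apply, chr_one]
  simp only [et, PiLp.toLp_apply, Matrix.cons_val_zero, Matrix.cons_val_one]
  push_cast
  linear_combination -(Complex.sin θ) * Complex.I_sq

theorem toC_ex (θ : ℝ) : toC (ex θ) = 1 := by
  rw [toC_apply]; simp [ex]

theorem toC_ey (θ : ℝ) : toC (ey θ) = Complex.I := by
  rw [toC_apply]; simp [ey]

theorem toC_rot (w : ℝ → Plane) (θ : ℝ) : toC (rot w θ) = chr 1 θ * toC (w θ) := by
  rw [toC_apply, toC_apply, chr_one]
  simp only [rot, PiLp.toLp_apply, Matrix.cons_val_zero, Matrix.cons_val_one]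
  push_cast
  linear_combination -(Complex.sin θ) * (w θ 1) * Complex.I_sq

theorem toC_rotInv (w : ℝ → Plane) (θ : ℝ) : toC (rotInv w θ) = chr (-1) θ * toC (w θ) := by
  rw [toC_apply, toC_apply, ← conj_chr, chr_one]
  simp only [rotInv, PiLp.toLp_apply, Matrix.cons_val_zero, Matrix.cons_val_one]
  simp only [map_add, map_mul, Complex.conj_ofReal, Complex.conj_I]
  push_cast
  linear_combination (Complex.sin θ) * (w θ 1) * Complex.I_sq

theorem pairing_eq {w e : ℝ → Plane} {c : ℂ} {m : ℤ}
    (hw : IntervalIntegrable (fun θ => toC (w θ)) volume 0 (2 * Real.pi))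
    (he : ∀ θ, toC (e θ) = c * chr m θ) :
    pairing w e = 2 * Real.pi * ((starRingEnd ℂ) c * coeffC (fun θ => toC (w θ)) m).re := by
  have hi : IntervalIntegrable (fun θ => chr (-m) θ * toC (w θ)) volume 0 (2 * Real.pi) :=
    hw.continuousOn_mul (continuous_chr _).continuousOn
  have h1 : pairing w e = ∫ θ in (0 : ℝ)..(2 * Real.pi),
      Complex.reCLM ((starRingEnd ℂ) c * (chr (-m) θ * toC (w θ))) := by
    rw [pairing]
    refine intervalIntegral.integral_congr fun θ _ => ?_
    simp only [Complex.reCLM_apply]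
    rw [real_inner_comm, inner_toC, he, map_mul, conj_chr, mul_assoc]
  rw [h1, Complex.reCLM.intervalIntegral_comp_comm (hi.const_mul _),
    intervalIntegral.integral_const_mul, coeffC, Complex.reCLM_apply, mul_left_comm]
  have : (2 * Real.pi : ℂ)⁻¹ = (((2 * Real.pi)⁻¹ : ℝ) : ℂ) := by push_cast; ring
  rw [this, Complex.re_ofReal_mul, ← mul_assoc, mul_inv_cancel₀ Real.two_pi_pos.ne', one_mul]

theorem toC_projP {w : ℝ → Plane}
    (hw : IntervalIntegrable (fun θ => toC (w θ)) volume 0 (2 * Real.pi)) (θ : ℝ) :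
    toC (projP w θ) = coeffC (fun s => toC (w s)) 0 + coeffC (fun s => toC (w s)) 1 * chr 1 θ := by
  have h1 := pairing_eq (e := er) (c := 1) (m := 1) hw fun θ => by rw [toC_er, one_mul]
  have h2 := pairing_eq (e := et) (c := Complex.I) (m := 1) hw fun θ => toC_et θ
  have h3 := pairing_eq (e := ex) (c := 1) (m := 0) hw fun θ => by rw [toC_ex, chr_zero, one_mul]
  have h4 := pairing_eq (e := ey) (c := Complex.I) (m := 0) hw fun θ => by
    rw [toC_ey, chr_zero, mul_one]
  have hpi : (Real.pi : ℂ) ≠ 0 := by exact_mod_cast Real.pi_ne_zero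
  simp only [projP, map_smul, map_add, h1, h2, h3, h4, toC_er, toC_et, toC_ex, toC_ey,
    Complex.real_smul, map_one, one_mul, Complex.conj_I]
  set a := coeffC (fun s => toC (w s)) 0
  set b := coeffC (fun s => toC (w s)) 1
  have e : ∀ z : ℂ, (-Complex.I * z).re = z.im := fun z => by simp
  rw [e, e]
  conv_rhs => rw [← Complex.re_add_im a, ← Complex.re_add_im b]
  push_cast
  field_simp
  ring

theorem toC_projPi {w : ℝ → Plane}
    (hw : IntervalIntegrable (fun θ => toC (w θ)) volume 0 (2 * Real.pi)) (θ : ℝ) :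
    toC (projPi w θ) = toC (w θ) - (coeffC (fun s => toC (w s)) 0 +
      coeffC (fun s => toC (w s)) 1 * chr 1 θ) := by
  rw [projPi, map_sub, toC_projP hw]

/-- The Fourier coefficient of a derivative. -/
theorem coeffC_deriv {f f' : ℝ → ℂ} (hd : ∀ θ, HasDerivAt f (f' θ) θ) (hc : Continuous f')
    (hp : Function.Periodic f (2 * Real.pi)) (m : ℤ) :
    coeffC f' m = m * Complex.I * coeffC f m := by
  have hcf : Continuous f := continuous_iff_continuousAt.2 fun θ => (hd θ).continuousAt
  have h1 : ∀ θ ∈ uIcc (0 : ℝ) (2 * Real.pi), HasDerivAt (fun s => chr (-m) s * f s)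
      (((-m : ℤ) : ℂ) * Complex.I * chr (-m) θ * f θ + chr (-m) θ * f' θ) θ := fun θ _ =>
    (hasDerivAt_chr (-m) θ).mul (hd θ)
  have i1 : IntervalIntegrable (fun θ => ((-m : ℤ) : ℂ) * Complex.I * chr (-m) θ * f θ)
      volume 0 (2 * Real.pi) :=
    ((continuous_const.mul (continuous_chr _)).mul hcf).intervalIntegrable _ _
  have i2 : IntervalIntegrable (fun θ => chr (-m) θ * f' θ) volume 0 (2 * Real.pi) :=
    ((continuous_chr _).mul hc).intervalIntegrable _ _
  have h2 := intervalIntegral.integral_eq_sub_of_hasDerivAt h1 (i1.add i2)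
  have hp0 := hp 0
  have hp1 := chr_periodic (-m) 0
  rw [zero_add] at hp0 hp1
  rw [hp0, hp1, sub_self, intervalIntegral.integral_add i1 i2] at h2
  simp_rw [mul_assoc] at h2
  rw [intervalIntegral.integral_const_mul, intervalIntegral.integral_const_mul] at h2
  rw [coeffC, coeffC]
  push_cast at h2
  linear_combination (2 * Real.pi : ℂ)⁻¹ * h2

theorem hasDerivAt_of_toC {X : ℝ → Plane} {d : ℂ} {θ : ℝ}
    (h : HasDerivAt (fun s => toC (X s)) d θ) : HasDerivAt X (toC.symm d) θ := by
  have h1 : HasDerivAt (fun s => toC.symm (toC (X s))) (toC.symm d) θ :=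
    toC.symm.toContinuousLinearEquiv.toContinuousLinearMap.hasFDerivAt.comp_hasDerivAt θ h
  simpa only [LinearIsometryEquiv.symm_apply_apply] using h1

/-! ### Regularity and periodicity of the perturbation in complex notation -/

namespace HolderOne

variable {γ M : ℝ} {Y : ℝ → Plane}

theorem hasDerivAt (hY : HolderOne γ M Y) (θ : ℝ) : HasDerivAt Y (deriv Y θ) θ :=
  (hY.contDiff.differentiable one_ne_zero θ).hasDerivAt

theorem hasDerivAt_toC (hY : HolderOne γ M Y) (θ : ℝ) :
    HasDerivAt (fun s => toC (Y s)) (toC (deriv Y θ)) θ :=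
  toC.toContinuousLinearEquiv.toContinuousLinearMap.hasFDerivAt.comp_hasDerivAt θ (hY.hasDerivAt θ)

theorem continuous_deriv (hY : HolderOne γ M Y) : Continuous (deriv Y) :=
  hY.contDiff.continuous_deriv le_rfl

theorem deriv_periodic (hY : HolderOne γ M Y) : Function.Periodic (deriv Y) (2 * Real.pi) := by
  intro θ
  rw [← deriv_comp_add_const]
  congr 1
  funext s
  exact hY.periodic s

theorem norm_sub_le (hY : HolderOne γ M Y) (θ θ' : ℝ) : ‖Y θ - Y θ'‖ ≤ M * |θ - θ'| :=
  norm_sub_le_of_hasDerivAt hY.hasDerivAt hY.norm_deriv_le θ θ'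

theorem continuous_toC (hY : HolderOne γ M Y) : Continuous fun θ => toC (Y θ) :=
  toC.continuous.comp hY.contDiff.continuous

theorem continuous_toC_deriv (hY : HolderOne γ M Y) : Continuous fun θ => toC (deriv Y θ) :=
  toC.continuous.comp hY.continuous_deriv

theorem holderBdd_deriv (hY : HolderOne γ M Y) : HolderBdd γ (deriv Y) :=
  ⟨hY.continuous_deriv, M, hY.nonneg, hY.norm_deriv_le, hY.norm_deriv_sub_le⟩

theorem holderBdd_toC (hY : HolderOne γ M Y) (hγ0 : 0 ≤ γ) (hγ : γ ≤ 1) :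
    HolderBdd γ fun θ => toC (Y θ) :=
  HolderBdd.of_lipschitz hγ0 hγ (fun θ => by rw [toC.norm_map]; exact hY.norm_le θ) fun θ θ' => by
    rw [← map_sub, toC.norm_map]; exact hY.norm_sub_le θ θ'

theorem holderBdd_toC_deriv (hY : HolderOne γ M Y) : HolderBdd γ fun θ => toC (deriv Y θ) :=
  ⟨hY.continuous_toC_deriv, M, hY.nonneg,
    fun θ => by rw [toC.norm_map]; exact hY.norm_deriv_le θ, fun θ θ' => by
    rw [← map_sub, toC.norm_map]; exact hY.norm_deriv_sub_le θ θ'⟩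

theorem toC_periodic (hY : HolderOne γ M Y) :
    Function.Periodic (fun θ => toC (Y θ)) (2 * Real.pi) := fun θ => by
  simp only [hY.periodic θ]

theorem toC_deriv_periodic (hY : HolderOne γ M Y) :
    Function.Periodic (fun θ => toC (deriv Y θ)) (2 * Real.pi) := fun θ => by
  simp only [hY.deriv_periodic θ]

end HolderOne

/-- Conjugating the Hilbert transform with `exp (i θ)`. -/
theorem chr_mul_hilbertInt {γ : ℝ} (hγ0 : 0 < γ) (hγ : γ ≤ 1) {u : ℝ → ℂ} (hu : HolderBdd γ u)
    (hp : Function.Periodic u (2 * Real.pi)) (θ : ℝ) :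
    chr 1 θ * hilbertInt (fun s => chr (-1) s * u s) θ =
      hilbertInt u θ + Complex.I * (coeffC u 0 + coeffC u 1 * chr 1 θ) := by
  have hc := hu.1
  have i1 := hu.intervalIntegrable hγ0 hγ θ
  set h : ℝ → ℂ := fun φ => (chr 1 φ + 1) * u (θ - φ) with hh
  have hhc : Continuous h :=
    ((continuous_chr 1).add continuous_const).mul (by fun_prop)
  -- The factors e^{±iφ} produced by the conjugation are moved off the cotangent; the price is a
  -- smooth kernel, written as `h φ + h (-φ)` so as to unfold to the whole period.
  have e1 : ∫ φ in (0 : ℝ)..Real.pi, chr 1 θ * (Real.cot (φ / 2) •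
        (chr (-1) (θ - φ) * u (θ - φ) - chr (-1) (θ + φ) * u (θ + φ))) =
      ∫ φ in (0 : ℝ)..Real.pi, (Real.cot (φ / 2) • (u (θ - φ) - u (θ + φ)) +
        Complex.I * (h φ + h (-φ))) := by
    refine intervalIntegral.integral_congr_ae (ae_of_all _ fun φ hφ => ?_)
    rw [uIoc_of_le Real.pi_pos.le] at hφ
    have h1 := cot_mul_chr_sub_one hφ.1 hφ.2
    have h2 := cot_mul_chr_neg_sub_one hφ.1 hφ.2
    have h3 : chr 1 θ * chr (-1) θ = 1 := by rw [chr_mul]; exact chr_zero θ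
    simp only [hh, chr_neg, sub_neg_eq_add]
    rw [Complex.real_smul, Complex.real_smul, chr_sub, chr_add, neg_neg]
    linear_combination u (θ - φ) * h1 - u (θ + φ) * h2 +
      (Real.cot (φ / 2) : ℂ) * (chr 1 φ * u (θ - φ) - chr (-1) φ * u (θ + φ)) * h3
  have i2 : IntervalIntegrable (fun φ => Complex.I * (h φ + h (-φ))) volume 0 Real.pi :=
    (by fun_prop : Continuous fun φ => Complex.I * (h φ + h (-φ))).intervalIntegrable _ _
  -- The kernel e^{iφ} + 1 sees only the frequencies 1 and 0, those where sgn(m - 1) and sgn(m)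
  -- differ.
  have e2 : ∫ φ in (-Real.pi)..Real.pi, h φ = 2 * Real.pi * (coeffC u 0 + coeffC u 1 * chr 1 θ) := by
    have hper : Function.Periodic (fun s => (chr 1 (θ - s) + 1) * u s) (2 * Real.pi) := fun s => by
      simp only [hp s, chr_sub, chr_periodic (-1) s]
    have := integral_sub_left_periodic hper θ
    simp only [sub_sub_cancel] at this
    rw [hh, this, coeffC, coeffC]
    have i3 : IntervalIntegrable (fun s => chr (-1) s * u s) volume 0 (2 * Real.pi) :=
      ((continuous_chr _).mul hc).intervalIntegrable _ _
    have e3 : ∀ s, (chr 1 (θ - s) + 1) * u s = chr 1 θ * (chr (-1) s * u s) + u s := fun s => by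
      rw [chr_sub]; ring
    simp_rw [e3]
    rw [intervalIntegral.integral_add (i3.const_mul _) (hc.intervalIntegrable _ _),
      intervalIntegral.integral_const_mul]
    have h0 := two_pi_ne
    simp only [neg_zero, chr_zero, one_mul]
    field_simp
    ring
  rw [hilbertInt, hilbertInt, mul_smul_comm, ← intervalIntegral.integral_const_mul, e1,
    intervalIntegral.integral_add i1 i2, intervalIntegral.integral_const_mul, integral_add_neg hhc,
    e2, smul_add]
  congr 1
  rw [Complex.real_smul]
  have h0 := two_pi_ne
  push_cast
  field_simp

theorem hilbertInt_add_const {E : Type*} [NormedAddCommGroup E] [NormedSpace ℝ E]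
    (w : ℝ → E) (c : E) (θ : ℝ) :
    hilbertInt (fun s => w s + c) θ = hilbertInt w θ := by
  simp only [hilbertInt, add_sub_add_right_eq_sub]

/-- The eigenvalue of `-𝓛` on the `m`-th Fourier mode. -/
def lam (m : ℤ) : ℝ := m.sign * (m - 1) / 4

theorem holderBdd_symbol {γ M : ℝ} {Y : ℝ → Plane} (hY : HolderOne γ M Y) (hγ0 : 0 < γ)
    (hγ : γ ≤ 1) : HolderBdd γ fun s => toC (deriv Y s) + -Complex.I * toC (Y s) :=
  hY.holderBdd_toC_deriv.add ((HolderBdd.const γ _).mul (hY.holderBdd_toC hγ0.le hγ))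

theorem symbol_periodic {γ M : ℝ} {Y : ℝ → Plane} (hY : HolderOne γ M Y) :
    Function.Periodic (fun s => toC (deriv Y s) + -Complex.I * toC (Y s)) (2 * Real.pi) :=
  fun θ => by simp only [hY.periodic θ, hY.deriv_periodic θ]

theorem coeffC_symbol {γ M : ℝ} {Y : ℝ → Plane} (hY : HolderOne γ M Y) (m : ℤ) :
    coeffC (fun s => toC (deriv Y s) + -Complex.I * toC (Y s)) m =
      Complex.I * (m - 1) * coeffC (fun s => toC (Y s)) m := by
  have hc : Continuous fun s => -Complex.I * toC (Y s) := continuous_const.mul hY.continuous_toC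
  rw [coeffC_add (hY.continuous_toC_deriv.intervalIntegrable _ _)
    (hc.intervalIntegrable _ _), coeffC_const_mul,
    coeffC_deriv hY.hasDerivAt_toC hY.continuous_toC_deriv hY.toC_periodic]
  ring

/-- Differentiating e^{-iθ}ΠY kills the frequency-one part of the projection, which has become
constant, and leaves e^{-iθ}(∂Y - iY + ic₀). Undoing the conjugation costs the coefficients 0 and 1
of the bracket, and both vanish. -/
theorem toC_circleOp {γ M : ℝ} {Y : ℝ → Plane} (hY : HolderOne γ M Y) (hγ0 : 0 < γ) (hγ : γ ≤ 1)
    (θ : ℝ) : toC (circleOp Y θ) =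
      -(1 / 4) * hilbertInt (fun s => toC (deriv Y s) + -Complex.I * toC (Y s)) θ := by
  set c0 := coeffC (fun s => toC (Y s)) 0 with hc0
  set c1 := coeffC (fun s => toC (Y s)) 1 with hc1
  set U := fun s => toC (deriv Y s) + -Complex.I * toC (Y s) with hU
  have hUh := holderBdd_symbol hY hγ0 hγ
  have hUp := symbol_periodic hY
  have hi := hY.continuous_toC.intervalIntegrable (μ := volume) 0 (2 * Real.pi)
  have hd : ∀ s, HasDerivAt (fun s => toC (rotInv (projPi Y) s))
      (chr (-1) s * (U s + Complex.I * c0)) s := by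
    intro s
    have h1 := (hasDerivAt_chr (-1) s).mul ((hY.hasDerivAt_toC s).sub
      (((hasDerivAt_chr 1 s).const_mul c1).const_add c0))
    have h2 : (fun s => toC (rotInv (projPi Y) s)) =
        fun s => chr (-1) s * (toC (Y s) - (c0 + c1 * chr 1 s)) := by
      funext s; rw [toC_rotInv, toC_projPi hi]
    rw [h2]
    refine h1.congr_deriv ?_
    simp only [hU, Pi.sub_apply]
    push_cast
    ring
  have hd' : ∀ s, toC (deriv (rotInv (projPi Y)) s) = chr (-1) s * (U s + Complex.I * c0) := by
    intro s
    have h2 := hasDerivAt_of_toC (hd s)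
    rw [h2.deriv, LinearIsometryEquiv.apply_symm_apply]
  have hV : HolderBdd γ fun s => U s + Complex.I * c0 := hUh.add (HolderBdd.const γ _)
  have hW := (holderBdd_chr hγ0.le hγ (-1)).mul hV
  have hVp : Function.Periodic (fun s => U s + Complex.I * c0) (2 * Real.pi) := fun s => by
    exact congrArg (· + Complex.I * c0) (hUp s)
  have hH : toC (hilbert (deriv (rotInv (projPi Y))) θ) =
      hilbertInt (fun s => chr (-1) s * (U s + Complex.I * c0)) θ := by
    obtain ⟨hc, K, hK, -, h⟩ := hW
    have hcont : Continuous (deriv (rotInv (projPi Y))) := by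
      have : deriv (rotInv (projPi Y)) =
          fun s => toC.symm (chr (-1) s * (U s + Complex.I * c0)) := by
        funext s; rw [← hd', LinearIsometryEquiv.symm_apply_apply]
      rw [this]
      exact toC.symm.continuous.comp hc
    rw [hilbert_eq_hilbertInt hK hγ0 hγ hcont (fun x x' => ?_), toC_hilbertInt]
    · simp_rw [hd']
    · rw [← toC.norm_map, map_sub, hd', hd']
      exact h x x'
  rw [circleOp, toC_rot, Lam, map_smul, hH, mul_smul_comm, chr_mul_hilbertInt hγ0 hγ hV hVp,
    hilbertInt_add_const]
  -- At frequency 0 the symbol i(m - 1) gives -ic₀, which the term from the projection cancels; at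
  -- frequency 1 the symbol itself is zero.
  have a0 : coeffC (fun s => U s + Complex.I * c0) 0 = 0 := by
    rw [coeffC_add (hUh.1.intervalIntegrable _ _) (continuous_const.intervalIntegrable _ _),
      coeffC_symbol hY]
    have := coeffC_chr (Complex.I * c0) 0 0
    simp only [chr_zero, mul_one, if_pos] at this
    rw [this]
    push_cast
    ring
  have a1 : coeffC (fun s => U s + Complex.I * c0) 1 = 0 := by
    rw [coeffC_add (hUh.1.intervalIntegrable _ _) (continuous_const.intervalIntegrable _ _),
      coeffC_symbol hY]
    have := coeffC_chr (Complex.I * c0) 1 0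
    simp only [chr_zero, mul_one] at this
    rw [this]
    simp
  rw [a0, a1, Complex.real_smul]
  push_cast
  ring

theorem coeffC_circleOp {γ M : ℝ} {Y : ℝ → Plane} (hY : HolderOne γ M Y) (hγ0 : 0 < γ)
    (hγ : γ ≤ 1) (m : ℤ) :
    coeffC (fun s => toC (circleOp Y s)) m = -(lam m : ℂ) * coeffC (fun s => toC (Y s)) m := by
  simp_rw [toC_circleOp hY hγ0 hγ]
  rw [coeffC_const_mul, coeffC_hilbertInt hγ0 hγ (holderBdd_symbol hY hγ0 hγ) (symbol_periodic hY),
    coeffC_symbol hY, lam]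
  push_cast
  linear_combination (m.sign * (m - 1) / 4 * coeffC (fun s => toC (Y s)) m : ℂ) * Complex.I_sq

/-! ### The integrand of the evolution equation in complex notation -/

/-- The integrand of the remainder. -/
def remIntegrand (X : ℝ → Plane) (θ θ' : ℝ) : Plane :=
  (inner ℝ (X θ - X θ') (deriv X θ') / ‖X θ - X θ'‖ ^ 2
      - (1 / 2) * Real.cot ((θ - θ') / 2)) • deriv X θ'
    + deriv (fun σ => tensorTerm X θ σ (deriv X θ')) θ'

theorem remainder_eq (X : ℝ → Plane) (θ : ℝ) : remainder X θ =
    (-(1 / (4 * Real.pi))) • ∫ θ' in (0 : ℝ)..(2 * Real.pi), remIntegrand X θ θ' := rfl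

/-- The complex form of the kernel applied to `p`, with `z` the difference of the positions. -/
def kerC (z p : ℂ) : ℂ :=
  (p ^ 2 / z + (starRingEnd ℂ p) ^ 2 * z / (starRingEnd ℂ z) ^ 2) / 2

theorem hasDerivAt_tensorTerm {X : ℝ → Plane} {θ θ' : ℝ} {d : Plane} (hd : HasDerivAt X d θ')
    (hne : X θ ≠ X θ') (p : Plane) :
    HasDerivAt (fun σ => tensorTerm X θ σ p)
      ((inner ℝ (X θ - X θ') p / ‖X θ - X θ'‖ ^ 2) • (-d) +
        ((inner ℝ (-d) p * ‖X θ - X θ'‖ ^ 2 -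
          inner ℝ (X θ - X θ') p * (2 * inner ℝ (X θ - X θ') (-d))) /
          (‖X θ - X θ'‖ ^ 2) ^ 2) • (X θ - X θ')) θ' := by
  have hv : HasDerivAt (fun σ => X θ - X σ) (-d) θ' := hd.const_sub (X θ)
  have h1 : HasDerivAt (fun σ => inner ℝ (X θ - X σ) p) (inner ℝ (-d) p) θ' := by
    have := hv.inner ℝ (hasDerivAt_const θ' p)
    simpa using this
  have h2 := hv.norm_sq
  have h3 : ‖X θ - X θ'‖ ^ 2 ≠ 0 := by
    have : X θ - X θ' ≠ 0 := sub_ne_zero.2 hne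
    positivity
  exact (h1.div h2 h3).smul hv

/-- Writing u·v as (ūv + uv̄)/2 and |z|² as z z̄, the scalar term and the differentiated tensor
combine: all mixed products of `p` and its conjugate cancel, and only p²/z and p̄²z/z̄² survive. -/
theorem toC_remIntegrand {X : ℝ → Plane} {θ θ' : ℝ} (hd : DifferentiableAt ℝ X θ')
    (hne : X θ ≠ X θ') :
    toC (remIntegrand X θ θ') = kerC (toC (X θ) - toC (X θ')) (toC (deriv X θ')) -
      1 / 2 * (Real.cot ((θ - θ') / 2) : ℂ) * toC (deriv X θ') := by
  rw [remIntegrand, (hasDerivAt_tensorTerm hd.hasDerivAt hne _).deriv]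
  set p := deriv X θ'
  have hz : toC (X θ) - toC (X θ') ≠ 0 := sub_ne_zero.2 fun h => hne (toC.injective h)
  have hzb : (starRingEnd ℂ) (toC (X θ) - toC (X θ')) ≠ 0 := by
    simpa only [ne_eq, map_eq_zero] using hz
  have hn : ((‖X θ - X θ'‖ ^ 2 : ℝ) : ℂ) =
      (starRingEnd ℂ) (toC (X θ) - toC (X θ')) * (toC (X θ) - toC (X θ')) := by
    rw [← toC.norm_map, map_sub, mul_comm, Complex.mul_conj, Complex.normSq_eq_norm_sq]
  have hi : ∀ u v : Plane, ((inner ℝ u v : ℝ) : ℂ) =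
      ((starRingEnd ℂ) (toC u) * toC v + toC u * (starRingEnd ℂ) (toC v)) / 2 := fun u v => by
    rw [inner_toC, Complex.re_eq_add_conj, map_mul, Complex.conj_conj]
  simp only [map_add, map_smul, Complex.real_smul, Complex.ofReal_sub, Complex.ofReal_div,
    Complex.ofReal_mul, Complex.ofReal_pow (‖X θ - X θ'‖ ^ 2), hn, hi, map_neg, kerC, map_sub]
  simp only [map_sub] at hzb
  -- Treating a number and its conjugate as independent variables makes the claim an identity of
  -- rational functions.
  set z := toC (X θ) - toC (X θ')
  set zb := (starRingEnd ℂ) (toC (X θ)) - (starRingEnd ℂ) (toC (X θ'))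
  set P := toC p
  set Pb := (starRingEnd ℂ) P
  push_cast
  field_simp
  ring

theorem remIntegrand_periodic {X : ℝ → Plane} (hp : Function.Periodic X (2 * Real.pi)) (θ : ℝ) :
    Function.Periodic (remIntegrand X θ) (2 * Real.pi) := by
  intro θ'
  have hdp : deriv X (θ' + 2 * Real.pi) = deriv X θ' := by
    rw [← deriv_comp_add_const]
    congr 1
    funext s
    exact hp s
  have hcot : Real.cot ((θ - (θ' + 2 * Real.pi)) / 2) = Real.cot ((θ - θ') / 2) := by
    rw [show (θ - (θ' + 2 * Real.pi)) / 2 = (θ - θ') / 2 - Real.pi by ring,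
      Real.cot_eq_cos_div_sin, Real.cot_eq_cos_div_sin, Real.cos_sub_pi, Real.sin_sub_pi,
      neg_div_neg_eq]
  have ht : ∀ p, deriv (fun σ => tensorTerm X θ σ p) (θ' + 2 * Real.pi) =
      deriv (fun σ => tensorTerm X θ σ p) θ' := by
    intro p
    rw [← deriv_comp_add_const]
    congr 1
    funext s
    simp only [tensorTerm, hp s]
  simp only [remIntegrand, hdp, hcot, hp θ', ht]

/-- Periodicity allows the shift θ' = θ - φ with φ in [-π, π], which puts the only singularity at φ
= 0, a null set. -/
theorem toC_remainder {X : ℝ → Plane} (hp : Function.Periodic X (2 * Real.pi))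
    (hd : Differentiable ℝ X) {θ : ℝ}
    (hne : ∀ φ, φ ≠ 0 → |φ| ≤ Real.pi → X θ ≠ X (θ - φ)) :
    toC (remainder X θ) = -(1 / (4 * Real.pi)) * ∫ φ in (-Real.pi)..Real.pi,
      (kerC (toC (X θ) - toC (X (θ - φ))) (toC (deriv X (θ - φ))) -
        1 / 2 * (Real.cot (φ / 2) : ℂ) * toC (deriv X (θ - φ))) := by
  rw [remainder_eq, map_smul, ← integral_sub_left_periodic (remIntegrand_periodic hp θ) θ,
    toC_intervalIntegral, Complex.real_smul]
  congr 1
  · push_cast; ring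
  refine intervalIntegral.integral_congr_ae ?_
  have h0 : ∀ᵐ φ : ℝ, φ ≠ 0 := by
    rw [ae_iff]; simp
  filter_upwards [h0] with φ h0 hφ
  rw [uIoc_of_le (by linarith [Real.pi_pos])] at hφ
  rw [toC_remIntegrand (hd _) (hne φ h0 (abs_le.2 ⟨hφ.1.le, hφ.2⟩)), sub_sub_cancel]

/-! ### The kernel `κ = ∂X' / ΔX` of the circle -/

theorem abs_le_pi_mul_abs_sin {φ : ℝ} (h : |φ| ≤ Real.pi) :
    |φ| ≤ Real.pi * |Real.sin (φ / 2)| := by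
  have h2 : |φ / 2| ≤ Real.pi / 2 := by
    rw [abs_div, abs_two]; linarith
  have := Real.mul_abs_le_abs_sin h2
  rw [abs_div, abs_two] at this
  have hp := Real.pi_pos
  calc |φ| = Real.pi * (2 / Real.pi * (|φ| / 2)) := by field_simp
    _ ≤ _ := by gcongr

/-- The kernel `κ = (cot (φ / 2) - i) / 2`. -/
def kap (φ : ℝ) : ℂ := (Real.cot (φ / 2) - Complex.I) / 2

theorem conj_kap (φ : ℝ) : (starRingEnd ℂ) (kap φ) = kap φ + Complex.I := by
  rw [kap, map_div₀, map_sub, Complex.conj_ofReal, Complex.conj_I, map_ofNat]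
  ring

theorem two_mul_kap (φ : ℝ) : 2 * kap φ = Real.cot (φ / 2) - Complex.I := by
  rw [kap]; ring

/-- That is, κ = i/(e^{iφ} - 1) off the singularity, so that multiplication by κ turns the chord of
a circle into its tangent. -/
theorem kap_mul {φ : ℝ} (h0 : φ ≠ 0) (h : |φ| ≤ Real.pi) :
    kap φ * (chr 1 φ - 1) = Complex.I := by
  rcases lt_or_gt_of_ne h0 with hn | hp
  · have h1 := cot_mul_chr_neg_sub_one (φ := -φ) (by linarith) (by linarith [abs_le.1 h])
    rw [chr_neg, neg_neg, neg_div, cot_neg] at h1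
    rw [kap]
    rw [Complex.ofReal_neg] at h1
    linear_combination -h1 / 2
  · have h1 := cot_mul_chr_sub_one hp (abs_le.1 h).2
    rw [kap]
    linear_combination h1 / 2

theorem norm_chr_sub_one (φ : ℝ) : ‖chr 1 φ - 1‖ = 2 * |Real.sin (φ / 2)| := by
  have := Complex.norm_exp_I_mul_ofReal_sub_one φ
  rw [mul_comm] at this
  rw [chr, Int.cast_one, one_mul, this, norm_mul, Real.norm_ofNat, Real.norm_eq_abs]

theorem norm_kap_le {φ : ℝ} (h0 : φ ≠ 0) (h : |φ| ≤ Real.pi) :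
    ‖kap φ‖ ≤ Real.pi / 2 * |φ|⁻¹ := by
  have h1 := congrArg norm (kap_mul h0 h)
  rw [norm_mul, Complex.norm_I, norm_chr_sub_one] at h1
  have h2 := abs_le_pi_mul_abs_sin h
  have h3 := abs_pos.2 h0
  rw [← div_eq_mul_inv, le_div_iff₀ h3]
  have := mul_le_mul_of_nonneg_left h2 (norm_nonneg (kap φ))
  nlinarith

theorem measurable_kap : Measurable kap := by
  unfold kap
  simp only [Real.cot_eq_cos_div_sin]
  fun_prop

/-- A first-order Taylor estimate for a function with a Hölder continuous derivative. -/
theorem norm_taylor_le {f f' : ℝ → ℂ} {γ M : ℝ} (hγ0 : 0 ≤ γ)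
    (hM : 0 ≤ M) (hd : ∀ θ, HasDerivAt f (f' θ) θ)
    (hh : ∀ θ θ', ‖f' θ - f' θ'‖ ≤ M * |θ - θ'| ^ γ) (θ φ : ℝ) :
    ‖f θ - f (θ - φ) - φ * f' (θ - φ)‖ ≤ M * |φ| ^ γ * |φ| := by
  have h1 : ∀ s ∈ uIcc (θ - φ) θ, HasDerivWithinAt (fun s : ℝ => f s - s * f' (θ - φ))
      (f' s - f' (θ - φ)) (uIcc (θ - φ) θ) s := fun s _ => by
    have := ((hd s).sub ((Complex.ofRealCLM.hasDerivAt (x := s)).mul_const (f' (θ - φ))))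
    simp only [Complex.ofRealCLM_apply, Complex.ofReal_one, one_mul] at this
    exact this.hasDerivWithinAt
  have h2 := Convex.norm_image_sub_le_of_norm_hasDerivWithin_le (C := M * |φ| ^ γ) h1
    (fun s hs => ?_) (convex_uIcc _ _) left_mem_uIcc right_mem_uIcc
  · have e : f θ - θ * f' (θ - φ) - (f (θ - φ) - ((θ - φ : ℝ) : ℂ) * f' (θ - φ)) =
        f θ - f (θ - φ) - φ * f' (θ - φ) := by push_cast; ring
    rw [e, sub_sub_cancel, Real.norm_eq_abs] at h2
    exact h2
  · refine (hh _ _).trans ?_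
    have h3 : |s - (θ - φ)| ≤ |φ| := by
      have := abs_sub_left_of_mem_uIcc hs
      rwa [sub_sub_cancel] at this
    gcongr

theorem intervalIntegrable_abs_rpow {γ : ℝ} (hγ : 0 < γ) (C : ℝ) :
    IntervalIntegrable (fun φ : ℝ => C * |φ| ^ (γ - 1)) volume (-Real.pi) Real.pi := by
  have h1 : IntervalIntegrable (fun φ : ℝ => C * |φ| ^ (γ - 1)) volume 0 Real.pi := by
    refine (intervalIntegrable_rpow_sub_one hγ C 0 Real.pi).congr ?_
    intro φ hφ
    rw [uIoc_of_le Real.pi_pos.le] at hφ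
    simp only [abs_of_pos hφ.1]
  have h2 : IntervalIntegrable (fun φ : ℝ => C * |φ| ^ (γ - 1)) volume (-Real.pi) 0 := by
    have := (IntervalIntegrable.iff_comp_neg enorm_ne_top).1 h1
    simp only [abs_neg, neg_zero] at this
    exact this.symm
  exact h2.trans h1

/-- The expansion of the integrand of the evolution equation around a circle. Here `z` is the
difference of the positions on the circle, and `p = κ z` is the tangent vector. -/
theorem kerC_expansion {z w q k : ℂ} {ε : ℝ} (hz : z ≠ 0) (hzw : z + ε * w ≠ 0)
    (hk : (starRingEnd ℂ) k = k + Complex.I) :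
    kerC (z + ε * w) (k * z + ε * q) - 1 / 2 * (2 * k + Complex.I) * (k * z + ε * q) =
      Complex.I / 2 * (starRingEnd ℂ) k * z +
      ε * (-(Complex.I / 2) * q + Complex.I / 2 * (2 * k + Complex.I) * w +
        (starRingEnd ℂ) k * (z / (starRingEnd ℂ) z) * (starRingEnd ℂ) (q - k * w)) +
      ε ^ 2 * (((q - k * w) ^ 2 / (z + ε * w) +
        (starRingEnd ℂ) (q - k * w) ^ 2 * (z + ε * w) / (starRingEnd ℂ) (z + ε * w) ^ 2 +
        2 * (starRingEnd ℂ) k * (starRingEnd ℂ) (q - k * w) * w / (starRingEnd ℂ) (z + ε * w) -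
        2 * (starRingEnd ℂ) k * (z / (starRingEnd ℂ) z) * (starRingEnd ℂ) (q - k * w) *
          (starRingEnd ℂ) w / (starRingEnd ℂ) (z + ε * w)) / 2) := by
  have hzb : (starRingEnd ℂ) z ≠ 0 := by simpa only [ne_eq, map_eq_zero] using hz
  have hzwb : (starRingEnd ℂ) (z + ε * w) ≠ 0 := by simpa only [ne_eq, map_eq_zero] using hzw
  simp only [kerC, map_add, map_mul, map_sub, Complex.conj_ofReal] at hzwb ⊢
  -- The expansion is exact: with `p = k z + ε q`, division by `z + ε w` leaves the remainder ε²(q -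
  -- kw)²/(z + εw), and the combination q - kw is what makes it small.
  have e1 : (k * z + ε * q) ^ 2 / (z + ε * w) = k ^ 2 * z + ε * (2 * k * q - k ^ 2 * w) +
      ε ^ 2 * ((q - k * w) ^ 2 / (z + ε * w)) := by
    field_simp
    ring
  -- From here conjugates are independent symbols; the relation between `k` and its conjugate enters
  -- only at the end, through `hk`.
  generalize (starRingEnd ℂ) z = zb at *
  generalize (starRingEnd ℂ) w = wb at *
  generalize (starRingEnd ℂ) q = qb at *
  generalize (starRingEnd ℂ) k = kb at *
  have e2 : (kb * zb + ε * qb) ^ 2 * (z + ε * w) / (zb + ε * wb) ^ 2 =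
      kb ^ 2 * z + ε * (2 * kb * (z / zb) * (qb - kb * wb) + kb ^ 2 * w) +
      ε ^ 2 * ((qb - kb * wb) ^ 2 * (z + ε * w) / (zb + ε * wb) ^ 2 +
        2 * kb * (qb - kb * wb) * w / (zb + ε * wb) -
        2 * kb * (z / zb) * (qb - kb * wb) * wb / (zb + ε * wb)) := by
    field_simp
    ring
  rw [e1, e2, hk]
  ring

/-! ### The linearization at a circle -/

theorem intervalIntegrable_of_bound {f : ℝ → ℂ} {γ C : ℝ} (hγ : 0 < γ) (hf : Measurable f)
    (hb : ∀ φ, φ ≠ 0 → |φ| ≤ Real.pi → ‖f φ‖ ≤ C * |φ| ^ (γ - 1)) :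
    IntervalIntegrable f volume (-Real.pi) Real.pi ∧
      ‖∫ φ in (-Real.pi)..Real.pi, f φ‖ ≤
        ∫ φ in (-Real.pi)..Real.pi, C * |φ| ^ (γ - 1) := by
  have hpi : -Real.pi ≤ Real.pi := by linarith [Real.pi_pos]
  have h0 : ∀ᵐ φ : ℝ, φ ≠ 0 := by
    rw [ae_iff]; simp
  have hb' : ∀ᵐ φ : ℝ, φ ∈ Ioc (-Real.pi) Real.pi → ‖f φ‖ ≤ C * |φ| ^ (γ - 1) := by
    filter_upwards [h0] with φ h0 hφ
    exact hb φ h0 (abs_le.2 ⟨hφ.1.le, hφ.2⟩)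
  refine ⟨(intervalIntegrable_abs_rpow hγ C).mono_fun' hf.aestronglyMeasurable ?_,
    intervalIntegral.norm_integral_le_of_norm_le hpi hb' (intervalIntegrable_abs_rpow hγ C)⟩
  rw [uIoc_of_le hpi]
  exact (ae_restrict_iff' measurableSet_Ioc).2 hb'

theorem integral_symm_eq {f : ℝ → ℂ}
    (hf : IntervalIntegrable f volume (-Real.pi) Real.pi) :
    ∫ φ in (-Real.pi)..Real.pi, f φ = ∫ φ in (0 : ℝ)..Real.pi, (f φ + f (-φ)) := by
  have hpi := Real.pi_pos
  have i1 : IntervalIntegrable f volume (-Real.pi) 0 :=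
    hf.mono_set (by rw [uIcc_of_le (by linarith), uIcc_of_le (by linarith)]
                    exact Icc_subset_Icc le_rfl hpi.le)
  have i2 : IntervalIntegrable f volume 0 Real.pi :=
    hf.mono_set (by rw [uIcc_of_le (by linarith), uIcc_of_le (by linarith)]
                    exact Icc_subset_Icc (by linarith) le_rfl)
  have i3 : IntervalIntegrable (fun φ => f (-φ)) volume 0 Real.pi := by
    have := (IntervalIntegrable.iff_comp_neg enorm_ne_top).1 i1.symm
    simpa using this
  rw [intervalIntegral.integral_add i2 i3, intervalIntegral.integral_comp_neg, neg_zero, add_comm,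
    intervalIntegral.integral_add_adjacent_intervals i1 i2]

/-- The difference of the positions on the circle. -/
def chord (a : ℂ) (θ φ : ℝ) : ℂ := a * chr 1 θ * (1 - chr (-1) φ)

theorem chord_eq (a : ℂ) (θ φ : ℝ) : chord a θ φ = a * chr 1 θ - a * chr 1 (θ - φ) := by
  rw [chord, chr_sub]; ring

theorem one_sub_chr_neg (φ : ℝ) : 1 - chr (-1) φ = chr (-1) φ * (chr 1 φ - 1) := by
  rw [mul_sub, chr_mul]; simp [chr_zero]

theorem kap_mul_chord (a : ℂ) (θ : ℝ) {φ : ℝ} (h0 : φ ≠ 0) (h : |φ| ≤ Real.pi) :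
    kap φ * chord a θ φ = Complex.I * (a * chr 1 (θ - φ)) := by
  rw [chord, one_sub_chr_neg, chr_sub]
  linear_combination a * chr 1 θ * chr (-1) φ * kap_mul h0 h

theorem conj_kap_mul {φ : ℝ} (h0 : φ ≠ 0) (h : |φ| ≤ Real.pi) :
    (starRingEnd ℂ) (kap φ) * (1 - chr (-1) φ) = Complex.I := by
  have := congrArg (starRingEnd ℂ) (kap_mul h0 h)
  rw [map_mul, map_sub, conj_chr, Complex.conj_I, map_one] at this
  linear_combination -this

theorem norm_chord (a : ℂ) (θ φ : ℝ) : ‖chord a θ φ‖ = ‖a‖ * (2 * |Real.sin (φ / 2)|) := by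
  rw [chord, one_sub_chr_neg, norm_mul, norm_mul, norm_mul, norm_chr, norm_chr, mul_one, one_mul,
    norm_chr_sub_one]

theorem le_norm_chord (a : ℂ) (θ : ℝ) {φ : ℝ} (h : |φ| ≤ Real.pi) :
    2 * (‖a‖ / Real.pi) * |φ| ≤ ‖chord a θ φ‖ := by
  rw [norm_chord]
  have h1 := abs_le_pi_mul_abs_sin h
  have hp := Real.pi_pos
  calc 2 * (‖a‖ / Real.pi) * |φ| ≤ 2 * (‖a‖ / Real.pi) * (Real.pi * |Real.sin (φ / 2)|) := by
        gcongr
    _ = _ := by field_simp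

theorem chord_ne_zero {a : ℂ} (ha : a ≠ 0) (θ : ℝ) {φ : ℝ} (h0 : φ ≠ 0) (h : |φ| ≤ Real.pi) :
    chord a θ φ ≠ 0 := by
  intro h1
  have := kap_mul_chord a θ h0 h
  rw [h1, mul_zero] at this
  exact mul_ne_zero Complex.I_ne_zero (mul_ne_zero ha (chr_ne_zero _ _)) this.symm

/-- The direction of a chord of a circle turns smoothly with φ, through the singularity as well.
This is what allows the third linear term to be integrated in closed form. -/
theorem chord_div_conj {a : ℂ} (ha : a ≠ 0) (θ : ℝ) {φ : ℝ} (h0 : φ ≠ 0) (h : |φ| ≤ Real.pi) :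
    chord a θ φ / (starRingEnd ℂ) (chord a θ φ) =
      -(a / (starRingEnd ℂ) a * chr 2 θ) * chr (-1) φ := by
  have hc : (starRingEnd ℂ) (chord a θ φ) ≠ 0 := by
    simpa only [ne_eq, map_eq_zero] using chord_ne_zero ha θ h0 h
  have hab : (starRingEnd ℂ) a ≠ 0 := by simpa only [ne_eq, map_eq_zero] using ha
  rw [div_eq_iff hc]
  simp only [chord, map_mul, map_sub, map_one, conj_chr, neg_neg]
  have e1 : chr 2 θ * chr (-1) θ = chr 1 θ := by rw [chr_mul]; rfl
  have e2 : chr (-1) φ * chr 1 φ = 1 := by rw [chr_mul]; exact chr_zero φ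
  field_simp
  linear_combination (chr (-1) φ - chr (-1) φ * chr 1 φ) * e1 - chr 1 θ * e2

/-! ### The first-order terms of the expansion -/

section Estimates

variable {γ M : ℝ} {Y : ℝ → Plane}

/-- The difference of the values of the perturbation. -/
def incr (Y : ℝ → Plane) (θ φ : ℝ) : ℂ := toC (Y θ) - toC (Y (θ - φ))

/-- The combination `∂Y' - κ ΔY`. -/
def defect (Y : ℝ → Plane) (θ φ : ℝ) : ℂ := toC (deriv Y (θ - φ)) - kap φ * incr Y θ φ

theorem norm_incr_le (hY : HolderOne γ M Y) (θ φ : ℝ) : ‖incr Y θ φ‖ ≤ M * |φ| := by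
  have := hY.norm_sub_le θ (θ - φ)
  rwa [sub_sub_cancel, ← toC.norm_map, map_sub] at this

theorem norm_kap_mul_incr_le (hY : HolderOne γ M Y) (θ : ℝ) {φ : ℝ} (h0 : φ ≠ 0)
    (h : |φ| ≤ Real.pi) : ‖kap φ * incr Y θ φ‖ ≤ Real.pi / 2 * M := by
  rw [norm_mul]
  have h3 := abs_pos.2 h0
  have hM := hY.nonneg
  calc ‖kap φ‖ * ‖incr Y θ φ‖ ≤ (Real.pi / 2 * |φ|⁻¹) * (M * |φ|) :=
        mul_le_mul (norm_kap_le h0 h) (norm_incr_le hY θ φ) (norm_nonneg _) (by positivity)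
    _ = Real.pi / 2 * M := by field_simp

theorem norm_defect_le (hY : HolderOne γ M Y) (θ : ℝ) {φ : ℝ} (h0 : φ ≠ 0)
    (h : |φ| ≤ Real.pi) : ‖defect Y θ φ‖ ≤ M + Real.pi / 2 * M := by
  refine (norm_sub_le _ _).trans (add_le_add ?_ (norm_kap_mul_incr_le hY θ h0 h))
  rw [toC.norm_map]
  exact hY.norm_deriv_le _

/-- By κ(e^{iφ} - 1) = i, the defect is κ times a difference of two first-order Taylor remainders,
one of -ie^{iφ} at 0 and one of `Y` at θ - φ. Both are O(|φ|^{1+γ}) and κ is O(1/|φ|). -/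
theorem exists_norm_defect_le (hY : HolderOne γ M Y) (hγ0 : 0 < γ) (hγ : γ ≤ 1) :
    ∃ K, 0 ≤ K ∧ ∀ θ φ, φ ≠ 0 → |φ| ≤ Real.pi → ‖defect Y θ φ‖ ≤ K * |φ| ^ γ := by
  obtain ⟨-, K1, hK1, -, hchr⟩ := holderBdd_chr hγ0.le hγ 1
  have hM := hY.nonneg
  refine ⟨Real.pi / 2 * (M * K1 + M), by positivity, fun θ φ h0 h => ?_⟩
  have t1 := norm_taylor_le hγ0.le hK1 (f := fun s => -Complex.I * chr 1 s) (f' := chr 1)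
    (fun s => ((hasDerivAt_chr 1 s).const_mul (-Complex.I)).congr_deriv (by
      push_cast; linear_combination -chr 1 s * Complex.I_sq)) hchr φ φ
  rw [sub_self, chr_apply_zero, mul_one, mul_one] at t1
  have t2 := norm_taylor_le hγ0.le hM hY.hasDerivAt_toC (fun x x' => by
    rw [← map_sub, toC.norm_map]; exact hY.norm_deriv_sub_le x x') θ φ
  have e : defect Y θ φ = kap φ * (toC (deriv Y (θ - φ)) *
      (-Complex.I * chr 1 φ - -Complex.I - φ) -
      (toC (Y θ) - toC (Y (θ - φ)) - φ * toC (deriv Y (θ - φ)))) := by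
    rw [defect, incr]
    linear_combination (Complex.I * toC (deriv Y (θ - φ))) * kap_mul h0 h +
      toC (deriv Y (θ - φ)) * Complex.I_sq
  have h3 := abs_pos.2 h0
  rw [e, norm_mul]
  calc ‖kap φ‖ * _ ≤ (Real.pi / 2 * |φ|⁻¹) * (M * (K1 * |φ| ^ γ * |φ|) + M * |φ| ^ γ * |φ|) := by
        refine mul_le_mul (norm_kap_le h0 h) ?_ (norm_nonneg _) (by positivity)
        refine (norm_sub_le _ _).trans (add_le_add ?_ t2)
        rw [norm_mul]
        refine mul_le_mul ?_ t1 (norm_nonneg _) hM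
        rw [toC.norm_map]
        exact hY.norm_deriv_le _
    _ = _ := by field_simp

theorem continuous_incr (hY : HolderOne γ M Y) (θ : ℝ) : Continuous (incr Y θ) :=
  continuous_const.sub (hY.continuous_toC.comp (continuous_const.sub continuous_id))

theorem measurable_incr (hY : HolderOne γ M Y) (θ : ℝ) : Measurable (incr Y θ) :=
  (continuous_incr hY θ).measurable

theorem measurable_deriv_shift (hY : HolderOne γ M Y) (θ : ℝ) :
    Measurable fun φ => toC (deriv Y (θ - φ)) := by
  have := hY.continuous_toC_deriv
  exact (this.comp (continuous_const.sub continuous_id)).measurable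

theorem measurable_defect (hY : HolderOne γ M Y) (θ : ℝ) : Measurable (defect Y θ) :=
  (measurable_deriv_shift hY θ).sub (measurable_kap.mul (measurable_incr hY θ))

theorem measurable_chord (a : ℂ) (θ : ℝ) : Measurable (chord a θ) :=
  (measurable_const.mul (measurable_const.sub (continuous_chr _).measurable))

theorem measurable_conj {f : ℝ → ℂ} (hf : Measurable f) :
    Measurable fun φ => (starRingEnd ℂ) (f φ) := Complex.continuous_conj.measurable.comp hf

/-- The integral of the tangent vector vanishes. -/
theorem integral_deriv_shift (hY : HolderOne γ M Y) (θ : ℝ) :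
    ∫ φ in (-Real.pi)..Real.pi, toC (deriv Y (θ - φ)) = 0 := by
  rw [integral_sub_left_periodic hY.toC_deriv_periodic θ,
    intervalIntegral.integral_eq_sub_of_hasDerivAt (fun s _ => hY.hasDerivAt_toC s)
    (hY.continuous_toC_deriv.intervalIntegrable _ _)]
  have := hY.periodic 0
  rw [zero_add] at this
  rw [this, sub_self]

theorem intervalIntegrable_kap_mul_incr (hY : HolderOne γ M Y) (θ : ℝ) :
    IntervalIntegrable (fun φ => kap φ * incr Y θ φ) volume (-Real.pi) Real.pi :=
  (intervalIntegrable_of_bound (γ := 1) (C := Real.pi / 2 * M) one_pos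
    (measurable_kap.mul (measurable_incr hY θ)) fun φ h0 h => by
      rw [sub_self, Real.rpow_zero, mul_one]
      exact norm_kap_mul_incr_le hY θ h0 h).1

theorem intervalIntegrable_cot_mul_incr (hY : HolderOne γ M Y) (θ : ℝ) :
    IntervalIntegrable (fun φ => (2 * kap φ + Complex.I) * incr Y θ φ) volume
      (-Real.pi) Real.pi := by
  have h := ((intervalIntegrable_kap_mul_incr hY θ).const_mul 2).add
    (((continuous_incr hY θ).intervalIntegrable (-Real.pi) Real.pi).const_mul Complex.I)
  refine h.congr ?_
  intro φ _
  ring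

/-- The factor 2κ + i is cot(φ/2). Folding the integral about 0 cancels the value at `θ` by oddness
and leaves the folded Hilbert transform. -/
theorem integral_cot_mul_incr (hY : HolderOne γ M Y) (θ : ℝ) :
    ∫ φ in (-Real.pi)..Real.pi, (2 * kap φ + Complex.I) * incr Y θ φ =
      -(2 * Real.pi) * hilbertInt (fun s => toC (Y s)) θ := by
  rw [integral_symm_eq (intervalIntegrable_cot_mul_incr hY θ), hilbertInt, Complex.real_smul]
  have e : ∀ φ, (2 * kap φ + Complex.I) * incr Y θ φ +
      (2 * kap (-φ) + Complex.I) * incr Y θ (-φ) =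
      -(Real.cot (φ / 2) • (toC (Y (θ - φ)) - toC (Y (θ + φ)))) := by
    intro φ
    rw [two_mul_kap, two_mul_kap, neg_div, cot_neg, incr, incr, sub_neg_eq_add, Complex.real_smul]
    push_cast
    ring
  simp_rw [e]
  rw [intervalIntegral.integral_neg]
  have := two_pi_ne
  push_cast
  field_simp

/-- The part of the linearization which is a total derivative. -/
def exactPart (a : ℂ) (Y : ℝ → Plane) (θ φ : ℝ) : ℂ :=
  (starRingEnd ℂ) (kap φ) * (chord a θ φ / (starRingEnd ℂ) (chord a θ φ)) *
    (starRingEnd ℂ) (defect Y θ φ)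

theorem norm_exactPart_le (a : ℂ) (Y : ℝ → Plane) (θ φ : ℝ) :
    ‖exactPart a Y θ φ‖ ≤ ‖kap φ‖ * ‖defect Y θ φ‖ := by
  rw [exactPart, norm_mul, norm_mul, norm_div, Complex.norm_conj, Complex.norm_conj,
    Complex.norm_conj]
  have := div_self_le_one ‖chord a θ φ‖
  have h1 := mul_le_mul_of_nonneg_left this (norm_nonneg (kap φ))
  rw [mul_one] at h1
  exact mul_le_mul_of_nonneg_right h1 (norm_nonneg _)

theorem intervalIntegrable_exactPart (hY : HolderOne γ M Y) (hγ0 : 0 < γ) (hγ : γ ≤ 1) (a : ℂ)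
    (θ : ℝ) : IntervalIntegrable (exactPart a Y θ) volume (-Real.pi) Real.pi := by
  obtain ⟨K, hK, hd⟩ := exists_norm_defect_le hY hγ0 hγ
  refine (intervalIntegrable_of_bound (C := Real.pi / 2 * K) hγ0 ?_ fun φ h0 h => ?_).1
  · exact ((measurable_conj measurable_kap).mul ((measurable_chord a θ).div
      (measurable_conj (measurable_chord a θ)))).mul (measurable_conj (measurable_defect hY θ))
  · refine (norm_exactPart_le a Y θ φ).trans ?_
    refine (mul_le_mul (norm_kap_le h0 h) (hd θ φ h0 h) (norm_nonneg _) (by positivity)).trans_eq ?_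
    rw [Real.rpow_sub_one (abs_pos.2 h0).ne']
    field_simp

/-- With D = 1 - e^{-iφ}, the conjugate of κ is i/D and D' = ie^{-iφ}; the integrand is then the
derivative of N = iν e^{-iφ} w̄/D, where w = ΔY and ν is constant in φ. The function N is periodic
and has a limit at φ = 0, so the two one-sided integrals cancel. -/
theorem integral_exactPart (hY : HolderOne γ M Y) (hγ0 : 0 < γ) (hγ : γ ≤ 1) {a : ℂ} (ha : a ≠ 0)
    (θ : ℝ) : ∫ φ in (-Real.pi)..Real.pi, exactPart a Y θ φ = 0 := by
  have hpi := Real.pi_pos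
  set ν := -(a / (starRingEnd ℂ) a * chr 2 θ) with hν
  set N : ℝ → ℂ := fun φ =>
    Complex.I * ν * (chr (-1) φ * (starRingEnd ℂ) (incr Y θ φ)) / (1 - chr (-1) φ) with hN
  have hD : ∀ φ, φ ≠ 0 → |φ| ≤ Real.pi → 1 - chr (-1) φ ≠ 0 := fun φ h0 h h1 => by
    have := conj_kap_mul h0 h
    rw [h1, mul_zero] at this
    exact Complex.I_ne_zero this.symm
  have hw : ∀ φ, HasDerivAt (fun φ => (starRingEnd ℂ) (incr Y θ φ))
      ((starRingEnd ℂ) (toC (deriv Y (θ - φ)))) φ := fun φ => by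
    have h1 : HasDerivAt (fun s : ℝ => θ - s) (-1) φ := (hasDerivAt_id φ).const_sub θ
    have h2 := ((hY.hasDerivAt_toC (θ - φ)).scomp φ h1).const_sub (toC (Y θ))
    have h3 : HasDerivAt (incr Y θ) (toC (deriv Y (θ - φ))) φ := h2.congr_deriv (by simp)
    exact Complex.conjCLE.toContinuousLinearMap.hasFDerivAt.comp_hasDerivAt φ h3
  have he : ∀ φ, HasDerivAt (fun φ => 1 - chr (-1) φ) (Complex.I * chr (-1) φ) φ := fun φ =>
    ((hasDerivAt_chr (-1) φ).const_sub 1).congr_deriv (by push_cast; ring)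
  have hder : ∀ φ, φ ≠ 0 → |φ| ≤ Real.pi → HasDerivAt N (exactPart a Y θ φ) φ := by
    intro φ h0 h
    have h1 := ((((hasDerivAt_chr (-1) φ).mul (hw φ)).const_mul (Complex.I * ν)).div (he φ)
      (hD φ h0 h))
    refine h1.congr_deriv ?_
    have hk : (starRingEnd ℂ) (kap φ) = Complex.I / (1 - chr (-1) φ) :=
      eq_div_of_mul_eq (hD φ h0 h) (conj_kap_mul h0 h)
    rw [exactPart, chord_div_conj ha θ h0 h, ← hν, defect, map_sub, map_mul, hk]
    have hD' := hD φ h0 h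
    simp only [Pi.mul_apply]
    push_cast
    field_simp
    ring
  -- Numerator and denominator both vanish at 0, so the limit is the quotient of their slopes. The
  -- Hölder bound on the defect, used for integrability, is not needed for this limit.
  have hlim : Tendsto N (𝓝[≠] 0) (𝓝 (Complex.I * ν * ((starRingEnd ℂ) (toC (deriv Y θ)) /
      Complex.I))) := by
    have h1 := (hw 0).tendsto_slope_zero
    have h2 := (he 0).tendsto_slope_zero
    have h3 : Tendsto (chr (-1)) (𝓝[≠] 0) (𝓝 1) := by
      have := (continuous_chr (-1)).tendsto 0
      rw [chr_apply_zero] at this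
      exact this.mono_left nhdsWithin_le_nhds
    have i0 : incr Y θ 0 = 0 := by simp [incr]
    simp only [zero_add, i0, map_zero, sub_zero, chr_apply_zero, sub_self, mul_one] at h1 h2
    have h4 := (h3.mul (h1.div h2 Complex.I_ne_zero)).const_mul (Complex.I * ν)
    rw [one_mul] at h4
    refine h4.congr' ?_
    filter_upwards [self_mem_nhdsWithin] with φ hφ
    have hφ' : (φ : ℂ) ≠ 0 := by exact_mod_cast hφ
    simp only [hN, Complex.real_smul, Complex.ofReal_inv, Pi.div_apply]
    by_cases hz : 1 - chr (-1) φ = 0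
    · simp [hz]
    · field_simp
  have hcont : ∀ φ, φ ≠ 0 → |φ| ≤ Real.pi → ContinuousAt N φ := fun φ h0 h =>
    (hder φ h0 h).continuousAt
  have hi := intervalIntegrable_exactPart hY hγ0 hγ a θ
  have i1 : IntervalIntegrable (exactPart a Y θ) volume (-Real.pi) 0 :=
    hi.mono_set (by rw [uIcc_of_le (by linarith), uIcc_of_le (by linarith)]
                    exact Icc_subset_Icc le_rfl hpi.le)
  have i2 : IntervalIntegrable (exactPart a Y θ) volume 0 Real.pi :=
    hi.mono_set (by rw [uIcc_of_le (by linarith), uIcc_of_le (by linarith)]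
                    exact Icc_subset_Icc (by linarith) le_rfl)
  have a1 : |(-Real.pi)| = Real.pi := by rw [abs_neg, abs_of_pos hpi]
  have a2 : |Real.pi| = Real.pi := abs_of_pos hpi
  have r1 := intervalIntegral.integral_eq_sub_of_hasDerivAt_of_tendsto (a := -Real.pi) (b := 0)
    (by linarith) (fun φ hφ => hder φ hφ.2.ne (abs_le.2 ⟨hφ.1.le, by linarith [hφ.2]⟩)) i1
    ((hcont (-Real.pi) (by linarith) a1.le).tendsto.mono_left nhdsWithin_le_nhds)
    (hlim.mono_left (nhdsWithin_mono _ fun x hx => ne_of_lt hx))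
  have r2 := intervalIntegral.integral_eq_sub_of_hasDerivAt_of_tendsto (a := 0) (b := Real.pi)
    hpi (fun φ hφ => hder φ hφ.1.ne' (abs_le.2 ⟨by linarith [hφ.1], hφ.2.le⟩)) i2
    (hlim.mono_left (nhdsWithin_mono _ fun x hx => ne_of_gt hx))
    ((hcont Real.pi hpi.ne' a2.le).tendsto.mono_left nhdsWithin_le_nhds)
  -- Only the endpoints remain, and both ingredients of `N` have period 2π.
  have hper : N Real.pi = N (-Real.pi) := by
    have e1 : chr (-1) Real.pi = chr (-1) (-Real.pi) := by
      have := chr_periodic (-1) (-Real.pi)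
      rwa [show -Real.pi + 2 * Real.pi = Real.pi by ring] at this
    have e2 : incr Y θ Real.pi = incr Y θ (-Real.pi) := by
      have := hY.periodic (θ - Real.pi)
      rw [incr, incr, ← this]
      ring_nf
    simp only [hN, e1, e2]
  rw [← intervalIntegral.integral_add_adjacent_intervals i1 i2, r1, r2, hper]
  ring

end Estimates

/-! ### The quadratic remainder -/

section Quadratic

variable {γ M : ℝ} {Y : ℝ → Plane}

/-- The second-order remainder in the expansion of the integrand. -/
def quadPart (a : ℂ) (Y : ℝ → Plane) (ε θ φ : ℝ) : ℂ :=
  ((defect Y θ φ) ^ 2 / (chord a θ φ + ε * incr Y θ φ) +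
    (starRingEnd ℂ) (defect Y θ φ) ^ 2 * (chord a θ φ + ε * incr Y θ φ) /
      (starRingEnd ℂ) (chord a θ φ + ε * incr Y θ φ) ^ 2 +
    2 * (starRingEnd ℂ) (kap φ) * (starRingEnd ℂ) (defect Y θ φ) * incr Y θ φ /
      (starRingEnd ℂ) (chord a θ φ + ε * incr Y θ φ) -
    2 * (starRingEnd ℂ) (kap φ) * (chord a θ φ / (starRingEnd ℂ) (chord a θ φ)) *
      (starRingEnd ℂ) (defect Y θ φ) * (starRingEnd ℂ) (incr Y θ φ) /
      (starRingEnd ℂ) (chord a θ φ + ε * incr Y θ φ)) / 2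

/-- The chord is at least 2(|a|/π)|φ|, and the condition on ε lets the perturbation consume at most
half of it. The perturbed curve thus stays uniformly non-degenerate for all `θ` and all small ε. -/
theorem le_norm_chord_add (hY : HolderOne γ M Y) {a : ℂ} {ε : ℝ} (hε : |ε| * M ≤ ‖a‖ / Real.pi)
    (θ : ℝ) {φ : ℝ} (h : |φ| ≤ Real.pi) :
    ‖a‖ / Real.pi * |φ| ≤ ‖chord a θ φ + ε * incr Y θ φ‖ := by
  have h1 := le_norm_chord a θ h
  have h2 : ‖(ε : ℂ) * incr Y θ φ‖ ≤ ‖a‖ / Real.pi * |φ| := by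
    rw [norm_mul, Complex.norm_real, Real.norm_eq_abs]
    calc |ε| * ‖incr Y θ φ‖ ≤ |ε| * (M * |φ|) := by gcongr; exact norm_incr_le hY θ φ
      _ = |ε| * M * |φ| := by ring
      _ ≤ _ := by gcongr
  have h3 := norm_sub_le (chord a θ φ + ε * incr Y θ φ) (ε * incr Y θ φ)
  rw [add_sub_cancel_right] at h3
  linarith

/-- Each of the four terms has a factor `defect`. Its decay |φ|^γ is needed against the denominator
of size |φ|; the remaining factor is bounded, since κ occurs only multiplied by the increment. -/
theorem norm_quadPart_le (a : ℂ) (Y : ℝ → Plane) (ε θ φ : ℝ) :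
    ‖quadPart a Y ε θ φ‖ ≤ ‖defect Y θ φ‖ *
      (‖defect Y θ φ‖ + 2 * ‖kap φ * incr Y θ φ‖) / ‖chord a θ φ + ε * incr Y θ φ‖ := by
  rw [quadPart, norm_div, Complex.norm_ofNat, div_le_iff₀ two_pos]
  set z := chord a θ φ + ε * incr Y θ φ
  set h := defect Y θ φ
  set w := incr Y θ φ
  have e1 : ‖h ^ 2 / z‖ = ‖h‖ * ‖h‖ / ‖z‖ := by
    rw [norm_div, norm_pow, sq]
  have e2 : ‖(starRingEnd ℂ) h ^ 2 * z / (starRingEnd ℂ) z ^ 2‖ = ‖h‖ * ‖h‖ / ‖z‖ := by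
    rw [norm_div, norm_mul, norm_pow, norm_pow, Complex.norm_conj, Complex.norm_conj]
    by_cases hz : ‖z‖ = 0
    · simp [hz]
    · field_simp
  have e3 : ‖2 * (starRingEnd ℂ) (kap φ) * (starRingEnd ℂ) h * w / (starRingEnd ℂ) z‖ =
      2 * (‖h‖ * ‖kap φ * w‖ / ‖z‖) := by
    rw [norm_div, norm_mul, norm_mul, norm_mul, norm_mul, Complex.norm_conj, Complex.norm_conj,
      Complex.norm_conj, Complex.norm_ofNat]
    ring
  have e4 : ‖2 * (starRingEnd ℂ) (kap φ) * (chord a θ φ / (starRingEnd ℂ) (chord a θ φ)) *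
      (starRingEnd ℂ) h * (starRingEnd ℂ) w / (starRingEnd ℂ) z‖ ≤
      2 * (‖h‖ * ‖kap φ * w‖ / ‖z‖) := by
    rw [norm_div, norm_mul, norm_mul, norm_mul, norm_mul, norm_mul, norm_div, Complex.norm_conj,
      Complex.norm_conj, Complex.norm_conj, Complex.norm_conj, Complex.norm_conj,
      Complex.norm_ofNat]
    have := div_self_le_one ‖chord a θ φ‖
    have h0 : 0 ≤ 2 * (‖h‖ * (‖kap φ‖ * ‖w‖) / ‖z‖) := by positivity
    calc _ = 2 * (‖h‖ * (‖kap φ‖ * ‖w‖) / ‖z‖) * (‖chord a θ φ‖ / ‖chord a θ φ‖) := by ring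
      _ ≤ 2 * (‖h‖ * (‖kap φ‖ * ‖w‖) / ‖z‖) * 1 := by gcongr
      _ = _ := by ring
  refine (norm_sub_le _ _).trans ((add_le_add ((norm_add_le _ _).trans
    (add_le_add ((norm_add_le _ _).trans (add_le_add e1.le e2.le)) e3.le)) e4).trans_eq ?_)
  ring

theorem exists_norm_quadPart_le (hY : HolderOne γ M Y) (hγ0 : 0 < γ) (hγ : γ ≤ 1) {a : ℂ}
    (ha : a ≠ 0) : ∃ K, 0 ≤ K ∧ ∀ ε, |ε| * M ≤ ‖a‖ / Real.pi → ∀ θ φ, φ ≠ 0 → |φ| ≤ Real.pi →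
      ‖quadPart a Y ε θ φ‖ ≤ K * |φ| ^ (γ - 1) := by
  obtain ⟨K, hK, hd⟩ := exists_norm_defect_le hY hγ0 hγ
  have hM := hY.nonneg
  have hna : 0 < ‖a‖ := norm_pos_iff.2 ha
  refine ⟨K * ((M + Real.pi / 2 * M) + 2 * (Real.pi / 2 * M)) / (‖a‖ / Real.pi), by positivity,
    fun ε hε θ φ h0 h => ?_⟩
  have hφ := abs_pos.2 h0
  refine (norm_quadPart_le a Y ε θ φ).trans ?_
  calc _ ≤ (K * |φ| ^ γ) * ((M + Real.pi / 2 * M) + 2 * (Real.pi / 2 * M)) /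
        (‖a‖ / Real.pi * |φ|) := by
        gcongr
        · exact hd θ φ h0 h
        · exact norm_defect_le hY θ h0 h
        · exact norm_kap_mul_incr_le hY θ h0 h
        · exact le_norm_chord_add hY hε θ h
    _ = _ := by
        rw [Real.rpow_sub_one hφ.ne']
        field_simp

theorem measurable_quadPart (hY : HolderOne γ M Y) (a : ℂ) (ε θ : ℝ) :
    Measurable (quadPart a Y ε θ) := by
  have hk := measurable_kap
  have hh := measurable_defect hY θ
  have hw := measurable_incr hY θ
  have hc := measurable_chord a θ
  have hz : Measurable fun φ => chord a θ φ + ε * incr Y θ φ := hc.add (measurable_const.mul hw)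
  have hzb := measurable_conj hz
  exact ((((hh.pow_const 2).div hz).add (((measurable_conj hh).pow_const 2).mul hz |>.div
    (hzb.pow_const 2))).add ((((measurable_const.mul (measurable_conj hk)).mul
    (measurable_conj hh)).mul hw).div hzb)).sub ((((((measurable_const.mul (measurable_conj hk)).mul
    (hc.div (measurable_conj hc))).mul (measurable_conj hh)).mul (measurable_conj hw))).div hzb)
    |>.div_const 2

end Quadratic

/-! ### The circles -/

theorem toC_circle (A B C₁ C₂ θ : ℝ) : toC (circle A B C₁ C₂ θ) =
    (A + B * Complex.I) * chr 1 θ + (C₁ + C₂ * Complex.I) := by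
  simp only [circle, map_add, map_smul, toC_er, toC_et, toC_ex, toC_ey, Complex.real_smul]
  ring

theorem circle_eq_mode (A B C₁ C₂ : ℝ) : circle A B C₁ C₂ =
    mode 1 (A + B * Complex.I) + mode 0 (C₁ + C₂ * Complex.I) := by
  funext θ
  apply toC.injective
  rw [toC_circle, Pi.add_apply, map_add, toC_mode, toC_mode, chr_zero, mul_one]

theorem hasDerivAt_mode (m : ℤ) (c : ℂ) (θ : ℝ) :
    HasDerivAt (mode m c) (mode m (m * Complex.I * c) θ) θ := by
  refine (hasDerivAt_of_toC (d := c * (m * Complex.I * chr m θ)) ?_).congr_deriv ?_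
  · simp_rw [toC_mode]
    exact (hasDerivAt_chr m θ).const_mul c
  · rw [mode]; congr 1; ring

theorem hasDerivAt_circle (A B C₁ C₂ θ : ℝ) :
    HasDerivAt (circle A B C₁ C₂) (mode 1 (Complex.I * (A + B * Complex.I)) θ) θ := by
  rw [circle_eq_mode]
  refine ((hasDerivAt_mode 1 _ θ).add (hasDerivAt_mode 0 _ θ)).congr_deriv ?_
  simp [mode]

theorem circle_periodic (A B C₁ C₂ : ℝ) :
    Function.Periodic (circle A B C₁ C₂) (2 * Real.pi) := by
  rw [circle_eq_mode]
  exact (mode_periodic _ _).add (mode_periodic _ _)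

theorem deriv_circle (A B C₁ C₂ : ℝ) :
    deriv (circle A B C₁ C₂) = mode 1 (Complex.I * (A + B * Complex.I)) :=
  funext fun θ => (hasDerivAt_circle A B C₁ C₂ θ).deriv

theorem HolderBdd.comp_toC_symm {γ : ℝ} {w : ℝ → ℂ} (hw : HolderBdd γ w) :
    HolderBdd γ fun θ => toC.symm (w θ) := by
  obtain ⟨hc, M, hM, hb, hh⟩ := hw
  refine ⟨toC.symm.continuous.comp hc, M, hM, fun θ => ?_, fun θ θ' => ?_⟩
  · rw [LinearIsometryEquiv.norm_map]; exact hb θ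
  · rw [← map_sub, LinearIsometryEquiv.norm_map]; exact hh θ θ'

theorem holderBdd_mode {γ : ℝ} (hγ0 : 0 ≤ γ) (hγ : γ ≤ 1) (m : ℤ) (c : ℂ) :
    HolderBdd γ (mode m c) :=
  ((HolderBdd.const γ c).mul (holderBdd_chr hγ0 hγ m)).comp_toC_symm

theorem HolderBdd.hilbert_eq {γ : ℝ} (hγ0 : 0 < γ) (hγ : γ ≤ 1) {w : ℝ → Plane}
    (hw : HolderBdd γ w) (θ : ℝ) : hilbert w θ = hilbertInt w θ := by
  obtain ⟨hc, M, hM, -, hh⟩ := hw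
  exact hilbert_eq_hilbertInt hM hγ0 hγ hc hh θ

theorem HolderBdd.const_smul {E : Type*} [NormedAddCommGroup E] [NormedSpace ℝ E] {γ : ℝ}
    {w : ℝ → E} (hw : HolderBdd γ w) (ε : ℝ) : HolderBdd γ fun θ => ε • w θ := by
  obtain ⟨hc, M, hM, hb, hh⟩ := hw
  refine ⟨hc.const_smul ε, |ε| * M, by positivity, fun θ => ?_, fun θ θ' => ?_⟩
  · rw [norm_smul, Real.norm_eq_abs]; gcongr; exact hb θ
  · rw [← smul_sub, norm_smul, Real.norm_eq_abs, mul_assoc]; gcongr; exact hh θ θ'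

theorem HolderBdd.hilbertInt_add_smul {E : Type*} [NormedAddCommGroup E] [NormedSpace ℝ E] {γ : ℝ}
    (hγ0 : 0 < γ) (hγ : γ ≤ 1) {v w : ℝ → E}
    (hv : HolderBdd γ v) (hw : HolderBdd γ w) (ε θ : ℝ) :
    hilbertInt (fun s => v s + ε • w s) θ = hilbertInt v θ + ε • hilbertInt w θ := by
  obtain ⟨hc, M, hM, -, hh⟩ := hv
  obtain ⟨hc', M', hM', -, hh'⟩ := hw
  have i1 := intervalIntegrable_cot_smul hM hγ0 hγ hc hh θ
  have i2 := intervalIntegrable_cot_smul hM' hγ0 hγ hc' hh' θ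
  have i3 : IntervalIntegrable (fun φ => ε • Real.cot (φ / 2) • (w (θ - φ) - w (θ + φ)))
      volume 0 Real.pi := i2.smul ε
  have e : ∫ φ in (0 : ℝ)..Real.pi, Real.cot (φ / 2) •
        ((v (θ - φ) + ε • w (θ - φ)) - (v (θ + φ) + ε • w (θ + φ))) =
      (∫ φ in (0 : ℝ)..Real.pi, Real.cot (φ / 2) • (v (θ - φ) - v (θ + φ))) +
        ε • ∫ φ in (0 : ℝ)..Real.pi, Real.cot (φ / 2) • (w (θ - φ) - w (θ + φ)) := by
    rw [← intervalIntegral.integral_smul, ← intervalIntegral.integral_add i1 i3]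
    refine intervalIntegral.integral_congr fun φ _ => ?_
    module
  rw [hilbertInt, e, smul_add, smul_comm _ ε]
  rfl

/-! ### The derivative of the velocity at a circle -/

section Linearization

variable {γ M : ℝ} {Y : ℝ → Plane}

/-- The expansion in ε is integrated term by term. In the linear part the tangent term and the exact
derivative integrate to zero, and the cotangent term gives (i/2)(-2π)HY. -/
theorem toC_remainder_circle_add (hY : HolderOne γ M Y) (hγ0 : 0 < γ) (hγ : γ ≤ 1)
    {A B C₁ C₂ : ℝ} {a : ℂ} (ha : a = A + B * Complex.I) (ha0 : a ≠ 0)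
    {ε : ℝ} (hε : |ε| * M ≤ ‖a‖ / Real.pi) (θ : ℝ) :
    toC (remainder (fun s => circle A B C₁ C₂ s + ε • Y s) θ) =
      -(1 / (4 * Real.pi)) * ((∫ φ in (-Real.pi)..Real.pi,
        Complex.I / 2 * (starRingEnd ℂ) (kap φ) * chord a θ φ) +
        ε * (-(Real.pi * Complex.I) * hilbertInt (fun s => toC (Y s)) θ) +
        ε ^ 2 * ∫ φ in (-Real.pi)..Real.pi, quadPart a Y ε θ φ) := by
  obtain ⟨K, hK, hq⟩ := exists_norm_quadPart_le hY hγ0 hγ ha0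
  set X : ℝ → Plane := fun s => circle A B C₁ C₂ s + ε • Y s with hX
  have hna : 0 < ‖a‖ / Real.pi := div_pos (norm_pos_iff.2 ha0) Real.pi_pos
  have hXd : ∀ s, HasDerivAt X (mode 1 (Complex.I * a) s + ε • deriv Y s) s := fun s => by
    rw [ha]
    exact (hasDerivAt_circle A B C₁ C₂ s).add ((hY.hasDerivAt s).const_smul ε)
  have hXp : Function.Periodic X (2 * Real.pi) := fun s => by
    simp only [hX, circle_periodic A B C₁ C₂ s, hY.periodic s]
  have hdiff : ∀ φ, toC (X θ) - toC (X (θ - φ)) = chord a θ φ + ε * incr Y θ φ := fun φ => by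
    simp only [hX, map_add, map_smul, toC_circle, Complex.real_smul, chord_eq, incr, ← ha]
    ring
  have hzne : ∀ φ, φ ≠ 0 → |φ| ≤ Real.pi → chord a θ φ + ε * incr Y θ φ ≠ 0 := fun φ h0 h h1 => by
    have := le_norm_chord_add hY hε θ h
    rw [h1, norm_zero] at this
    have := mul_pos hna (abs_pos.2 h0)
    linarith
  rw [toC_remainder hXp (fun s => (hXd s).differentiableAt) (θ := θ)
    (fun φ h0 h h1 => hzne φ h0 h (by rw [← hdiff, h1, sub_self]))]
  congr 1
  have iC : IntervalIntegrable (fun φ => Complex.I / 2 * (starRingEnd ℂ) (kap φ) * chord a θ φ)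
      volume (-Real.pi) Real.pi := by
    refine (intervalIntegrable_of_bound (γ := 1) (C := ‖a‖) one_pos
      ((measurable_const.mul (measurable_conj measurable_kap)).mul (measurable_chord a θ))
      fun φ h0 h => ?_).1
    rw [sub_self, Real.rpow_zero, mul_one]
    show ‖Complex.I / 2 * (starRingEnd ℂ) (kap φ) * (a * chr 1 θ * (1 - chr (-1) φ))‖ ≤ ‖a‖
    have : Complex.I / 2 * (starRingEnd ℂ) (kap φ) * (a * chr 1 θ * (1 - chr (-1) φ)) =
        Complex.I / 2 * (a * chr 1 θ) * Complex.I := by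
      linear_combination Complex.I / 2 * (a * chr 1 θ) * conj_kap_mul h0 h
    rw [this]
    simp only [norm_mul, norm_div, Complex.norm_I, norm_chr, Complex.norm_ofNat, mul_one]
    linarith [norm_nonneg a]
  have iQ := (intervalIntegrable_of_bound hγ0 (measurable_quadPart hY a ε θ) (hq ε hε θ)).1
  have iD : IntervalIntegrable (fun φ => -(Complex.I / 2) * toC (deriv Y (θ - φ))) volume
      (-Real.pi) Real.pi :=
    (continuous_const.mul (hY.continuous_toC_deriv.comp
      (continuous_const.sub continuous_id))).intervalIntegrable _ _
  have iW := (intervalIntegrable_cot_mul_incr hY θ).const_mul (Complex.I / 2)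
  have iE := intervalIntegrable_exactPart hY hγ0 hγ a θ
  have e : ∫ φ in (-Real.pi)..Real.pi, (kerC (toC (X θ) - toC (X (θ - φ))) (toC (deriv X (θ - φ))) -
        1 / 2 * (Real.cot (φ / 2) : ℂ) * toC (deriv X (θ - φ))) =
      ∫ φ in (-Real.pi)..Real.pi, (Complex.I / 2 * (starRingEnd ℂ) (kap φ) * chord a θ φ +
        ε * (-(Complex.I / 2) * toC (deriv Y (θ - φ)) +
          Complex.I / 2 * ((2 * kap φ + Complex.I) * incr Y θ φ) + exactPart a Y θ φ) +
        ε ^ 2 * quadPart a Y ε θ φ) := by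
    refine intervalIntegral.integral_congr_ae ?_
    have h0 : ∀ᵐ φ : ℝ, φ ≠ 0 := by
      rw [ae_iff]; simp
    filter_upwards [h0] with φ h0 hφ
    rw [uIoc_of_le (by linarith [Real.pi_pos])] at hφ
    have h : |φ| ≤ Real.pi := abs_le.2 ⟨hφ.1.le, hφ.2⟩
    have hcot : (Real.cot (φ / 2) : ℂ) = 2 * kap φ + Complex.I := by rw [two_mul_kap]; ring
    have hder : toC (deriv X (θ - φ)) = kap φ * chord a θ φ + ε * toC (deriv Y (θ - φ)) := by
      rw [(hXd _).deriv, map_add, map_smul, toC_mode, kap_mul_chord a θ h0 h, Complex.real_smul]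
      ring
    rw [hdiff, hder, hcot, kerC_expansion (chord_ne_zero ha0 θ h0 h) (hzne φ h0 h) (conj_kap φ)]
    simp only [exactPart, quadPart, defect]
    ring
  rw [e, intervalIntegral.integral_add (iC.add (((iD.add iW).add iE).const_mul _))
      (iQ.const_mul _), intervalIntegral.integral_add iC (((iD.add iW).add iE).const_mul _),
    intervalIntegral.integral_const_mul, intervalIntegral.integral_const_mul,
    intervalIntegral.integral_add (iD.add iW) iE, intervalIntegral.integral_add iD iW,
    intervalIntegral.integral_const_mul, intervalIntegral.integral_const_mul,
    integral_exactPart hY hγ0 hγ ha0, integral_deriv_shift hY, integral_cot_mul_incr hY]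
  ring

theorem toC_Lam_circle_add (hY : HolderOne γ M Y) (hγ0 : 0 < γ) (hγ : γ ≤ 1)
    (A B C₁ C₂ ε θ : ℝ) :
    toC (Lam (fun s => circle A B C₁ C₂ s + ε • Y s) θ) =
      -(1 / 4) * toC (hilbertInt (deriv (circle A B C₁ C₂)) θ) -
        ε * (1 / 4 * hilbertInt (fun s => toC (deriv Y s)) θ) := by
  have hd : deriv (fun s => circle A B C₁ C₂ s + ε • Y s) =
      fun s => deriv (circle A B C₁ C₂) s + ε • deriv Y s := by
    funext s
    exact (((hasDerivAt_circle A B C₁ C₂ s).differentiableAt.hasDerivAt).add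
      ((hY.hasDerivAt s).const_smul ε)).deriv
  have h1 : HolderBdd γ (deriv (circle A B C₁ C₂)) := by
    rw [deriv_circle]; exact holderBdd_mode hγ0.le hγ _ _
  rw [Lam, hd, (h1.add (hY.holderBdd_deriv.const_smul ε)).hilbert_eq hγ0 hγ,
    h1.hilbertInt_add_smul hγ0 hγ hY.holderBdd_deriv, map_smul, map_add, map_smul, toC_hilbertInt (deriv Y),
    Complex.real_smul, Complex.real_smul]
  push_cast
  ring

theorem hilbertInt_symbol (hY : HolderOne γ M Y) (hγ0 : 0 < γ) (hγ : γ ≤ 1) (θ : ℝ) :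
    hilbertInt (fun s => toC (deriv Y s) + -Complex.I * toC (Y s)) θ =
      hilbertInt (fun s => toC (deriv Y s)) θ - Complex.I * hilbertInt (fun s => toC (Y s)) θ := by
  have h2 : HolderBdd γ fun s => -Complex.I * toC (Y s) :=
    (HolderBdd.const γ _).mul (hY.holderBdd_toC hγ0.le hγ)
  have := hY.holderBdd_toC_deriv.hilbertInt_add_smul hγ0 hγ h2 1 θ
  simp only [one_smul] at this
  rw [this, sub_eq_add_neg]
  congr 1
  have e : ∀ φ : ℝ, Real.cot (φ / 2) • (-Complex.I * toC (Y (θ - φ)) -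
      -Complex.I * toC (Y (θ + φ))) =
      -Complex.I * (Real.cot (φ / 2) • (toC (Y (θ - φ)) - toC (Y (θ + φ)))) := fun φ => by
    rw [Complex.real_smul, Complex.real_smul]; ring
  simp_rw [hilbertInt, e]
  rw [intervalIntegral.integral_const_mul, neg_mul, smul_neg, mul_smul_comm]

/-- The essential point is that `v` does not depend on ε: it cancels in the difference quotient, so
the velocity of the circle itself need not be computed. The linear terms combine as -(1/4)H∂Y +
(i/4)HY. -/
theorem toC_velocity_circle_add (hY : HolderOne γ M Y) (hγ0 : 0 < γ) (hγ : γ ≤ 1)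
    {A B C₁ C₂ : ℝ} {a : ℂ} (ha : a = A + B * Complex.I) (ha0 : a ≠ 0) (θ : ℝ) :
    ∃ v : ℂ, ∀ ε : ℝ, |ε| * M ≤ ‖a‖ / Real.pi →
      toC (velocity (fun s => circle A B C₁ C₂ s + ε • Y s) θ) =
        v + ε * toC (circleOp Y θ) -
          ε ^ 2 * (1 / (4 * Real.pi) * ∫ φ in (-Real.pi)..Real.pi, quadPart a Y ε θ φ) := by
  refine ⟨-(1 / 4) * toC (hilbertInt (deriv (circle A B C₁ C₂)) θ) +
    -(1 / (4 * Real.pi)) * (∫ φ in (-Real.pi)..Real.pi,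
        Complex.I / 2 * (starRingEnd ℂ) (kap φ) * chord a θ φ), fun ε hε => ?_⟩
  rw [velocity, map_add, toC_Lam_circle_add hY hγ0 hγ,
    toC_remainder_circle_add hY hγ0 hγ ha ha0 hε, toC_circleOp hY hγ0 hγ,
    hilbertInt_symbol hY hγ0 hγ]
  have hpi : (Real.pi : ℂ) ≠ 0 := by exact_mod_cast Real.pi_ne_zero
  field_simp
  ring

/-- The difference quotient misses `circleOp Y` by ε times an integral bounded by a constant `J`
that depends neither on `θ` nor on ε; this is uniform convergence. -/
theorem hasLinearization_circle (hY : HolderOne γ M Y) (hγ0 : 0 < γ) (hγ : γ ≤ 1)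
    {A B : ℝ} (C₁ C₂ : ℝ) (hAB : 0 < A ^ 2 + B ^ 2) :
    HasLinearization (circle A B C₁ C₂) Y (circleOp Y) := by
  obtain ⟨a, ha⟩ : ∃ a : ℂ, a = A + B * Complex.I := ⟨_, rfl⟩
  have ha0 : a ≠ 0 := by
    intro h
    have h1 : Complex.normSq a = A ^ 2 + B ^ 2 := by rw [ha, Complex.normSq_add_mul_I]
    rw [h, map_zero] at h1
    linarith
  obtain ⟨K, hK, hq⟩ := exists_norm_quadPart_le hY hγ0 hγ ha0
  have hM := hY.nonneg
  have hna : 0 < ‖a‖ / Real.pi := div_pos (norm_pos_iff.2 ha0) Real.pi_pos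
  set J := ∫ φ in (-Real.pi)..Real.pi, K * |φ| ^ (γ - 1) with hJ
  have hJ0 : 0 ≤ J := intervalIntegral.integral_nonneg (by linarith [Real.pi_pos]) fun φ _ => by
    positivity
  rw [HasLinearization, Metric.tendstoUniformly_iff]
  intro η hη
  have hε1 : ∀ᶠ ε : ℝ in 𝓝[≠] 0, |ε| * M < ‖a‖ / Real.pi := by
    have : Tendsto (fun ε : ℝ => |ε| * M) (𝓝[≠] 0) (𝓝 (|0| * M)) :=
      ((continuous_abs.mul continuous_const).tendsto 0).mono_left nhdsWithin_le_nhds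
    rw [abs_zero, zero_mul] at this
    exact this.eventually_lt_const hna
  have hε2 : ∀ᶠ ε : ℝ in 𝓝[≠] 0, |ε| * (1 / (4 * Real.pi) * J) < η := by
    have : Tendsto (fun ε : ℝ => |ε| * (1 / (4 * Real.pi) * J)) (𝓝[≠] 0)
        (𝓝 (|0| * (1 / (4 * Real.pi) * J))) :=
      ((continuous_abs.mul continuous_const).tendsto 0).mono_left nhdsWithin_le_nhds
    rw [abs_zero, zero_mul] at this
    exact this.eventually_lt_const hη
  filter_upwards [hε1, hε2, self_mem_nhdsWithin] with ε h1 h2 h3 θ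
  obtain ⟨v, hv⟩ := toC_velocity_circle_add hY hγ0 hγ (C₁ := C₁) (C₂ := C₂) ha ha0 θ
  have v1 := hv ε h1.le
  -- The case ε = 0 identifies `v` with the velocity of the circle.
  have v0 := hv 0 (by rw [abs_zero, zero_mul]; exact hna.le)
  simp only [zero_smul, add_zero, Complex.ofReal_zero, zero_mul, ne_eq, OfNat.ofNat_ne_zero,
    not_false_eq_true, zero_pow, sub_zero] at v0
  have hε0 : (ε : ℂ) ≠ 0 := by exact_mod_cast h3
  have e : toC (circleOp Y θ - ε⁻¹ • (velocity (fun s => circle A B C₁ C₂ s + ε • Y s) θ -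
      velocity (circle A B C₁ C₂) θ)) =
      ε * (1 / (4 * Real.pi) * ∫ φ in (-Real.pi)..Real.pi, quadPart a Y ε θ φ) := by
    rw [map_sub, map_smul, map_sub, v1]
    have v0' : toC (velocity (circle A B C₁ C₂) θ) = v := v0
    rw [v0', Complex.real_smul]
    push_cast
    field_simp
    ring
  rw [dist_eq_norm, ← toC.norm_map, e, norm_mul, norm_mul, Complex.norm_real, Real.norm_eq_abs]
  refine lt_of_le_of_lt ?_ h2
  have e2 : ‖(1 / (4 * Real.pi) : ℂ)‖ = 1 / (4 * Real.pi) := by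
    rw [norm_div, norm_mul, Complex.norm_real, norm_one, Complex.norm_ofNat,
      Real.norm_of_nonneg Real.pi_pos.le]
  rw [e2]
  have hpi := Real.pi_pos
  gcongr
  exact (intervalIntegrable_of_bound hγ0 (measurable_quadPart hY a ε θ) (hq ε h1.le θ)).2

end Linearization

theorem HasLinearization.unique {X Y W W' : ℝ → Plane} (h : HasLinearization X Y W)
    (h' : HasLinearization X Y W') : W = W' :=
  funext fun θ => tendsto_nhds_unique (h.tendsto_at θ) (h'.tendsto_at θ)

/-! ### Smooth functions are Hölder continuous -/

theorem iteratedDeriv_periodic {E : Type*} [NormedAddCommGroup E] [NormedSpace ℝ E] {u : ℝ → E}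
    {T : ℝ} (hp : Function.Periodic u T) (l : ℕ) :
    Function.Periodic (iteratedDeriv l u) T := by
  intro θ
  have := iteratedDeriv_comp_add_const (n := l) (f := u) (s := T)
  rw [← congrFun this θ]
  congr 1
  funext s
  exact hp s

theorem exists_norm_le_of_periodic {E : Type*} [NormedAddCommGroup E] {u : ℝ → E}
    (hc : Continuous u) (hp : Function.Periodic u (2 * Real.pi)) : ∃ M, 0 ≤ M ∧ ∀ θ, ‖u θ‖ ≤ M := by
  obtain ⟨M, hM⟩ := (isCompact_Icc (a := (0 : ℝ)) (b := 2 * Real.pi)).exists_bound_of_continuousOn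
    hc.continuousOn
  refine ⟨M, (norm_nonneg _).trans (hM 0 ⟨le_rfl, Real.two_pi_pos.le⟩), fun θ => ?_⟩
  obtain ⟨y, hy, hyx⟩ := hp.exists_mem_Ico₀ Real.two_pi_pos θ
  rw [hyx]
  exact hM y ⟨hy.1, hy.2.le⟩

theorem exists_norm_iteratedDeriv_le {u : ℝ → Plane} (hp : Function.Periodic u (2 * Real.pi))
    {k : ℕ} (hc : ContDiff ℝ k u) : ∃ M, 0 ≤ M ∧ ∀ l ≤ k, ∀ θ, ‖iteratedDeriv l u θ‖ ≤ M := by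
  have h : ∀ l : ℕ, ∃ M, 0 ≤ M ∧ (l ≤ k → ∀ θ, ‖iteratedDeriv l u θ‖ ≤ M) := fun l => by
    by_cases hl : l ≤ k
    · obtain ⟨M, hM, h⟩ := exists_norm_le_of_periodic
        (hc.continuous_iteratedDeriv l (by exact_mod_cast hl)) (iteratedDeriv_periodic hp l)
      exact ⟨M, hM, fun _ => h⟩
    · exact ⟨0, le_rfl, fun h => absurd h hl⟩
  choose M hM h using h
  refine ⟨∑ l ∈ Finset.range (k + 1), M l, Finset.sum_nonneg fun l _ => hM l, fun l hl θ => ?_⟩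
  exact (h l hl θ).trans (Finset.single_le_sum (f := M) (fun l _ => hM l)
    (Finset.mem_range.2 (Nat.lt_succ_of_le hl)))

theorem memHolder_of_bound {α : ℝ} {u : ℝ → Plane} {A : ℝ}
    (hp : Function.Periodic u (2 * Real.pi)) (hc : ContDiff ℝ (⌊α⌋₊ : ℕ) u)
    (h : α ≠ (⌊α⌋₊ : ℝ) → ∀ θ θ' : ℝ, 0 < |θ - θ'| → |θ - θ'| < 1 →
      ‖iteratedDeriv ⌊α⌋₊ u θ - iteratedDeriv ⌊α⌋₊ u θ'‖ ≤ A * |θ - θ'| ^ (α - ⌊α⌋₊)) :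
    MemHolder α u := by
  obtain ⟨M, hM, hb⟩ := exists_norm_iteratedDeriv_le hp hc
  refine ⟨hp, hc, (holderNorm_le_of_bounds (M := max M A) (le_max_of_le_left hM)
    (fun l hl θ => (hb l hl θ).trans (le_max_left _ _))
    fun hα θ θ' h0 h1 => (h hα θ θ' h0 h1).trans ?_).trans_lt ENNReal.ofReal_lt_top⟩
  gcongr
  exact le_max_right _ _

theorem exists_iteratedDeriv_sub_le {u : ℝ → Plane} (hp : Function.Periodic u (2 * Real.pi))
    {k : ℕ} (hc : ContDiff ℝ (k + 1 : ℕ) u) : ∃ L, 0 ≤ L ∧ ∀ θ θ',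
      ‖iteratedDeriv k u θ - iteratedDeriv k u θ'‖ ≤ L * |θ - θ'| := by
  obtain ⟨L, hL, hb⟩ := exists_norm_iteratedDeriv_le hp hc
  refine ⟨L, hL, norm_sub_le_of_hasDerivAt (f' := iteratedDeriv (k + 1) u) (fun θ => ?_)
    fun θ => hb (k + 1) le_rfl θ⟩
  rw [iteratedDeriv_succ]
  exact (hc.differentiable_iteratedDeriv k (by exact_mod_cast k.lt_succ_self) θ).hasDerivAt

/-- One derivative beyond ⌊α⌋ makes the last derivative Lipschitz, and at distances below 1 this is
stronger than any Hölder condition of exponent at most 1. -/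
theorem memHolder_of_contDiff {α : ℝ} {u : ℝ → Plane}
    (hp : Function.Periodic u (2 * Real.pi)) (hc : ContDiff ℝ (⌊α⌋₊ + 1 : ℕ) u) :
    MemHolder α u := by
  obtain ⟨L, hL, hb⟩ := exists_iteratedDeriv_sub_le hp hc
  refine memHolder_of_bound (A := L) hp (hc.of_le (by exact_mod_cast Nat.le_succ _))
    fun _ θ θ' h0 h1 => (hb θ θ').trans ?_
  gcongr
  have : α - ⌊α⌋₊ ≤ 1 := by linarith [Nat.lt_floor_add_one α]
  simpa using Real.rpow_le_rpow_of_exponent_ge h0 h1.le this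

/-! ### The operator on trigonometric polynomials -/

theorem HolderOne.of_contDiff {γ : ℝ} (hγ0 : 0 < γ) (hγ : γ < 1) {Y : ℝ → Plane}
    (hp : Function.Periodic Y (2 * Real.pi)) (hc : ContDiff ℝ 2 Y) : ∃ M, HolderOne γ M Y :=
  (memHolder_of_contDiff hp
    (by rw [floor_one_add hγ0 hγ]; exact_mod_cast hc)).exists_holderOne hγ0 hγ

/-- The trigonometric polynomial with frequencies in `s` and coefficients `c`. -/
def trigPoly (s : Finset ℤ) (c : ℤ → ℂ) : ℝ → Plane := ∑ m ∈ s, mode m (c m)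

theorem contDiff_trigPoly (s : Finset ℤ) (c : ℤ → ℂ) {n : WithTop ℕ∞} :
    ContDiff ℝ n (trigPoly s c) := by
  have : trigPoly s c = fun θ => ∑ m ∈ s, mode m (c m) θ := by
    funext θ; simp [trigPoly]
  rw [this]
  exact ContDiff.sum fun m _ => contDiff_mode m (c m)

theorem trigPoly_periodic (s : Finset ℤ) (c : ℤ → ℂ) :
    Function.Periodic (trigPoly s c) (2 * Real.pi) := by
  intro θ
  simp only [trigPoly, Finset.sum_apply, mode_periodic _ _ θ]

theorem exists_holderOne_trigPoly {γ : ℝ} (hγ0 : 0 < γ) (hγ : γ < 1) (s : Finset ℤ) (c : ℤ → ℂ) :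
    ∃ M, HolderOne γ M (trigPoly s c) :=
  HolderOne.of_contDiff hγ0 hγ (trigPoly_periodic s c) (contDiff_trigPoly s c)

theorem toC_trigPoly (s : Finset ℤ) (c : ℤ → ℂ) (θ : ℝ) :
    toC (trigPoly s c θ) = ∑ m ∈ s, c m * chr m θ := by
  simp only [trigPoly, Finset.sum_apply, map_sum, toC_mode]

theorem circleOp_add {γ M N : ℝ} {Y Z : ℝ → Plane} (hY : HolderOne γ M Y) (hZ : HolderOne γ N Z)
    (hYZ : ∃ K, HolderOne γ K (Y + Z)) (hγ0 : 0 < γ) (hγ : γ ≤ 1) :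
    circleOp (Y + Z) = circleOp Y + circleOp Z := by
  obtain ⟨K, hK⟩ := hYZ
  funext θ
  apply toC.injective
  have h := (holderBdd_symbol hY hγ0 hγ).hilbertInt_add_smul hγ0 hγ (holderBdd_symbol hZ hγ0 hγ) 1 θ
  simp only [one_smul] at h
  rw [toC_circleOp hK hγ0 hγ, Pi.add_apply, map_add, toC_circleOp hY hγ0 hγ,
    toC_circleOp hZ hγ0 hγ, ← mul_add, ← h]
  congr 2
  funext s
  rw [((hY.hasDerivAt s).add (hZ.hasDerivAt s)).deriv, Pi.add_apply, map_add, map_add]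
  ring

theorem circleOp_mode (m : ℤ) (c : ℂ) : circleOp (mode m c) = mode m (-(lam m : ℂ) * c) := by
  obtain ⟨M, hM⟩ := HolderOne.of_contDiff (γ := 1 / 2) (by norm_num) (by norm_num)
    (mode_periodic m c) (contDiff_mode m c)
  funext θ
  apply toC.injective
  rw [toC_circleOp hM (by norm_num) (by norm_num), toC_mode]
  have e : (fun s => toC (deriv (mode m c) s) + -Complex.I * toC (mode m c s)) =
      fun s => ((m - 1) * Complex.I * c) * chr m s := by
    funext s
    rw [(hasDerivAt_mode m c s).deriv, toC_mode, toC_mode]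
    ring
  rw [e, hilbertInt_chr, lam]
  push_cast
  linear_combination (m.sign * (m - 1) / 4 * c * chr m θ : ℂ) * Complex.I_sq

theorem circleOp_trigPoly (s : Finset ℤ) (c : ℤ → ℂ) :
    circleOp (trigPoly s c) = trigPoly s fun m => -(lam m : ℂ) * c m := by
  have h0 : (0 : ℝ) < 1 / 2 := by norm_num
  have h1 : (1 / 2 : ℝ) < 1 := by norm_num
  induction s using Finset.induction_on with
  | empty =>
    have : trigPoly ∅ c = mode 0 0 := by
      funext θ; simp [trigPoly, mode]
    rw [this, circleOp_mode]
    funext θ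
    simp [trigPoly, mode]
  | insert m s hm ih =>
    obtain ⟨M, hM⟩ := HolderOne.of_contDiff h0 h1 (mode_periodic m (c m)) (contDiff_mode m (c m))
    obtain ⟨N, hN⟩ := exists_holderOne_trigPoly h0 h1 s c
    have e : trigPoly (insert m s) c = mode m (c m) + trigPoly s c := Finset.sum_insert hm
    have hK := exists_holderOne_trigPoly h0 h1 (insert m s) c
    rw [e] at hK
    rw [e, circleOp_add hM hN hK h0 h1.le, circleOp_mode, ih]
    exact (Finset.sum_insert (f := fun m => mode m (-(lam m : ℂ) * c m)) hm).symm

/-! ### The eigenfunctions -/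

/-- The frequencies of the eigenfunctions for the eigenvalue `-k/4`. -/
def freq (k : ℕ) : Finset ℤ := if k = 0 then {0, 1} else if k = 1 then {2} else {1 + (k : ℤ), 1 - (k : ℤ)}

/-- The equation is |m - 1| = k except at m = 0, where the sign vanishes. So m = 0 leaves the level
k = 1, which keeps only m = 2, and joins m = 1 at the level k = 0. -/
theorem mem_freq_iff {m : ℤ} {k : ℕ} : m ∈ freq k ↔ m.sign * (m - 1) = k := by
  rw [freq]
  rcases lt_trichotomy m 0 with h | h | h
  · rw [Int.sign_eq_neg_one_of_neg h]
    split_ifs <;> simp only [Finset.mem_insert, Finset.mem_singleton] <;> omega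
  · subst h
    rw [Int.sign_zero, zero_mul]
    split_ifs <;> simp only [Finset.mem_insert, Finset.mem_singleton, true_or, true_iff] <;> omega
  · rw [Int.sign_eq_one_of_pos h]
    split_ifs <;> simp only [Finset.mem_insert, Finset.mem_singleton] <;> omega

theorem lam_eq_iff {m : ℤ} {k : ℕ} : lam m = k / 4 ↔ m ∈ freq k := by
  rw [mem_freq_iff, lam, div_left_inj' (by norm_num)]
  exact_mod_cast Iff.rfl

theorem exists_mem_freq (m : ℤ) : ∃ k, m ∈ freq k := by
  have h : 0 ≤ m.sign * (m - 1) := by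
    rcases lt_trichotomy m 0 with h | h | h
    · rw [Int.sign_eq_neg_one_of_neg h]; omega
    · subst h; simp
    · rw [Int.sign_eq_one_of_pos h]; omega
  obtain ⟨k, hk⟩ := Int.eq_ofNat_of_zero_le h
  exact ⟨k, mem_freq_iff.2 hk⟩

theorem lam_nonneg (m : ℤ) : 0 ≤ lam m := by
  obtain ⟨k, hk⟩ := exists_mem_freq m
  rw [lam_eq_iff.2 hk]
  positivity

theorem card_freq (k : ℕ) : (freq k).card = if k = 1 then 1 else 2 := by
  rw [freq]
  split_ifs with h0 h1 h1
  · omega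
  · rfl
  · rfl
  · rw [Finset.card_pair (by omega)]

theorem freq_zero : freq 0 = {0, 1} := rfl

theorem freq_one : freq 1 = {2} := rfl

theorem freq_of_two_le {k : ℕ} (hk : 2 ≤ k) : freq k = {1 + (k : ℤ), 1 - (k : ℤ)} := by
  rw [freq, if_neg (by omega), if_neg (by omega)]

theorem modes_zero : modes 0 = {er, et, ex, ey} := if_pos rfl

theorem er_eq : er = mode 1 1 := funext fun θ => toC.injective (by rw [toC_er, toC_mode, one_mul])

theorem et_eq : et = mode 1 Complex.I := funext fun θ => toC.injective (by rw [toC_et, toC_mode])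

theorem ex_eq : ex = mode 0 1 := funext fun θ => toC.injective (by
  rw [toC_ex, toC_mode, chr_zero, one_mul])

theorem ey_eq : ey = mode 0 Complex.I := funext fun θ => toC.injective (by
  rw [toC_ey, toC_mode, chr_zero, mul_one])

theorem modes_one : modes 1 = {mode 2 1, mode 2 Complex.I} := by
  rw [modes, if_neg one_ne_zero, if_pos rfl]
  congr 1
  · funext θ
    apply toC.injective
    rw [toC_apply, toC_mode, chr_eq_cos_sin]
    simp
  · rw [Set.singleton_eq_singleton_iff]
    funext θ
    apply toC.injective
    rw [toC_apply, toC_mode, chr_eq_cos_sin]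
    simp only [Matrix.cons_val_zero, Matrix.cons_val_one]
    push_cast
    linear_combination -(Complex.sin (2 * θ)) * Complex.I_sq

/-- The trigonometric polynomial `a exp (i (1 + k) θ) + b exp (i (1 - k) θ)`. -/
def modePair (k : ℕ) (a b : ℂ) : ℝ → Plane := mode (1 + k) a + mode (1 - k) b

theorem toC_modePair (k : ℕ) (a b : ℂ) (θ : ℝ) : toC (modePair k a b θ) =
    ((a + b) * Real.cos (k * θ) + (a - b) * Complex.I * Real.sin (k * θ)) * chr 1 θ := by
  rw [modePair, Pi.add_apply, map_add, toC_mode, toC_mode, ← chr_mul, sub_eq_add_neg (1 : ℤ),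
    ← chr_mul 1 (-(k : ℤ)), ← conj_chr, chr_eq_cos_sin k, map_add, map_mul, Complex.conj_ofReal,
    Complex.conj_ofReal, Complex.conj_I]
  push_cast
  ring

theorem cos_smul_er (k : ℕ) :
    (fun θ : ℝ => Real.cos (k * θ) • er θ) = modePair k (1 / 2) (1 / 2) := by
  funext θ
  apply toC.injective
  rw [toC_modePair, map_smul, toC_er, Complex.real_smul]
  ring

theorem sin_smul_er (k : ℕ) :
    (fun θ : ℝ => Real.sin (k * θ) • er θ) = modePair k (-Complex.I / 2) (Complex.I / 2) := by
  funext θ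
  apply toC.injective
  rw [toC_modePair, map_smul, toC_er, Complex.real_smul]
  linear_combination (Real.sin (k * θ) : ℂ) * chr 1 θ * Complex.I_sq

theorem cos_smul_et (k : ℕ) :
    (fun θ : ℝ => Real.cos (k * θ) • et θ) = modePair k (Complex.I / 2) (Complex.I / 2) := by
  funext θ
  apply toC.injective
  rw [toC_modePair, map_smul, toC_et, Complex.real_smul]
  ring

theorem sin_smul_et (k : ℕ) :
    (fun θ : ℝ => Real.sin (k * θ) • et θ) = modePair k (1 / 2) (-1 / 2) := by
  funext θ
  apply toC.injective
  rw [toC_modePair, map_smul, toC_et, Complex.real_smul]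
  ring

theorem modes_of_two_le {k : ℕ} (hk : 2 ≤ k) : modes k =
    {modePair k (1 / 2) (1 / 2), modePair k (-Complex.I / 2) (Complex.I / 2),
      modePair k (Complex.I / 2) (Complex.I / 2), modePair k (1 / 2) (-1 / 2)} := by
  rw [modes, if_neg (by omega), if_neg (by omega), cos_smul_er, sin_smul_er, cos_smul_et,
    sin_smul_et]

theorem trigPoly_congr {s : Finset ℤ} {c d : ℤ → ℂ} (h : ∀ m ∈ s, c m = d m) :
    trigPoly s c = trigPoly s d := Finset.sum_congr rfl fun m hm => by rw [h m hm]

theorem trigPoly_pair {m n : ℤ} (h : m ≠ n) (c : ℤ → ℂ) :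
    trigPoly {m, n} c = mode m (c m) + mode n (c n) := Finset.sum_pair h

theorem mode_mem_span_freq {k : ℕ} {m : ℤ} (hm : m ∈ freq k) (c : ℂ) :
    mode m c ∈ Submodule.span ℝ (modes k) := by
  suffices h : mode m 1 ∈ Submodule.span ℝ (modes k) ∧
      mode m Complex.I ∈ Submodule.span ℝ (modes k) by
    have e : mode m c = c.re • mode m 1 + c.im • mode m Complex.I := by
      rw [← mode_smul, ← mode_smul, ← mode_add]
      congr 1
      simp [Complex.re_add_im]
    rw [e]
    exact add_mem (Submodule.smul_mem _ _ h.1) (Submodule.smul_mem _ _ h.2)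
  have hsub := Submodule.subset_span (R := ℝ) (s := modes k)
  rcases Nat.lt_or_ge k 2 with hk | hk
  · interval_cases k
    · rw [modes_zero, er_eq, et_eq, ex_eq, ey_eq] at hsub ⊢
      rw [freq_zero, Finset.mem_insert, Finset.mem_singleton] at hm
      rcases hm with rfl | rfl
      · exact ⟨hsub (by simp), hsub (by simp)⟩
      · exact ⟨hsub (by simp), hsub (by simp)⟩
    · rw [modes_one] at hsub ⊢
      rw [freq_one, Finset.mem_singleton] at hm
      subst hm
      exact ⟨hsub (by simp), hsub (by simp)⟩
  · rw [modes_of_two_le hk] at hsub ⊢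
    rw [freq_of_two_le hk, Finset.mem_insert, Finset.mem_singleton] at hm
    have m1 := hsub (Set.mem_insert _ _)
    have m2 := hsub (Set.mem_insert_of_mem _ (Set.mem_insert _ _))
    have m3 := hsub (Set.mem_insert_of_mem _ (Set.mem_insert_of_mem _ (Set.mem_insert _ _)))
    have m4 := hsub (Set.mem_insert_of_mem _ (Set.mem_insert_of_mem _
      (Set.mem_insert_of_mem _ (Set.mem_singleton _))))
    have e0 : ∀ a b : ℂ, modePair k a 0 = mode (1 + k) a ∧ modePair k 0 b = mode (1 - k) b := by
      intro a b
      constructor <;> funext θ <;> simp [modePair, mode]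
    have eadd : ∀ a b c d : ℂ,
        modePair k a b + modePair k c d = modePair k (a + c) (b + d) := fun a b c d => by
      simp only [modePair, mode_add]; abel
    have esub : ∀ a b c d : ℂ,
        modePair k a b - modePair k c d = modePair k (a - c) (b - d) := fun a b c d => by
      rw [sub_eq_iff_eq_add, eadd, sub_add_cancel, sub_add_cancel]
    -- The identities behind the four cases: e^{i(1+k)θ} = cos(kθ)e_r + sin(kθ)e_t and ie^{i(1+k)θ}
    -- = cos(kθ)e_t - sin(kθ)e_r, and the same with the sign of the sine reversed for the frequency
    -- 1 - k.
    rcases hm with rfl | rfl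
    · refine ⟨?_, ?_⟩
      · convert add_mem m1 m4 using 1
        rw [eadd, ← (e0 1 0).1]; congr 1 <;> ring
      · convert sub_mem m3 m2 using 1
        rw [esub, ← (e0 Complex.I 0).1]; congr 1 <;> ring
    · refine ⟨?_, ?_⟩
      · convert sub_mem m1 m4 using 1
        rw [esub, ← (e0 0 1).2]; congr 1 <;> ring
      · convert add_mem m3 m2 using 1
        rw [eadd, ← (e0 0 Complex.I).2]; congr 1 <;> ring

theorem exists_trigPoly_of_mem_modes {k : ℕ} {u : ℝ → Plane} (hu : u ∈ modes k) :
    ∃ c, u = trigPoly (freq k) c := by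
  have hsingle : ∀ {m n : ℤ} (_ : m ≠ n) (a b : ℂ),
      mode m a + mode n b = trigPoly {m, n} fun j => if j = m then a else b := by
    intro m n h a b
    rw [trigPoly_pair h, if_pos rfl, if_neg h.symm]
  have hz : ∀ m, mode m 0 = 0 := fun m => by funext θ; simp [mode]
  rcases Nat.lt_or_ge k 2 with hk | hk
  · interval_cases k
    · rw [modes_zero, er_eq, et_eq, ex_eq, ey_eq] at hu
      have h1 : ∀ c, ∃ d, mode 1 c = trigPoly (freq 0) d := fun c =>
        ⟨_, by rw [freq_zero, ← hsingle zero_ne_one 0 c, hz, zero_add]⟩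
      have h0 : ∀ c, ∃ d, mode 0 c = trigPoly (freq 0) d := fun c =>
        ⟨_, by rw [freq_zero, ← hsingle zero_ne_one c 0, hz, add_zero]⟩
      rcases hu with rfl | rfl | rfl | rfl
      exacts [h1 _, h1 _, h0 _, h0 _]
    · rw [modes_one] at hu
      have h1 : ∀ c, ∃ d, mode 2 c = trigPoly (freq 1) d := fun c =>
        ⟨fun _ => c, by rw [freq_one, trigPoly, Finset.sum_singleton]⟩
      rcases hu with rfl | rfl
      exacts [h1 _, h1 _]
  · rw [modes_of_two_le hk] at hu
    have h1 : ∀ a b, ∃ d, modePair k a b = trigPoly (freq k) d := fun a b =>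
      ⟨_, by rw [freq_of_two_le hk, modePair, hsingle (by omega) a b]⟩
    rcases hu with rfl | rfl | rfl | rfl <;> exact h1 _ _

theorem mem_span_modes_iff {k : ℕ} {Y : ℝ → Plane} :
    Y ∈ Submodule.span ℝ (modes k) ↔ ∃ c, Y = trigPoly (freq k) c := by
  constructor
  · intro h
    induction h using Submodule.span_induction with
    | mem u hu => exact exists_trigPoly_of_mem_modes hu
    | zero =>
      refine ⟨0, ?_⟩
      funext θ
      simp [trigPoly, mode]
    | add u v _ _ hu hv =>
      obtain ⟨c, rfl⟩ := hu
      obtain ⟨d, rfl⟩ := hv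
      exact ⟨c + d, by simp only [trigPoly, Pi.add_apply, mode_add, Finset.sum_add_distrib]⟩
    | smul a u _ hu =>
      obtain ⟨c, rfl⟩ := hu
      exact ⟨a • c, by simp only [trigPoly, Pi.smul_apply, mode_smul, Finset.smul_sum]⟩
  · rintro ⟨c, rfl⟩
    exact sum_mem fun m hm => mode_mem_span_freq hm (c m)

theorem coeffC_trigPoly (s : Finset ℤ) (c : ℤ → ℂ) (m : ℤ) :
    coeffC (fun θ => toC (trigPoly s c θ)) m = if m ∈ s then c m else 0 := by
  simp_rw [toC_trigPoly]
  induction s using Finset.induction_on with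
  | empty => simp [coeffC]
  | insert n s hn ih =>
    have h1 : Continuous fun θ => c n * chr n θ := continuous_const.mul (continuous_chr n)
    have h2 : Continuous fun θ => ∑ m ∈ s, c m * chr m θ :=
      continuous_finsetSum _ fun m _ => continuous_const.mul (continuous_chr m)
    simp_rw [Finset.sum_insert hn]
    rw [coeffC_add (h1.intervalIntegrable _ _) (h2.intervalIntegrable _ _), ih, coeffC_chr]
    by_cases h : n = m
    · subst h; simp [hn]
    · simp [h, Ne.symm h]

/-- Linearizations are unique, so the eigenvalue equation holds pointwise for `circleOp Y`. It
forces the coefficients outside `freq k` to vanish, and a continuous periodic function is determined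
by its coefficients. -/
theorem eigenspace_classical {A B C₁ C₂ γ : ℝ} (hAB : 0 < A ^ 2 + B ^ 2) (hγ0 : 0 < γ)
    (hγ : γ < 1) (k : ℕ) (Y : ℝ → Plane) :
    (MemHolder (1 + γ) Y ∧ HasLinearization (circle A B C₁ C₂) Y
      (fun θ => (-(k : ℝ) / 4) • Y θ)) ↔ Y ∈ Submodule.span ℝ (modes k) := by
  rw [mem_span_modes_iff]
  constructor
  · rintro ⟨hY, hL⟩
    obtain ⟨M, hM⟩ := hY.exists_holderOne hγ0 hγ
    have h1 := (hasLinearization_circle hM hγ0 hγ.le C₁ C₂ hAB).unique hL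
    have hc : ∀ m, m ∉ freq k → coeffC (fun θ => toC (Y θ)) m = 0 := by
      intro m hm
      have h2 := coeffC_circleOp hM hγ0 hγ.le m
      rw [h1] at h2
      simp only [map_smul, Complex.real_smul] at h2
      rw [coeffC_const_mul] at h2
      rw [← lam_eq_iff] at hm
      have h3 : ((lam m : ℂ) - k / 4) * coeffC (fun θ => toC (Y θ)) m = 0 := by
        push_cast at h2
        linear_combination h2
      refine (mul_eq_zero.1 h3).resolve_left fun h4 => hm ?_
      rw [sub_eq_zero] at h4
      exact Complex.ofReal_injective (by push_cast; exact h4)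
    refine ⟨coeffC (fun θ => toC (Y θ)), ?_⟩
    have h5 : (fun θ => toC (Y θ)) =
        fun θ => toC (trigPoly (freq k) (coeffC (fun θ => toC (Y θ))) θ) := by
      refine eq_of_coeffC_eq hM.continuous_toC
        (toC.continuous.comp (contDiff_trigPoly _ _ (n := 0)).continuous) hM.toC_periodic
        (fun θ => by simp only [trigPoly_periodic _ _ θ]) fun m => ?_
      rw [coeffC_trigPoly]
      split_ifs with h
      · rfl
      · exact hc m h
    exact funext fun θ => toC.injective (congrFun h5 θ)
  · rintro ⟨c, rfl⟩
    have hM := memHolder_of_contDiff (α := 1 + γ) (trigPoly_periodic (freq k) c)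
      (contDiff_trigPoly (freq k) c)
    refine ⟨hM, ?_⟩
    obtain ⟨M, hM⟩ := hM.exists_holderOne hγ0 hγ
    have h1 := hasLinearization_circle hM hγ0 hγ.le C₁ C₂ hAB
    have h2 : (fun θ => (-(k : ℝ) / 4) • trigPoly (freq k) c θ) = circleOp (trigPoly (freq k) c) := by
      rw [circleOp_trigPoly]
      funext θ
      apply toC.injective
      rw [map_smul, toC_trigPoly, toC_trigPoly, Finset.smul_sum]
      refine Finset.sum_congr rfl fun m hm => ?_
      rw [lam_eq_iff.2 hm, Complex.real_smul]
      push_cast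
      ring
    rw [h2]
    exact h1

/-! ### The closed operator on `L²` -/

theorem toL2_trigPoly (s : Finset ℤ) (c : ℤ → ℂ) :
    toL2 (trigPoly s c) = ∑ m ∈ s, toL2 (mode m (c m)) := by
  induction s using Finset.induction_on with
  | empty =>
    have : trigPoly ∅ c = mode 0 0 := by
      funext θ; simp [trigPoly, mode]
    rw [this, Finset.sum_empty]
    refine coef_ext fun m => ?_
    rw [coef_toL2_mode, coef_zero, ite_self]
  | insert m s hm ih =>
    have e : trigPoly (insert m s) c = mode m (c m) + trigPoly s c := Finset.sum_insert hm
    rw [e, toL2_add (memLp_mode _ _) (Continuous.memLp_circle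
      (contDiff_trigPoly s c (n := 0)).continuous 2), ih, Finset.sum_insert hm]

theorem memLp_trigPoly (s : Finset ℤ) (c : ℤ → ℂ) : MemLp (trigPoly s c) 2 circleMeasure :=
  Continuous.memLp_circle (contDiff_trigPoly s c (n := 0)).continuous 2

theorem coef_toL2_trigPoly (s : Finset ℤ) (c : ℤ → ℂ) (m : ℤ) :
    coef (toL2 (trigPoly s c)) m = if m ∈ s then c m else 0 := by
  rw [coef_toL2 (memLp_trigPoly s c), coeffC_trigPoly]

theorem er_eq_circle : er = circle 1 0 0 0 := by
  funext θ; simp [circle]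

theorem isClosed_setOf_coef_eq :
    IsClosed {p : L2 × L2 | ∀ m, coef p.2 m = -(lam m : ℂ) * coef p.1 m} := by
  rw [Set.ofPred_forall]
  exact isClosed_iInter fun m => isClosed_eq ((continuous_coef m).comp continuous_snd)
    (continuous_const.mul ((continuous_coef m).comp continuous_fst))

theorem coef_eq_of_hasLinearization {γ : ℝ} {Y W : ℝ → Plane} {f g : L2} (hγ0 : 0 < γ) (hγ : γ < 1)
    (hY : MemHolder (1 + γ) Y) (hL : HasLinearization er Y W) (hf : f =ᵐ[circleMeasure] Y)
    (hg : g =ᵐ[circleMeasure] W) (m : ℤ) : coef g m = -(lam m : ℂ) * coef f m := by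
  have hAB : (0 : ℝ) < 1 ^ 2 + 0 ^ 2 := by norm_num
  obtain ⟨M, hM⟩ := hY.exists_holderOne hγ0 hγ
  rw [er_eq_circle] at hL
  have h1 := (hasLinearization_circle hM hγ0 hγ.le 0 0 hAB).unique hL
  subst h1
  have e1 : coef f m = coeffC (fun θ => toC (Y θ)) m := coeffC_congr (by
    filter_upwards [hf] with θ hθ
    exact congrArg toC hθ) m
  have e2 : coef g m = coeffC (fun θ => toC (circleOp Y θ)) m := coeffC_congr (by
    filter_upwards [hg] with θ hθ
    exact congrArg toC hθ) m
  rw [e1, e2]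
  exact coeffC_circleOp hM hγ0 hγ.le m

theorem trigPoly_mem_graph (s : Finset ℤ) {c d : ℤ → ℂ} (h : ∀ m, d m = -(lam m : ℂ) * c m) :
    ∃ (γ : ℝ) (Y W : ℝ → Plane), 0 < γ ∧ γ < 1 ∧ MemHolder (1 + γ) Y ∧
      HasLinearization er Y W ∧ toL2 (trigPoly s c) =ᵐ[circleMeasure] Y ∧
      toL2 (trigPoly s d) =ᵐ[circleMeasure] W := by
  have hAB : (0 : ℝ) < 1 ^ 2 + 0 ^ 2 := by norm_num
  refine ⟨1 / 2, trigPoly s c, trigPoly s d, by norm_num, by norm_num,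
    memHolder_of_contDiff (trigPoly_periodic _ _) (contDiff_trigPoly _ _), ?_,
    coeFn_toL2 (memLp_trigPoly _ _), coeFn_toL2 (memLp_trigPoly _ _)⟩
  obtain ⟨M, hM⟩ := exists_holderOne_trigPoly (γ := 1 / 2) (by norm_num) (by norm_num) s c
  have h2 := hasLinearization_circle hM (by norm_num) (by norm_num) 0 0 hAB
  rw [circleOp_trigPoly] at h2
  rw [er_eq_circle, trigPoly_congr (d := fun m => -(lam m : ℂ) * c m) fun m _ => h m]
  exact h2

theorem graphL_subset :
    graphL ⊆ {p : L2 × L2 | ∀ m, coef p.2 m = -(lam m : ℂ) * coef p.1 m} := by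
  refine closure_minimal (fun p hp => ?_) isClosed_setOf_coef_eq
  obtain ⟨γ, Y, W, hγ0, hγ, hY, hL, hf, hg⟩ := hp
  exact coef_eq_of_hasLinearization hγ0 hγ hY hL hf hg

/-- The closure is the maximal multiplier operator. One inclusion holds because each coefficient is
continuous on `L2`; for the other, the truncated Fourier series of `f` and `g` form pairs in the
original graph and converge to `(f, g)`. -/
theorem mem_graphL_iff {f g : L2} :
    (f, g) ∈ graphL ↔ ∀ m, coef g m = -(lam m : ℂ) * coef f m := by
  constructor
  · intro h m
    exact Set.mem_ofPred.1 (graphL_subset h) m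
  · intro h
    have h1 : Tendsto (fun s : Finset ℤ => (toL2 (trigPoly s (coef f)), toL2 (trigPoly s (coef g))))
        atTop (𝓝 (f, g)) := by
      simp only [toL2_trigPoly]
      exact Filter.Tendsto.prodMk_nhds (hasSum_mode f) (hasSum_mode g)
    refine isClosed_closure.mem_of_tendsto h1 (Eventually.of_forall fun s => subset_closure ?_)
    exact trigPoly_mem_graph s h

/-! ### Eigenspaces in `L²` -/

theorem toL2_mem_span {k : ℕ} {Y : ℝ → Plane} (hY : Y ∈ Submodule.span ℝ (modes k)) :
    toL2 Y ∈ Submodule.span ℝ (toL2 '' modes k) := by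
  have hm : ∀ {u}, u ∈ Submodule.span ℝ (modes k) → MemLp u 2 circleMeasure := fun hu => by
    obtain ⟨c, rfl⟩ := mem_span_modes_iff.1 hu
    exact memLp_trigPoly _ _
  induction hY using Submodule.span_induction with
  | mem u hu => exact Submodule.subset_span ⟨u, hu, rfl⟩
  | zero =>
    have : toL2 (0 : ℝ → Plane) = 0 := by
      have := toL2_smul (memLp_mode 0 0) 0
      rwa [zero_smul, zero_smul] at this
    rw [this]
    exact zero_mem _
  | add u v hu hv iu iv =>
    rw [toL2_add (hm hu) (hm hv)]
    exact add_mem iu iv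
  | smul a u hu iu =>
    rw [toL2_smul (hm hu)]
    exact Submodule.smul_mem _ _ iu

theorem mem_span_toL2_iff {k : ℕ} {f : L2} :
    f ∈ Submodule.span ℝ (toL2 '' modes k) ↔ ∀ m, m ∉ freq k → coef f m = 0 := by
  constructor
  · intro h m hm
    induction h using Submodule.span_induction with
    | mem f hf =>
      obtain ⟨u, hu, rfl⟩ := hf
      obtain ⟨c, rfl⟩ := exists_trigPoly_of_mem_modes hu
      rw [coef_toL2_trigPoly, if_neg hm]
    | zero => exact coef_zero m
    | add f g _ _ hf hg => rw [coef_add, hf, hg, add_zero]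
    | smul a f _ hf => rw [coef_smul, hf, smul_zero]
  · intro h
    have e : f = toL2 (trigPoly (freq k) (coef f)) := coef_ext fun m => by
      rw [coef_toL2_trigPoly]
      split_ifs with hm
      · rfl
      · exact h m hm
    rw [e]
    exact toL2_mem_span (mem_span_modes_iff.2 ⟨_, rfl⟩)

theorem eigenspace_L2 (k : ℕ) (f : L2) : (f, (-(k : ℝ) / 4) • f) ∈ graphL ↔
    f ∈ Submodule.span ℝ (toL2 '' modes k) := by
  rw [mem_graphL_iff, mem_span_toL2_iff]
  refine forall_congr' fun m => ?_
  rw [coef_smul, ← lam_eq_iff, Complex.real_smul]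
  constructor
  · intro h hm
    have h3 : ((lam m : ℂ) - k / 4) * coef f m = 0 := by
      push_cast at h
      linear_combination h
    refine (mul_eq_zero.1 h3).resolve_left fun h4 => hm ?_
    rw [sub_eq_zero] at h4
    exact Complex.ofReal_injective (by push_cast; exact h4)
  · intro h
    by_cases hm : lam m = k / 4
    · rw [hm]; push_cast; ring
    · rw [h hm, mul_zero, mul_zero]

theorem finrank_eigenspace (k : ℕ) :
    Module.finrank ℝ (Submodule.span ℝ (toL2 '' modes k)) = if k = 1 then 2 else 4 := by
  -- Taking coefficients at the frequencies of level `k` identifies the eigenspace with that many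
  -- copies of `ℂ`, each of real dimension 2.
  let F : Submodule.span ℝ (toL2 '' modes k) →ₗ[ℝ] (freq k → ℂ) :=
    { toFun := fun f m => coef f.1 m
      map_add' := fun f g => funext fun m => coef_add _ _ _
      map_smul' := fun a f => funext fun m => coef_smul _ _ _ }
  have hF : Function.Bijective F := by
    constructor
    · intro f g hfg
      refine Subtype.ext (coef_ext fun m => ?_)
      by_cases hm : m ∈ freq k
      · exact congrFun hfg ⟨m, hm⟩
      · rw [mem_span_toL2_iff.1 f.2 m hm, mem_span_toL2_iff.1 g.2 m hm]
    · intro c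
      refine ⟨⟨toL2 (trigPoly (freq k) fun m => if h : m ∈ freq k then c ⟨m, h⟩ else 0),
        toL2_mem_span (mem_span_modes_iff.2 ⟨_, rfl⟩)⟩, ?_⟩
      funext m
      show coef (toL2 _) m = c m
      rw [coef_toL2_trigPoly, if_pos m.2, dif_pos m.2]
  rw [(LinearEquiv.ofBijective F hF).finrank_eq, Module.finrank_pi_fintype]
  simp only [Complex.finrank_real_complex, Finset.sum_const, smul_eq_mul, Finset.card_univ,
    Fintype.card_coe, card_freq]
  split_ifs <;> rfl

/-! ### Orthogonality and completeness -/

theorem inner_toL2_trigPoly (s t : Finset ℤ) (c d : ℤ → ℂ) :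
    inner ℝ (toL2 (trigPoly s c)) (toL2 (trigPoly t d)) =
      2 * Real.pi * ∑ m ∈ s ∩ t, inner ℝ (c m) (d m) := by
  rw [inner_eq_tsum_coef]
  congr 1
  rw [tsum_eq_sum (s := s ∩ t)]
  · refine Finset.sum_congr rfl fun m hm => ?_
    rw [Finset.mem_inter] at hm
    rw [coef_toL2_trigPoly, coef_toL2_trigPoly, if_pos hm.1, if_pos hm.2]
  · intro m hm
    rw [coef_toL2_trigPoly, coef_toL2_trigPoly]
    rw [Finset.mem_inter, not_and_or] at hm
    rcases hm with hm | hm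
    · rw [if_neg hm, inner_zero_left]
    · rw [if_neg hm, inner_zero_right]

theorem inner_toL2_mode_mode (m n : ℤ) (a b : ℂ) :
    inner ℝ (toL2 (mode m a)) (toL2 (mode n b)) = if m = n then 2 * Real.pi * inner ℝ a b else 0 := by
  rw [inner_toL2_mode, coeffC_toL2_mode]
  by_cases h : m = n
  · simp [h]
  · simp [h, Ne.symm h]

theorem inner_toL2_modePair {k : ℕ} (hk : 2 ≤ k) (a b c d : ℂ) :
    inner ℝ (toL2 (modePair k a b)) (toL2 (modePair k c d)) =
      2 * Real.pi * (inner ℝ a c + inner ℝ b d) := by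
  rw [modePair, modePair, toL2_add (memLp_mode _ _) (memLp_mode _ _),
    toL2_add (memLp_mode _ _) (memLp_mode _ _), inner_add_left, inner_add_right, inner_add_right,
    inner_toL2_mode_mode, inner_toL2_mode_mode, inner_toL2_mode_mode, inner_toL2_mode_mode,
    if_pos rfl, if_pos rfl, if_neg (by omega), if_neg (by omega)]
  ring

theorem disjoint_freq {k j : ℕ} (h : k ≠ j) : freq k ∩ freq j = ∅ := by
  rw [← Finset.disjoint_iff_inter_eq_empty, Finset.disjoint_left]
  intro m hk hj
  rw [mem_freq_iff] at hk hj
  exact h (by exact_mod_cast hk.symm.trans hj)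

theorem inner_modes_eq_zero {u v : ℝ → Plane} (hu : u ∈ ⋃ k, modes k) (hv : v ∈ ⋃ k, modes k)
    (huv : u ≠ v) : inner ℝ (toL2 u) (toL2 v) = 0 := by
  obtain ⟨k, hk⟩ := Set.mem_iUnion.1 hu
  obtain ⟨j, hj⟩ := Set.mem_iUnion.1 hv
  rcases eq_or_ne k j with rfl | hkj
  · rcases Nat.lt_or_ge k 2 with h2 | h2
    · interval_cases k
      · rw [modes_zero, er_eq, et_eq, ex_eq, ey_eq] at hk hj
        rcases hk with rfl | rfl | rfl | rfl <;> rcases hj with rfl | rfl | rfl | rfl <;>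
          first
          | exact absurd rfl huv
          | (rw [inner_toL2_mode_mode]; simp [Complex.inner])
      · rw [modes_one] at hk hj
        rcases hk with rfl | rfl <;> rcases hj with rfl | rfl <;>
          first
          | exact absurd rfl huv
          | (rw [inner_toL2_mode_mode]; simp [Complex.inner])
    · rw [modes_of_two_le h2] at hk hj
      rcases hk with rfl | rfl | rfl | rfl <;> rcases hj with rfl | rfl | rfl | rfl <;>
        first
        | exact absurd rfl huv
        | (rw [inner_toL2_modePair h2]; simp [Complex.inner, Complex.div_re, Complex.div_im]; try norm_num)
  · obtain ⟨c, rfl⟩ := exists_trigPoly_of_mem_modes hk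
    obtain ⟨d, rfl⟩ := exists_trigPoly_of_mem_modes hj
    rw [inner_toL2_trigPoly, disjoint_freq hkj, Finset.sum_empty, mul_zero]

theorem span_modes_topologicalClosure :
    (Submodule.span ℝ (toL2 '' ⋃ k, modes k)).topologicalClosure = ⊤ := by
  rw [Submodule.eq_top_iff']
  intro f
  refine mem_closure_of_tendsto (hasSum_mode f) (Eventually.of_forall fun s => ?_)
  refine sum_mem fun m _ => ?_
  obtain ⟨k, hk⟩ := exists_mem_freq m
  exact Submodule.span_mono (Set.image_mono (Set.subset_iUnion modes k))
    (toL2_mem_span (mode_mem_span_freq hk _))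

/-! ### The spectrum -/

/-- Since |z + k/4| tends to infinity with `k`, its infimum is attained, and it is positive because
`z` is none of the values -k/4. -/
theorem exists_dist_spectrum {z : ℂ} (hz : ¬ ∃ k : ℕ, z = -(k : ℂ) / 4) :
    ∃ d : ℝ, 0 < d ∧ ∀ m, d ≤ ‖z + lam m‖ := by
  have ht : Tendsto (fun k : ℕ => ‖z + (k : ℂ) / 4‖) cofinite atTop := by
    rw [Nat.cofinite_eq_atTop]
    have h1 : Tendsto (fun k : ℕ => (k : ℝ) / 4 + -‖z‖) atTop atTop :=
      tendsto_atTop_add_const_right _ _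
        (tendsto_natCast_atTop_atTop.atTop_div_const (by norm_num))
    refine tendsto_atTop_mono (fun k => ?_) h1
    have h2 := norm_sub_le (z + (k : ℂ) / 4) z
    rw [add_sub_cancel_left, norm_div, Complex.norm_natCast, Complex.norm_ofNat] at h2
    linarith
  obtain ⟨k0, hk0⟩ := ht.exists_forall_le
  refine ⟨‖z + (k0 : ℂ) / 4‖, norm_pos_iff.2 fun h => hz ⟨k0, ?_⟩, fun m => ?_⟩
  · linear_combination h
  · obtain ⟨k, hk⟩ := exists_mem_freq m
    rw [lam_eq_iff.2 hk]
    push_cast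
    exact hk0 k

/-- The inverse is the multiplier 1/(x + iy) = (x - iy)/(x² + y²) with x = Re z + λ_m and y = Im z.
On pairs standing for f + ig its real and imaginary parts give (Pf + Qg, Pg - Qf), and both
multipliers are bounded by the reciprocal of the distance to the spectrum. -/
theorem inResolventSet_of_ne {z : ℂ} (hz : ¬ ∃ k : ℕ, z = -(k : ℂ) / 4) :
    InResolventSet graphL z := by
  obtain ⟨d, hd, hle⟩ := exists_dist_spectrum hz
  have hle' : ∀ m, d ^ 2 ≤ (z.re + lam m) ^ 2 + z.im ^ 2 := fun m => by
    have h := pow_le_pow_left₀ hd.le (hle m) 2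
    rw [← Complex.normSq_eq_norm_sq, Complex.normSq_apply] at h
    simp only [Complex.add_re, Complex.add_im, Complex.ofReal_re, Complex.ofReal_im, add_zero] at h
    nlinarith
  have hpos : ∀ m, 0 < (z.re + lam m) ^ 2 + z.im ^ 2 := fun m => (pow_pos hd 2).trans_le (hle' m)
  have hbound : ∀ m x, x ^ 2 ≤ (z.re + lam m) ^ 2 + z.im ^ 2 →
      |x / ((z.re + lam m) ^ 2 + z.im ^ 2)| ≤ 1 / d := fun m x hx => by
    rw [abs_div, abs_of_pos (hpos m), div_le_div_iff₀ (hpos m) hd, one_mul]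
    have h1 := hle' m
    refine le_trans (le_abs_self _) (abs_le_of_sq_le_sq ?_ (hpos m).le)
    rw [mul_pow, sq_abs, sq ((z.re + lam m) ^ 2 + z.im ^ 2)]
    exact mul_le_mul hx h1 (by positivity) (hpos m).le
  obtain ⟨P, hP⟩ := exists_multiplier (a := fun m => (z.re + lam m) /
    ((z.re + lam m) ^ 2 + z.im ^ 2)) fun m => hbound m _ (le_add_of_nonneg_right (sq_nonneg _))
  obtain ⟨Q, hQ⟩ := exists_multiplier (a := fun m => z.im /
    ((z.re + lam m) ^ 2 + z.im ^ 2)) fun m => hbound m _ (le_add_of_nonneg_left (sq_nonneg _))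
  refine ⟨(P.comp (ContinuousLinearMap.fst ℝ L2 L2) + Q.comp (ContinuousLinearMap.snd ℝ L2 L2)).prod
    (P.comp (ContinuousLinearMap.snd ℝ L2 L2) - Q.comp (ContinuousLinearMap.fst ℝ L2 L2)),
    fun u v f g => ?_⟩
  have hne : ∀ m, ((z.re + lam m) ^ 2 + z.im ^ 2 : ℂ) ≠ 0 := fun m => by
    exact_mod_cast (hpos m).ne'
  simp only [ContinuousLinearMap.prod_apply, _root_.add_apply,
    _root_.sub_apply, ContinuousLinearMap.comp_apply, ContinuousLinearMap.coe_fst',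
    ContinuousLinearMap.coe_snd', Prod.mk.injEq]
  constructor
  · rintro ⟨u', v', hu, hv, rfl, rfl⟩
    rw [mem_graphL_iff] at hu hv
    constructor <;> refine coef_ext fun m => ?_
    · have h := hne m
      simp only [coef_add, coef_sub, hP, hQ, coef_smul, hu, hv, Complex.real_smul]
      push_cast
      field_simp
      ring
    · have h := hne m
      simp only [coef_add, coef_sub, hP, hQ, coef_smul, hu, hv, Complex.real_smul]
      push_cast
      field_simp
      ring
  · rintro ⟨rfl, rfl⟩
    refine ⟨_, _, ?_, ?_, sub_sub_cancel _ f, sub_sub_cancel _ g⟩ <;> rw [mem_graphL_iff] <;>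
      intro m
    · have h := hne m
      simp only [coef_add, coef_sub, hP, hQ, coef_smul, Complex.real_smul]
      push_cast
      field_simp
      ring
    · have h := hne m
      simp only [coef_add, coef_sub, hP, hQ, coef_smul, Complex.real_smul]
      push_cast
      field_simp
      ring

theorem freq_nonempty (k : ℕ) : (freq k).Nonempty := by
  rw [← Finset.card_pos, card_freq]
  split_ifs <;> norm_num

theorem not_inResolventSet (k : ℕ) : ¬ InResolventSet graphL (-(k : ℂ) / 4) := by
  rintro ⟨S, hS⟩
  obtain ⟨m, hm⟩ := freq_nonempty k
  set f := toL2 (mode m 1) with hf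
  have hne : f ≠ 0 := fun h => by
    have h1 := coef_toL2_mode m m 1
    rw [← hf, h, coef_zero, if_pos rfl] at h1
    exact zero_ne_one h1
  have hre : (-(k : ℂ) / 4).re = -(k : ℝ) / 4 := by
    have : (-(k : ℂ) / 4) = ((-(k : ℝ) / 4 : ℝ) : ℂ) := by push_cast; ring
    rw [this, Complex.ofReal_re]
  have him : (-(k : ℂ) / 4).im = 0 := by
    have : (-(k : ℂ) / 4) = ((-(k : ℝ) / 4 : ℝ) : ℂ) := by push_cast; ring
    rw [this, Complex.ofReal_im]
  have h1 : (f, (-(k : ℝ) / 4) • f) ∈ graphL :=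
    (eigenspace_L2 k f).2 (toL2_mem_span (mode_mem_span_freq hm 1))
  have h2 : ((0 : L2), (0 : L2)) ∈ graphL := mem_graphL_iff.2 fun m => by
    rw [coef_zero, mul_zero]
  -- The pair (f, 0) is a non-zero vector in the kernel of z - 𝓛, which a left inverse excludes.
  have h3 := (hS f 0 0 0).1 ⟨_, 0, h1, h2, by rw [hre]; simp, by rw [him]; simp⟩
  have h4 : S (0, 0) = 0 := map_zero S
  rw [h4] at h3
  exact hne (congrArg Prod.fst h3).symm

theorem spectrum_graphL (z : ℂ) : ¬ InResolventSet graphL z ↔ ∃ k : ℕ, z = -(k : ℂ) / 4 := by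
  constructor
  · intro h
    by_contra hz
    exact h (inResolventSet_of_ne hz)
  · rintro ⟨k, rfl⟩
    exact not_inResolventSet k

/-! ### Uniqueness of semigroups on eigenvectors of the generator -/

section Semigroup

variable {H : Type*} [NormedAddCommGroup H] [NormedSpace ℝ H]
  {G : Set (H × H)} {T : ℝ≥0 → H →L[ℝ] H}

/-- Otherwise there are times tending to 0 at which the norms are unbounded. Strong continuity at 0
makes these operators pointwise bounded, against the uniform boundedness principle. -/
theorem IsSemigroupOf.exists_norm_le [CompleteSpace H] (hT : IsSemigroupOf G T) :
    ∃ δ : ℝ≥0, 0 < δ ∧ ∃ M : ℝ, 0 ≤ M ∧ ∀ t ≤ δ, ‖T t‖ ≤ M := by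
  by_contra! hcon
  have hn : ∀ n : ℕ, ∃ t : ℝ≥0, t ≤ 1 / ((n : ℝ≥0) + 1) ∧ (n : ℝ) < ‖T t‖ := fun n =>
    hcon _ (by positivity) n (Nat.cast_nonneg n)
  choose t ht htn using hn
  have h0 : Tendsto t atTop (𝓝 0) :=
    tendsto_of_tendsto_of_tendsto_of_le_of_le tendsto_const_nhds
      (tendsto_one_div_add_atTop_nhds_zero_nat (𝕜 := ℝ≥0)) (fun _ => zero_le) ht
  obtain ⟨C, hC⟩ := banach_steinhaus (g := fun n => T (t n)) fun f => by
    obtain ⟨C, hC⟩ := ((hT.continuous f).comp h0).norm.bddAbove_range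
    exact ⟨C, fun n => hC ⟨n, rfl⟩⟩
  obtain ⟨n, hn⟩ := exists_nat_gt C
  exact absurd (hC n) (not_le.2 (hn.trans (htn n)))

/-- Telescoping: the error after `n` steps is a sum of `n` one-step errors, each transported by the
semigroup, with norm at most `M`, and by powers of `S ≤ 1`. -/
theorem IsSemigroupOf.norm_iterate_sub_le (hT : IsSemigroupOf G T) {h : ℝ≥0} {M S : ℝ} {e : H}
    (hS0 : 0 ≤ S) (hS : S ≤ 1) (n : ℕ) (hM : ∀ j < n, ‖T (j * h)‖ ≤ M) :
    ‖T (n * h) e - S ^ n • e‖ ≤ n * (M * ‖T h e - S • e‖) := by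
  induction n with
  | zero => simp [hT.zero]
  | succ n ih =>
    have h1 : T ((n + 1 : ℕ) * h) e - S ^ (n + 1) • e =
        T (n * h) (T h e - S • e) + S • (T (n * h) e - S ^ n • e) := by
      rw [Nat.cast_succ, add_mul, one_mul, hT.add]
      simp only [ContinuousLinearMap.comp_apply, map_sub, map_smul, smul_sub, smul_smul, pow_succ']
      abel
    rw [h1]
    have h2 := ih fun j hj => hM j (hj.trans n.lt_succ_self)
    have h3 := (T (n * h)).le_of_opNorm_le (hM n n.lt_succ_self) (T h e - S • e)
    have h4 : ‖S • (T (n * h) e - S ^ n • e)‖ ≤ ‖T (n * h) e - S ^ n • e‖ := by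
      rw [norm_smul, Real.norm_of_nonneg hS0]
      exact mul_le_of_le_one_left (norm_nonneg _) hS
    refine (norm_add_le _ _).trans ?_
    push_cast
    linarith

/-- The generator is known only through the limit at time 0, so [0, t] is cut into n + 1 equal
steps. The semigroup and the exponential have the same derivative at 0, so the one-step error is
o(1/n) and the telescoped sum tends to 0. -/
theorem IsSemigroupOf.apply_eigenvector_of_le (hT : IsSemigroupOf G T) {l : ℝ} (hl : 0 ≤ l) {e : H}
    (he : (e, -l • e) ∈ G) {t δ : ℝ≥0} {M : ℝ} (hM : ∀ t ≤ δ, ‖T t‖ ≤ M) (ht : t ≤ δ) :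
    T t e = Real.exp (-l * t) • e := by
  rcases eq_or_ne t 0 with rfl | ht0
  · simp [hT.zero]
  have htp : (0 : ℝ) < t := by exact_mod_cast pos_iff_ne_zero.2 ht0
  have hs : Tendsto (fun n : ℕ => t / ((n : ℝ≥0) + 1)) atTop (𝓝[≠] 0) := by
    refine tendsto_nhdsWithin_iff.2 ⟨?_, Eventually.of_forall fun n => ?_⟩
    · have := (tendsto_one_div_add_atTop_nhds_zero_nat (𝕜 := ℝ≥0)).const_mul t
      rw [mul_zero] at this
      exact this.congr fun n => by rw [mul_one_div]
    · exact div_ne_zero ht0 (by positivity)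
  have hexp : Tendsto (fun h : ℝ≥0 => (h : ℝ)⁻¹ • (Real.exp (-l * h) • e - e)) (𝓝[≠] 0)
      (𝓝 (-l • e)) := by
    have h1 : HasDerivAt (fun x : ℝ => Real.exp (-l * x) • e) (-l • e) 0 := by
      have := (((hasDerivAt_id (0 : ℝ)).const_mul (-l)).exp).smul_const e
      simpa using this
    have h2 := h1.tendsto_slope_zero
    simp only [zero_add, mul_zero, Real.exp_zero, one_smul] at h2
    refine h2.comp (tendsto_nhdsWithin_iff.2 ⟨?_, ?_⟩)
    · exact (NNReal.continuous_coe.tendsto 0).mono_left nhdsWithin_le_nhds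
    · filter_upwards [self_mem_nhdsWithin] with h hh
      simpa using hh
  have hd := (((hT.generator _ _).1 he).sub hexp).comp hs
  have hd2 := (hd.norm.const_mul (M * t))
  rw [sub_self, norm_zero, mul_zero] at hd2
  have hle : ∀ n : ℕ, ‖T t e - Real.exp (-l * t) • e‖ ≤ M * t *
      ‖((fun h : ℝ≥0 => (h : ℝ)⁻¹ • (T h e - e) - (h : ℝ)⁻¹ • (Real.exp (-l * h) • e - e)) ∘
        fun n : ℕ => t / ((n : ℝ≥0) + 1)) n‖ := fun n => by
    set h : ℝ≥0 := t / ((n : ℝ≥0) + 1) with hh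
    have hn : ((n + 1 : ℕ) : ℝ≥0) * h = t := by
      rw [hh]; push_cast; field_simp
    have hhp : (0 : ℝ) < h := by rw [hh]; push_cast; positivity
    have hnR : ((n + 1 : ℕ) : ℝ) * (h : ℝ) = t := by exact_mod_cast hn
    have h1 := hT.norm_iterate_sub_le (h := h) (M := M) (e := e) (Real.exp_pos (-l * h)).le
      (Real.exp_le_one_iff.2 (by nlinarith)) (n + 1) fun j hj => hM _ (le_trans (by
        rw [← hn]
        exact mul_le_mul_left (by exact_mod_cast hj.le) h) ht)
    rw [hn, ← Real.exp_nat_mul, mul_left_comm, hnR] at h1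
    refine h1.trans (le_of_eq ?_)
    simp only [Function.comp_apply, ← hh]
    rw [← smul_sub, sub_sub_sub_cancel_right, norm_smul, norm_inv, Real.norm_of_nonneg hhp.le,
      ← hnR]
    field_simp
  have h0 := ge_of_tendsto' hd2 hle
  exact sub_eq_zero.1 (norm_le_zero_iff.1 h0)

/-- A semigroup acts on an eigenvector of its generator through the exponential. -/
theorem IsSemigroupOf.apply_eigenvector [CompleteSpace H] (hT : IsSemigroupOf G T) {l : ℝ}
    (hl : 0 ≤ l) {e : H} (he : (e, -l • e) ∈ G) (t : ℝ≥0) : T t e = Real.exp (-l * t) • e := by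
  obtain ⟨δ, hδ, M, -, hM⟩ := hT.exists_norm_le
  -- A large time is divided into `n` equal steps short enough for the local statement, which is
  -- then iterated.
  obtain ⟨n, hn⟩ := exists_nat_gt (t / δ)
  have hn0 : (0 : ℝ≥0) < n := zero_le.trans_lt hn
  have hle : t / n ≤ δ := by
    rw [div_le_iff₀ hn0, mul_comm]
    exact ((div_lt_iff₀ hδ).1 hn).le
  have h1 := hT.apply_eigenvector_of_le hl he hM hle
  have h2 : ∀ j : ℕ, T (j * (t / n)) e = Real.exp (-l * (t / n : ℝ≥0)) ^ j • e := fun j => by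
    induction j with
    | zero => simp [hT.zero]
    | succ j ih =>
      rw [Nat.cast_succ, add_mul, one_mul, hT.add, ContinuousLinearMap.comp_apply, h1, map_smul, ih,
        smul_smul, pow_succ']
  have h3 := h2 n
  rw [mul_div_cancel₀ _ hn0.ne', ← Real.exp_nat_mul] at h3
  rw [h3]
  congr 2
  have : (n : ℝ) ≠ 0 := by exact_mod_cast hn0.ne'
  push_cast
  field_simp

end Semigroup

/-! ### The semigroup on `L²` -/

theorem toL2_mode_mem_graphL (m : ℤ) (c : ℂ) :
    (toL2 (mode m c), -lam m • toL2 (mode m c)) ∈ graphL := by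
  refine mem_graphL_iff.2 fun n => ?_
  rw [coef_smul, coef_toL2_mode]
  split_ifs with h
  · rw [h, Complex.real_smul]; push_cast; ring
  · simp

/-- A bounded operator is determined by its values on the modes, and each mode is an eigenvector of
the generator. In particular the semigroup is unique. -/
theorem coef_semigroup {T : ℝ≥0 → L2 →L[ℝ] L2} (hT : IsSemigroupOf graphL T) (t : ℝ≥0) (f : L2)
    (m : ℤ) : coef (T t f) m = Real.exp (-lam m * t) • coef f m := by
  have h1 := ((hasSum_mode f).mapL (T t)).mapL (coefCLM m)
  have h2 : ∀ n, coefCLM m (T t (toL2 (mode n (coef f n)))) =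
      if n = m then Real.exp (-lam m * t) • coef f m else 0 := fun n => by
    rw [hT.apply_eigenvector (lam_nonneg n) (toL2_mode_mem_graphL n _) t, coefCLM_apply, coef_smul,
      coef_toL2_mode]
    split_ifs with h
    · rw [h]
    · rw [smul_zero]
  simp only [h2] at h1
  exact h1.unique (hasSum_ite_eq m _)

theorem norm_sq_eq_tsum_coef (f : L2) : ‖f‖ ^ 2 = 2 * Real.pi * ∑' m, ‖coef f m‖ ^ 2 := by
  rw [(hasSum_norm_sq_coef f).tsum_eq, mul_inv_cancel_left₀ Real.two_pi_pos.ne']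

/-- Dominated convergence for Fourier coefficients. -/
theorem tendsto_of_tendsto_coef {ι : Type*} {l : Filter ι} {F : ι → L2} {f : L2} {b : ℤ → ℝ}
    (hb : Summable fun m => b m ^ 2) (hF : ∀ m, Tendsto (fun i => coef (F i) m) l (𝓝 (coef f m)))
    (hle : ∀ᶠ i in l, ∀ m, ‖coef (F i) m - coef f m‖ ≤ b m) : Tendsto F l (𝓝 f) := by
  rw [tendsto_iff_norm_sub_tendsto_zero]
  have h1 : Tendsto (fun i => ∑' m, ‖coef (F i) m - coef f m‖ ^ 2) l (𝓝 (∑' _ : ℤ, (0 : ℝ))) := by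
    refine tendsto_tsum_of_dominated_convergence hb (fun m => ?_) ?_
    · have := ((tendsto_iff_norm_sub_tendsto_zero.1 (hF m)).pow 2)
      rwa [zero_pow two_ne_zero] at this
    · filter_upwards [hle] with i hi m
      rw [Real.norm_of_nonneg (by positivity)]
      exact pow_le_pow_left₀ (norm_nonneg _) (hi m) 2
  rw [tsum_zero] at h1
  have h2 : Tendsto (fun i => ‖F i - f‖ ^ 2) l (𝓝 0) := by
    have := h1.const_mul (2 * Real.pi)
    rw [mul_zero] at this
    refine this.congr fun i => ?_
    rw [norm_sq_eq_tsum_coef]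
    simp only [coef_sub]
  have h3 := h2.sqrt
  rw [Real.sqrt_zero] at h3
  exact h3.congr fun i => Real.sqrt_sq (norm_nonneg _)

theorem tendsto_exp_sub_one_div (l : ℝ) :
    Tendsto (fun t : ℝ≥0 => (t : ℝ)⁻¹ * (Real.exp (-l * t) - 1)) (𝓝[≠] 0) (𝓝 (-l)) := by
  have h1 : HasDerivAt (fun x : ℝ => Real.exp (-l * x)) (-l) 0 := by
    have := ((hasDerivAt_id (0 : ℝ)).const_mul (-l)).exp
    simpa using this
  have h2 := h1.tendsto_slope_zero
  simp only [zero_add, mul_zero, Real.exp_zero, smul_eq_mul] at h2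
  refine h2.comp (tendsto_nhdsWithin_iff.2 ⟨?_, ?_⟩)
  · exact (NNReal.continuous_coe.tendsto 0).mono_left nhdsWithin_le_nhds
  · filter_upwards [self_mem_nhdsWithin] with h hh
    simpa using hh

/-- By 1 + x ≤ e^x the difference quotient lies in [-l, 0]. This makes the coefficients of 𝓛f a
square summable majorant for the generator limit. -/
theorem abs_exp_sub_one_div_add_le {l : ℝ} (hl : 0 ≤ l) {t : ℝ≥0} (ht : t ≠ 0) :
    |(t : ℝ)⁻¹ * (Real.exp (-l * t) - 1) + l| ≤ l := by
  have htp : (0 : ℝ) < t := by exact_mod_cast pos_iff_ne_zero.2 ht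
  have h1 : Real.exp (-l * t) ≤ 1 := Real.exp_le_one_iff.2 (by nlinarith)
  have h2 := Real.add_one_le_exp (-l * t)
  have h3 : (t : ℝ)⁻¹ * (Real.exp (-l * t) - 1) ≤ 0 :=
    mul_nonpos_of_nonneg_of_nonpos (by positivity) (by linarith)
  have h4 : -l ≤ (t : ℝ)⁻¹ * (Real.exp (-l * t) - 1) := by
    rw [inv_mul_eq_div, le_div_iff₀ htp]
    linarith
  rw [abs_le]
  constructor <;> linarith

/-- Strong continuity and the generator limit on the graph are dominated convergence in the
coefficients. Conversely, if the difference quotients converge in `L2`, so does each coefficient,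
and the limit satisfies the equation that defines the graph. -/
theorem isSemigroupOf_of_coef {T : ℝ≥0 → L2 →L[ℝ] L2}
    (hT : ∀ t f m, coef (T t f) m = Real.exp (-lam m * t) • coef f m) :
    IsSemigroupOf graphL T where
  zero := by
    ext1 f
    refine coef_ext fun m => ?_
    rw [hT]
    simp
  add s t := by
    ext1 f
    refine coef_ext fun m => ?_
    rw [ContinuousLinearMap.comp_apply, hT, hT, hT, smul_smul, ← Real.exp_add, NNReal.coe_add,
      mul_add]
  continuous f := by
    refine tendsto_of_tendsto_coef (b := fun m => ‖coef f m‖) (hasSum_norm_sq_coef f).summable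
      (fun m => ?_) (Eventually.of_forall fun t m => ?_)
    · simp only [hT]
      have h1 : Continuous fun t : ℝ≥0 => Real.exp (-lam m * t) • coef f m := by fun_prop
      have h2 := h1.tendsto 0
      simpa using h2
    · rw [hT, show Real.exp (-lam m * t) • coef f m - coef f m =
        (Real.exp (-lam m * t) - 1) • coef f m by rw [sub_smul, one_smul], norm_smul, Real.norm_eq_abs]
      refine mul_le_of_le_one_left (norm_nonneg _) ?_
      have h1 : Real.exp (-lam m * t) ≤ 1 := Real.exp_le_one_iff.2 (by
        nlinarith [lam_nonneg m, t.coe_nonneg])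
      have h2 := Real.exp_pos (-lam m * t)
      rw [abs_le]
      constructor <;> linarith
  generator f g := by
    have hc : ∀ (t : ℝ≥0) m, coef ((t : ℝ)⁻¹ • (T t f - f)) m =
        ((t : ℝ)⁻¹ * (Real.exp (-lam m * t) - 1)) • coef f m := fun t m => by
      rw [coef_smul, coef_sub, hT, mul_smul, sub_smul, one_smul]
    have hlim : ∀ m, Tendsto (fun t : ℝ≥0 => coef ((t : ℝ)⁻¹ • (T t f - f)) m) (𝓝[≠] 0)
        (𝓝 (-(lam m : ℂ) * coef f m)) := fun m => by
      simp only [hc]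
      have := (tendsto_exp_sub_one_div (lam m)).smul_const (coef f m)
      rwa [Complex.real_smul, Complex.ofReal_neg] at this
    rw [mem_graphL_iff]
    constructor
    · intro h
      refine tendsto_of_tendsto_coef (b := fun m => ‖coef g m‖) (hasSum_norm_sq_coef g).summable
        (fun m => ?_) ?_
      · rw [h m]; exact hlim m
      · filter_upwards [self_mem_nhdsWithin] with t ht m
        have e : coef ((t : ℝ)⁻¹ • (T t f - f)) m - coef g m =
            ((t : ℝ)⁻¹ * (Real.exp (-lam m * t) - 1) + lam m) • coef f m := by
          rw [hc, h m, add_smul, Complex.real_smul (x := lam m)]; ring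
        rw [e, h m, norm_smul, norm_mul, norm_neg, Complex.norm_real, Real.norm_eq_abs,
          Real.norm_of_nonneg (lam_nonneg m)]
        exact mul_le_mul_of_nonneg_right (abs_exp_sub_one_div_add_le (lam_nonneg m) ht)
          (norm_nonneg _)
    · intro h m
      exact tendsto_nhds_unique (((continuous_coef m).tendsto g).comp h) (hlim m)

theorem existsUnique_semigroup : ∃! T : ℝ≥0 → L2 →L[ℝ] L2, IsSemigroupOf graphL T := by
  have hex : ∀ t : ℝ≥0, ∃ S : L2 →L[ℝ] L2, ∀ f m, coef (S f) m = Real.exp (-lam m * t) • coef f m :=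
    fun t => exists_multiplier (B := 1) fun m => by
      rw [abs_of_pos (Real.exp_pos _)]
      exact Real.exp_le_one_iff.2 (by nlinarith [lam_nonneg m, t.coe_nonneg])
  choose T hT using hex
  refine ⟨T, isSemigroupOf_of_coef hT, fun S hS => ?_⟩
  funext t
  ext1 f
  refine coef_ext fun m => ?_
  rw [coef_semigroup hS, hT]

/-! ### Convolution on the circle -/

/-- The convolution `(1 / 2π) ∫ K(φ) f(θ - φ) dφ`. -/
def circleConv (K f : ℝ → ℂ) (θ : ℝ) : ℂ :=
  (2 * Real.pi : ℂ)⁻¹ * ∫ φ in (-Real.pi)..Real.pi, K φ * f (θ - φ)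

theorem periodic_integral_symm {E : Type*} [NormedAddCommGroup E] [NormedSpace ℝ E]
    {h : ℝ → E} (hp : Function.Periodic h (2 * Real.pi)) :
    ∫ φ in (-Real.pi)..Real.pi, h φ = ∫ φ in (0 : ℝ)..(2 * Real.pi), h φ := by
  have := hp.intervalIntegral_add_eq (-Real.pi) 0
  rwa [zero_add, show -Real.pi + 2 * Real.pi = Real.pi by ring] at this

theorem circleConv_comm {K f : ℝ → ℂ} (hK : Function.Periodic K (2 * Real.pi))
    (hf : Function.Periodic f (2 * Real.pi)) : circleConv K f = circleConv f K := by
  funext θ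
  have hp : Function.Periodic (fun x => K (θ - x) * f x) (2 * Real.pi) := fun x => by
    simp only [hf x, show θ - (x + 2 * Real.pi) = θ - x - 2 * Real.pi by ring, hK.sub_eq]
  have h1 := integral_sub_left_periodic hp θ
  rw [← periodic_integral_symm hp] at h1
  simp only [sub_sub_cancel] at h1
  rw [circleConv, circleConv, h1]
  simp only [mul_comm]

theorem circleConv_periodic {K f : ℝ → ℂ} (hf : Function.Periodic f (2 * Real.pi)) :
    Function.Periodic (circleConv K f) (2 * Real.pi) := fun θ => by
  simp only [circleConv, show ∀ φ, θ + 2 * Real.pi - φ = θ - φ + 2 * Real.pi by intro; ring, hf _]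

theorem continuous_circleConv {K f : ℝ → ℂ} (hK : Continuous K) (hf : Continuous f) :
    Continuous (circleConv K f) :=
  continuous_const.mul (intervalIntegral.continuous_parametric_intervalIntegral_of_continuous'
    (f := fun θ φ => K φ * f (θ - φ)) (by unfold Function.uncurry; fun_prop) _ _)

theorem circleConv_sub {K f : ℝ → ℂ} (hK : Continuous K) (hf : Continuous f) (θ θ' : ℝ) :
    circleConv K f θ - circleConv K f θ' =
      (2 * Real.pi : ℂ)⁻¹ * ∫ φ in (-Real.pi)..Real.pi, K φ * (f (θ - φ) - f (θ' - φ)) := by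
  rw [circleConv, circleConv, ← mul_sub, ← intervalIntegral.integral_sub
    (Continuous.intervalIntegrable (by fun_prop) _ _)
    (Continuous.intervalIntegrable (by fun_prop) _ _)]
  simp only [mul_sub]

/-- The mean of a function dominated by a multiple of a density of mean one. -/
theorem norm_mean_le {p : ℝ → ℝ} (hp : Continuous p)
    (hint : ∫ φ in (-Real.pi)..Real.pi, p φ = 2 * Real.pi) {F : ℝ → ℂ} {C : ℝ}
    (h : ∀ φ, |φ| ≤ Real.pi → ‖F φ‖ ≤ C * p φ) :
    ‖(2 * Real.pi : ℂ)⁻¹ * ∫ φ in (-Real.pi)..Real.pi, F φ‖ ≤ C := by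
  have h1 : ‖∫ φ in (-Real.pi)..Real.pi, F φ‖ ≤ ∫ φ in (-Real.pi)..Real.pi, C * p φ :=
    intervalIntegral.norm_integral_le_of_norm_le (by linarith [Real.pi_pos])
      (ae_of_all _ fun φ hφ => h φ (abs_le.2 ⟨hφ.1.le, hφ.2⟩))
      ((continuous_const.mul hp).intervalIntegrable _ _)
  rw [intervalIntegral.integral_const_mul, hint] at h1
  have e : ‖(2 * Real.pi : ℂ)⁻¹‖ = (2 * Real.pi)⁻¹ := by
    rw [norm_inv]
    congr 1
    have : (2 * Real.pi : ℂ) = ((2 * Real.pi : ℝ) : ℂ) := by push_cast; ring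
    rw [this, Complex.norm_real, Real.norm_of_nonneg Real.two_pi_pos.le]
  rw [norm_mul, e, inv_mul_le_iff₀ Real.two_pi_pos]
  linarith

theorem hasDerivAt_circleConv {K f f' : ℝ → ℂ} (hK : Continuous K)
    (hf : ∀ θ, HasDerivAt f (f' θ) θ) (hf' : Continuous f')
    (hp : Function.Periodic f' (2 * Real.pi)) (θ : ℝ) :
    HasDerivAt (circleConv K f) (circleConv K f' θ) θ := by
  obtain ⟨M, hM, hb⟩ := exists_norm_le_of_periodic hf' hp
  have hcf : Continuous f := continuous_iff_continuousAt.2 fun x => (hf x).continuousAt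
  refine HasDerivAt.const_mul _ (intervalIntegral.hasDerivAt_integral_of_dominated_loc_of_deriv_le
    (F := fun θ φ => K φ * f (θ - φ)) (F' := fun θ φ => K φ * f' (θ - φ)) (s := univ)
    (bound := fun φ => ‖K φ‖ * M) univ_mem (Eventually.of_forall fun x => ?_) ?_ ?_ ?_ ?_ ?_).2
  · exact Continuous.aestronglyMeasurable (by fun_prop)
  · exact Continuous.intervalIntegrable (by fun_prop) _ _
  · exact Continuous.aestronglyMeasurable (by fun_prop)
  · exact ae_of_all _ fun φ _ x _ => by
      rw [norm_mul]
      exact mul_le_mul_of_nonneg_left (hb _) (norm_nonneg _)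
  · exact Continuous.intervalIntegrable (by fun_prop) _ _
  · exact ae_of_all _ fun φ _ x _ => ((hf (x - φ)).comp_sub_const x φ).const_mul _

/-- Commutativity of the convolution moves the derivative from the function to the kernel, so no
smoothness of `f` is required. -/
theorem hasDerivAt_circleConv_left {K K' f : ℝ → ℂ} (hK : ∀ θ, HasDerivAt K (K' θ) θ)
    (hK' : Continuous K') (hp : Function.Periodic K (2 * Real.pi))
    (hp' : Function.Periodic K' (2 * Real.pi)) (hf : Continuous f)
    (hpf : Function.Periodic f (2 * Real.pi)) (θ : ℝ) :
    HasDerivAt (circleConv K f) (circleConv K' f θ) θ := by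
  rw [circleConv_comm hp hpf, circleConv_comm hp' hpf]
  exact hasDerivAt_circleConv hf hK hK' hp' θ

theorem coeffC_circleConv {K f : ℝ → ℂ} (hK : Continuous K) (hpK : Function.Periodic K (2 * Real.pi))
    (hf : Continuous f) (hp : Function.Periodic f (2 * Real.pi)) (m : ℤ) :
    coeffC (circleConv K f) m = coeffC K m * coeffC f m := by
  have hc := continuous_chr (-m)
  have hint : IntegrableOn (Function.uncurry fun θ φ => chr (-m) θ * (K φ * f (θ - φ)))
      (uIoc 0 (2 * Real.pi) ×ˢ uIoc (-Real.pi) Real.pi) := by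
    have h1 : Continuous (Function.uncurry fun θ φ => chr (-m) θ * (K φ * f (θ - φ))) := by
      unfold Function.uncurry; fun_prop
    exact (h1.continuousOn.integrableOn_compact
      (isCompact_uIcc.prod isCompact_uIcc)).mono_set
        (Set.prod_mono uIoc_subset_uIcc uIoc_subset_uIcc)
  have hswap := intervalIntegral_intervalIntegral_swap hint
  have h2 : ∀ φ, ∫ θ in (0 : ℝ)..(2 * Real.pi), chr (-m) θ * (K φ * f (θ - φ)) =
      (2 * Real.pi) * coeffC f m * (chr (-m) φ * K φ) := fun φ => by
    have e1 := coeffC_comp_sub hp m φ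
    rw [coeffC, inv_mul_eq_iff_eq_mul₀ two_pi_ne] at e1
    simp_rw [mul_left_comm (chr (-m) _)]
    rw [intervalIntegral.integral_const_mul, e1]
    ring
  simp only [h2, intervalIntegral.integral_const_mul] at hswap
  rw [periodic_integral_symm fun φ => by simp only [chr_periodic (-m) φ, hpK φ]] at hswap
  have h3 : ∀ θ, chr (-m) θ * circleConv K f θ = (2 * Real.pi : ℂ)⁻¹ *
      ∫ φ in (-Real.pi)..Real.pi, chr (-m) θ * (K φ * f (θ - φ)) := fun θ => by
    rw [circleConv, mul_left_comm, intervalIntegral.integral_const_mul]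
  rw [coeffC]
  simp only [h3, intervalIntegral.integral_const_mul] at hswap ⊢
  rw [hswap, coeffC, coeffC]
  field_simp [two_pi_ne]

/-! ### Poisson kernels -/

/-- The denominator `1 - 2 r cos φ + r²`. -/
def poissonDen (r φ : ℝ) : ℝ := 1 - 2 * r * Real.cos φ + r ^ 2

/-- The Poisson kernel of the disc. -/
def poisson (r φ : ℝ) : ℝ := (1 - r ^ 2) / poissonDen r φ

/-- The derivative of the Poisson kernel. -/
def poissonDeriv (r φ : ℝ) : ℝ := -((1 - r ^ 2) * (2 * r * Real.sin φ)) / poissonDen r φ ^ 2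

/-- This form shows the two scales of the kernel, 1 - r and |φ|; each of them controls the
derivative in one of the estimates below. -/
theorem poissonDen_eq (r φ : ℝ) :
    poissonDen r φ = (1 - r) ^ 2 + 4 * r * Real.sin (φ / 2) ^ 2 := by
  have h := Real.cos_two_mul' (φ / 2)
  rw [mul_div_cancel₀ φ two_ne_zero] at h
  have h2 := Real.sin_sq_add_cos_sq (φ / 2)
  rw [poissonDen, h]
  linear_combination -2 * r * h2

theorem poissonDen_pos {r : ℝ} (h0 : 0 ≤ r) (h1 : r < 1) (φ : ℝ) : 0 < poissonDen r φ := by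
  rw [poissonDen_eq]
  have : 0 < 1 - r := sub_pos.2 h1
  positivity

theorem poisson_nonneg {r : ℝ} (h0 : 0 ≤ r) (h1 : r < 1) (φ : ℝ) : 0 ≤ poisson r φ :=
  div_nonneg (by nlinarith) (poissonDen_pos h0 h1 φ).le

theorem continuous_poisson {r : ℝ} (h0 : 0 ≤ r) (h1 : r < 1) : Continuous (poisson r) :=
  continuous_const.div (by unfold poissonDen; fun_prop) fun φ => (poissonDen_pos h0 h1 φ).ne'

theorem continuous_poissonDeriv {r : ℝ} (h0 : 0 ≤ r) (h1 : r < 1) :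
    Continuous (poissonDeriv r) :=
  Continuous.div (by fun_prop) (by unfold poissonDen; fun_prop)
    fun φ => pow_ne_zero 2 (poissonDen_pos h0 h1 φ).ne'

theorem poisson_periodic (r : ℝ) : Function.Periodic (poisson r) (2 * Real.pi) := fun φ => by
  simp only [poisson, poissonDen, Real.cos_add_two_pi]

theorem poissonDeriv_periodic (r : ℝ) : Function.Periodic (poissonDeriv r) (2 * Real.pi) :=
  fun φ => by
    simp only [poissonDeriv, poissonDen, Real.cos_add_two_pi, Real.sin_add_two_pi]

theorem hasDerivAt_poisson {r : ℝ} (h0 : 0 ≤ r) (h1 : r < 1) (φ : ℝ) :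
    HasDerivAt (poisson r) (poissonDeriv r φ) φ := by
  have hD : HasDerivAt (poissonDen r) (2 * r * Real.sin φ) φ := by
    have := (((Real.hasDerivAt_cos φ).const_mul (2 * r)).const_sub 1).add_const (r ^ 2)
    rw [mul_neg, neg_neg] at this
    exact this
  have := (hasDerivAt_const φ (1 - r ^ 2)).div hD (poissonDen_pos h0 h1 φ).ne'
  rwa [zero_mul, zero_sub] at this

/-- The logarithmic derivative of the kernel is -2r sin φ divided by the denominator, so a bound of
the derivative by the kernel is a comparison of sin φ with the denominator. -/
theorem mul_abs_poissonDeriv_le {r : ℝ} (h0 : 0 ≤ r) (h1 : r < 1) {φ c d : ℝ}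
    (h : c * |2 * r * Real.sin φ| ≤ d * poissonDen r φ) :
    c * |poissonDeriv r φ| ≤ d * poisson r φ := by
  have hD := poissonDen_pos h0 h1 φ
  have h2 : 0 ≤ 1 - r ^ 2 := by nlinarith
  rw [poissonDeriv, poisson, abs_div, abs_neg, abs_mul, abs_of_nonneg h2, abs_of_pos (pow_pos hD 2),
    ← mul_div_assoc, ← mul_div_assoc, div_le_div_iff₀ (pow_pos hD 2) hD]
  have h3 := mul_le_mul_of_nonneg_right h (mul_nonneg h2 hD.le)
  nlinarith

theorem abs_two_mul_sin_le {r : ℝ} (h0 : 0 ≤ r) (φ : ℝ) :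
    |2 * r * Real.sin φ| ≤ 4 * r * |Real.sin (φ / 2)| := by
  have h := Real.sin_two_mul (φ / 2)
  rw [mul_div_cancel₀ φ two_ne_zero] at h
  rw [h, show 2 * r * (2 * Real.sin (φ / 2) * Real.cos (φ / 2)) =
    4 * r * (Real.sin (φ / 2) * Real.cos (φ / 2)) by ring, abs_mul, abs_of_nonneg (by positivity),
    abs_mul]
  gcongr
  exact mul_le_of_le_one_right (abs_nonneg _) (Real.abs_cos_le_one _)

theorem one_sub_mul_abs_poissonDeriv_le {r : ℝ} (h0 : 0 ≤ r) (h1 : r < 1) (φ : ℝ) :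
    (1 - r) * |poissonDeriv r φ| ≤ 1 * poisson r φ := by
  refine mul_abs_poissonDeriv_le h0 h1 ?_
  have h2 := mul_le_mul_of_nonneg_left (abs_two_mul_sin_le h0 φ) (sub_pos.2 h1).le
  rw [poissonDen_eq, ← sq_abs (Real.sin (φ / 2))]
  set s := |Real.sin (φ / 2)|
  have h3 : r ^ 2 * s ^ 2 ≤ r * s ^ 2 := by
    have : 0 ≤ r * s ^ 2 := by positivity
    nlinarith
  -- The square gives 4(1 - r)rs ≤ (1 - r)² + 4r²s², and r² ≤ r turns the right side into a lower
  -- bound of the denominator.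
  nlinarith [sq_nonneg (1 - r - 2 * (r * s))]

theorem abs_mul_abs_poissonDeriv_le {r : ℝ} (h0 : 0 ≤ r) (h1 : r < 1) {φ : ℝ} (hφ : |φ| ≤ Real.pi) :
    |φ| * |poissonDeriv r φ| ≤ Real.pi * poisson r φ := by
  refine mul_abs_poissonDeriv_le h0 h1 ?_
  have h2 := Real.mul_abs_le_abs_sin (x := φ / 2) (by
    rw [abs_div, abs_two]; linarith)
  rw [abs_div, abs_two, div_mul_div_comm, mul_comm Real.pi, mul_div_mul_left _ _ two_ne_zero,
    div_le_iff₀ Real.pi_pos] at h2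
  rw [poissonDen_eq, ← sq_abs (Real.sin (φ / 2))]
  set s := |Real.sin (φ / 2)| with hs
  have hs0 : 0 ≤ s := abs_nonneg _
  calc |φ| * |2 * r * Real.sin φ| ≤ (s * Real.pi) * (4 * r * s) :=
        mul_le_mul h2 (abs_two_mul_sin_le h0 φ) (abs_nonneg _) (by positivity)
    _ = Real.pi * (4 * r * s ^ 2) := by ring
    _ ≤ _ := by
        have := sq_nonneg (1 - r)
        gcongr
        linarith

/-- Over the common denominator the claim is |cos φ - r| ≤ 1 - r cos φ, that is (1 - r)(1 + cos φ) ≥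
0 and (1 + r)(1 - cos φ) ≥ 0. The factor `r` on the right is the source of the exponential decay. -/
theorem abs_poisson_sub_one_le {r : ℝ} (h0 : 0 ≤ r) (h1 : r < 1) (φ : ℝ) :
    |poisson r φ - 1| ≤ r * (poisson r φ + 1) := by
  have hD := poissonDen_pos h0 h1 φ
  have hc := Real.cos_le_one φ
  have hc' := Real.neg_one_le_cos φ
  have e1 : poisson r φ - 1 = 2 * r * (Real.cos φ - r) / poissonDen r φ := by
    rw [poisson]; field_simp; rw [poissonDen]; ring
  have e2 : r * (poisson r φ + 1) = 2 * r * (1 - r * Real.cos φ) / poissonDen r φ := by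
    rw [poisson]; field_simp; rw [poissonDen]; ring
  rw [e1, e2, abs_div, abs_of_pos hD, abs_mul, abs_of_nonneg (by positivity : 0 ≤ 2 * r)]
  gcongr
  rw [abs_le]
  constructor <;> nlinarith

theorem chr_mul_natCast (e : ℤ) (n : ℕ) (φ : ℝ) : chr (e * n) φ = chr e φ ^ n := by
  induction n with
  | zero => simp [chr_zero]
  | succ n ih => rw [pow_succ, ← ih, chr_mul]; congr 1; push_cast; ring

theorem poissonDen_eq_mul (r φ : ℝ) :
    (poissonDen r φ : ℂ) = (1 - r * chr 1 φ) * (1 - r * chr (-1) φ) := by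
  have e1 : chr 1 φ * chr (-1) φ = 1 := by rw [chr_mul, add_neg_cancel, chr_zero]
  have e2 : chr 1 φ + chr (-1) φ = 2 * Real.cos φ := by
    rw [← conj_chr, Complex.add_conj, chr_one]
    norm_num
  rw [poissonDen]
  push_cast
  push_cast at e2
  linear_combination (r : ℂ) * e2 - (r : ℂ) ^ 2 * e1

theorem norm_mul_chr_lt_one {r : ℝ} (h0 : 0 ≤ r) (h1 : r < 1) (e : ℤ) (φ : ℝ) :
    ‖(r : ℂ) * chr e φ‖ < 1 := by
  rwa [norm_mul, norm_chr, mul_one, Complex.norm_real, Real.norm_of_nonneg h0]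

theorem one_sub_mul_chr_ne_zero {r : ℝ} (h0 : 0 ≤ r) (h1 : r < 1) (e : ℤ) (φ : ℝ) :
    1 - (r : ℂ) * chr e φ ≠ 0 := fun h => by
  have := norm_mul_chr_lt_one h0 h1 e φ
  rw [← sub_eq_zero.1 h, norm_one] at this
  exact lt_irrefl _ this

theorem poisson_eq_add {r : ℝ} (h0 : 0 ≤ r) (h1 : r < 1) (φ : ℝ) :
    (poisson r φ : ℂ) = (1 - r * chr 1 φ)⁻¹ + r * chr (-1) φ * (1 - r * chr (-1) φ)⁻¹ := by
  have n1 := one_sub_mul_chr_ne_zero h0 h1 1 φ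
  have n2 := one_sub_mul_chr_ne_zero h0 h1 (-1) φ
  have e1 : chr 1 φ * chr (-1) φ = 1 := by rw [chr_mul, add_neg_cancel, chr_zero]
  have e2 : ((1 : ℂ) - r ^ 2) = (1 - r * chr (-1) φ) + r * chr (-1) φ * (1 - r * chr 1 φ) := by
    linear_combination (r : ℂ) ^ 2 * e1
  rw [poisson, Complex.ofReal_div, poissonDen_eq_mul]
  push_cast
  rw [e2, add_div, div_mul_cancel_right₀ n2, mul_comm (1 - (r : ℂ) * chr 1 φ), mul_div_mul_right _ _ n1, div_eq_mul_inv]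

theorem hasSum_poisson {r : ℝ} (h0 : 0 ≤ r) (h1 : r < 1) (φ : ℝ) :
    HasSum (fun n : ℤ => (r : ℂ) ^ n.natAbs * chr n φ) (poisson r φ) := by
  rw [poisson_eq_add h0 h1]
  refine HasSum.of_nat_of_neg_add_one ?_ ?_
  · have h := hasSum_geometric_of_norm_lt_one (norm_mul_chr_lt_one h0 h1 1 φ)
    refine h.congr_fun fun n => ?_
    rw [Int.natAbs_natCast, mul_pow, ← chr_mul_natCast, one_mul]
  · have h := (hasSum_geometric_of_norm_lt_one
      (norm_mul_chr_lt_one h0 h1 (-1) φ)).mul_left (r * chr (-1) φ)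
    refine h.congr_fun fun n => ?_
    rw [show (-((n : ℤ) + 1)).natAbs = n + 1 by omega, ← pow_succ', mul_pow, ← chr_mul_natCast]
    congr 2
    push_cast; ring

theorem summable_pow_natAbs {r : ℝ} (h0 : 0 ≤ r) (h1 : r < 1) :
    Summable fun n : ℤ => r ^ n.natAbs := by
  have h := (hasSum_poisson h0 h1 0).summable.norm
  refine h.congr fun n => ?_
  rw [norm_mul, norm_chr, mul_one, norm_pow, Complex.norm_real, Real.norm_of_nonneg h0]

theorem coeffC_poisson {r : ℝ} (h0 : 0 ≤ r) (h1 : r < 1) (m : ℤ) :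
    coeffC (fun φ => (poisson r φ : ℂ)) m = (r : ℂ) ^ m.natAbs := by
  have h := intervalIntegral.hasSum_integral_of_dominated_convergence (μ := volume) (a := 0)
    (b := 2 * Real.pi) (F := fun (n : ℤ) φ => chr (-m) φ * ((r : ℂ) ^ n.natAbs * chr n φ))
    (f := fun φ => chr (-m) φ * poisson r φ) (fun n _ => r ^ n.natAbs)
    (fun n => Continuous.aestronglyMeasurable
      ((continuous_chr _).mul (continuous_const.mul (continuous_chr _))))
    (fun n => ae_of_all _ fun φ _ => by
      rw [norm_mul, norm_mul, norm_chr, norm_chr, one_mul, mul_one, norm_pow, Complex.norm_real,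
        Real.norm_of_nonneg h0])
    (ae_of_all _ fun φ _ => summable_pow_natAbs h0 h1)
    (continuous_const.intervalIntegrable _ _)
    (ae_of_all _ fun φ _ => (hasSum_poisson h0 h1 φ).mul_left _)
  have h2 := h.mul_left (2 * Real.pi : ℂ)⁻¹
  have h3 : ∀ n : ℤ, (2 * Real.pi : ℂ)⁻¹ * ∫ φ in (0 : ℝ)..(2 * Real.pi),
      chr (-m) φ * ((r : ℂ) ^ n.natAbs * chr n φ) = if n = m then (r : ℂ) ^ m.natAbs else 0 :=
    fun n => by
      have := coeffC_chr ((r : ℂ) ^ n.natAbs) m n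
      rw [coeffC] at this
      rw [this]
      split_ifs with hnm
      · rw [hnm]
      · rfl
  simp only [h3] at h2
  exact h2.unique (hasSum_ite_eq m _)

theorem integral_poisson {r : ℝ} (h0 : 0 ≤ r) (h1 : r < 1) :
    ∫ φ in (-Real.pi)..Real.pi, poisson r φ = 2 * Real.pi := by
  have h := coeffC_poisson h0 h1 0
  rw [coeffC, inv_mul_eq_iff_eq_mul₀ two_pi_ne] at h
  simp only [neg_zero, chr_zero, one_mul, Int.natAbs_zero, pow_zero, mul_one] at h
  rw [periodic_integral_symm (poisson_periodic r)]
  rw [intervalIntegral.integral_ofReal] at h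
  exact_mod_cast h

/-! ### Poisson kernels in the rotating frame -/

/-- `e^{iφ} P_r(φ)`. -/
def rotPoisson (r φ : ℝ) : ℂ := chr 1 φ * poisson r φ

/-- The derivative of `rotPoisson`. -/
def rotPoissonDeriv (r φ : ℝ) : ℂ :=
  Complex.I * chr 1 φ * poisson r φ + chr 1 φ * poissonDeriv r φ

/-- `e^{iφ} (P_r(φ) - 1)`. -/
def rotPoissonSub (r φ : ℝ) : ℂ := chr 1 φ * (poisson r φ - 1 : ℝ)

theorem rotPoisson_periodic (r : ℝ) : Function.Periodic (rotPoisson r) (2 * Real.pi) := fun φ => by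
  simp only [rotPoisson, chr_periodic 1 φ, poisson_periodic r φ]

theorem rotPoissonDeriv_periodic (r : ℝ) :
    Function.Periodic (rotPoissonDeriv r) (2 * Real.pi) := fun φ => by
  simp only [rotPoissonDeriv, chr_periodic 1 φ, poisson_periodic r φ, poissonDeriv_periodic r φ]

theorem rotPoissonSub_periodic (r : ℝ) :
    Function.Periodic (rotPoissonSub r) (2 * Real.pi) := fun φ => by
  simp only [rotPoissonSub, chr_periodic 1 φ, poisson_periodic r φ]

theorem coeffC_chr_one_mul (f : ℝ → ℂ) (m : ℤ) :
    coeffC (fun φ => chr 1 φ * f φ) m = coeffC f (m - 1) := by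
  rw [coeffC, coeffC]
  simp only [← mul_assoc, chr_mul, show -m + 1 = -(m - 1) by ring]

section

variable {r : ℝ}

theorem continuous_rotPoisson (h0 : 0 ≤ r) (h1 : r < 1) : Continuous (rotPoisson r) :=
  (continuous_chr 1).mul (Complex.continuous_ofReal.comp (continuous_poisson h0 h1))

theorem continuous_rotPoissonDeriv (h0 : 0 ≤ r) (h1 : r < 1) : Continuous (rotPoissonDeriv r) :=
  ((continuous_const.mul (continuous_chr 1)).mul
    (Complex.continuous_ofReal.comp (continuous_poisson h0 h1))).add
      ((continuous_chr 1).mul (Complex.continuous_ofReal.comp (continuous_poissonDeriv h0 h1)))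

theorem continuous_rotPoissonSub (h0 : 0 ≤ r) (h1 : r < 1) : Continuous (rotPoissonSub r) :=
  (continuous_chr 1).mul (Complex.continuous_ofReal.comp
    ((continuous_poisson h0 h1).sub continuous_const))

theorem hasDerivAt_rotPoisson (h0 : 0 ≤ r) (h1 : r < 1) (φ : ℝ) :
    HasDerivAt (rotPoisson r) (rotPoissonDeriv r φ) φ := by
  have h := (hasDerivAt_chr 1 φ).mul (hasDerivAt_poisson h0 h1 φ).ofReal_comp
  rw [Int.cast_one, one_mul] at h
  exact h

theorem coeffC_rotPoisson (h0 : 0 ≤ r) (h1 : r < 1) (m : ℤ) :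
    coeffC (rotPoisson r) m = (r : ℂ) ^ (m - 1).natAbs :=
  (coeffC_chr_one_mul _ m).trans (coeffC_poisson h0 h1 (m - 1))

/-- Subtracting e^{iφ} alters only the coefficient at frequency 1, which is irrelevant when
convolving with a function that lacks this frequency. -/
theorem coeffC_rotPoissonSub (h0 : 0 ≤ r) (h1 : r < 1) {m : ℤ} (hm : m ≠ 1) :
    coeffC (rotPoissonSub r) m = (r : ℂ) ^ (m - 1).natAbs := by
  have e : rotPoissonSub r = fun φ => rotPoisson r φ - 1 * chr 1 φ := by
    funext φ
    rw [rotPoissonSub, rotPoisson]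
    push_cast
    ring
  rw [e, coeffC_sub (g := fun φ => 1 * chr 1 φ) ((continuous_rotPoisson h0 h1).intervalIntegrable _ _)
    ((continuous_const.mul (continuous_chr 1)).intervalIntegrable _ _), coeffC_rotPoisson h0 h1,
    coeffC_chr, if_neg hm.symm, sub_zero]

theorem norm_rotPoisson (h0 : 0 ≤ r) (h1 : r < 1) (φ : ℝ) : ‖rotPoisson r φ‖ = poisson r φ := by
  rw [rotPoisson, norm_mul, norm_chr, one_mul, Complex.norm_real,
    Real.norm_of_nonneg (poisson_nonneg h0 h1 φ)]

theorem norm_rotPoissonSub_le (h0 : 0 ≤ r) (h1 : r < 1) (φ : ℝ) :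
    ‖rotPoissonSub r φ‖ ≤ 2 * r * ((poisson r φ + 1) / 2) := by
  rw [rotPoissonSub, norm_mul, norm_chr, one_mul, Complex.norm_real, Real.norm_eq_abs]
  linarith [abs_poisson_sub_one_le h0 h1 φ]

theorem integral_poisson_add_one_div_two (h0 : 0 ≤ r) (h1 : r < 1) :
    ∫ φ in (-Real.pi)..Real.pi, (poisson r φ + 1) / 2 = 2 * Real.pi := by
  rw [intervalIntegral.integral_div, intervalIntegral.integral_add
    ((continuous_poisson h0 h1).intervalIntegrable _ _) (continuous_const.intervalIntegrable _ _),
    integral_poisson h0 h1, intervalIntegral.integral_const, smul_eq_mul]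
  ring

theorem norm_rotPoissonDeriv_le (h0 : 0 ≤ r) (h1 : r < 1) (φ : ℝ) :
    ‖rotPoissonDeriv r φ‖ ≤ poisson r φ + |poissonDeriv r φ| := by
  refine (norm_add_le _ _).trans (le_of_eq ?_)
  rw [norm_mul, norm_mul, norm_mul, norm_chr, Complex.norm_I, one_mul, one_mul, one_mul,
    Complex.norm_real, Complex.norm_real, Real.norm_of_nonneg (poisson_nonneg h0 h1 φ),
    Real.norm_eq_abs]

theorem norm_rotPoissonDeriv_le_div (h0 : 0 ≤ r) (h1 : r < 1) (φ : ℝ) :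
    ‖rotPoissonDeriv r φ‖ ≤ 2 / (1 - r) * poisson r φ := by
  have hd : 0 < 1 - r := sub_pos.2 h1
  rw [div_mul_eq_mul_div, le_div_iff₀ hd]
  have h2 := one_sub_mul_abs_poissonDeriv_le h0 h1 φ
  have h3 := mul_le_mul_of_nonneg_right (norm_rotPoissonDeriv_le h0 h1 φ) hd.le
  nlinarith [poisson_nonneg h0 h1 φ]

theorem abs_mul_norm_rotPoissonDeriv_le (h0 : 0 ≤ r) (h1 : r < 1) {φ : ℝ} (hφ : |φ| ≤ Real.pi) :
    |φ| * ‖rotPoissonDeriv r φ‖ ≤ 2 * Real.pi * poisson r φ := by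
  have h2 := abs_mul_abs_poissonDeriv_le h0 h1 hφ
  have h3 := mul_le_mul_of_nonneg_left (norm_rotPoissonDeriv_le h0 h1 φ) (abs_nonneg φ)
  have h4 := mul_le_mul_of_nonneg_right hφ (poisson_nonneg h0 h1 φ)
  linarith

end

theorem rpow_le_of_le {h δ a b : ℝ} (hh : 0 ≤ h) (hδ : h ≤ δ) (hb : 0 ≤ b) (hba : b ≤ a) :
    h ^ a ≤ δ ^ (a - b) * h ^ b := by
  rcases hh.eq_or_lt with rfl | hh
  · rcases hb.eq_or_lt with rfl | hb
    · rcases hba.eq_or_lt with rfl | ha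
      · simp
      · rw [Real.zero_rpow ha.ne']; positivity
    · rw [Real.zero_rpow hb.ne', Real.zero_rpow (hb.trans_le hba).ne', mul_zero]
  · have e : h ^ a = h ^ (a - b) * h ^ b := by rw [← Real.rpow_add hh, sub_add_cancel]
    rw [e]
    exact mul_le_mul_of_nonneg_right (Real.rpow_le_rpow hh.le hδ (sub_nonneg.2 hba)) (by positivity)

theorem rpow_le_of_ge {h δ a b : ℝ} (hδ0 : 0 < δ) (hδ : δ ≤ h) (hab : a ≤ b) :
    h ^ a ≤ δ ^ (a - b) * h ^ b := by
  have hh := hδ0.trans_le hδ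
  have e : h ^ a = h ^ (a - b) * h ^ b := by rw [← Real.rpow_add hh, sub_add_cancel]
  rw [e]
  exact mul_le_mul_of_nonneg_right (Real.rpow_le_rpow_of_nonpos hδ0 hδ (sub_nonpos.2 hab))
    (by positivity)

/-- Interpolation at the scale 1 - r: inside it the bound of the derivative by P_r/(1 - r) is used,
outside it the bound by P_r/|φ|. Dominating by P_r itself reduces all later integrals to its mean.
-/
theorem rpow_mul_norm_rotPoissonDeriv_le {r : ℝ} (h0 : 0 ≤ r) (h1 : r < 1) {a : ℝ} (ha0 : 0 ≤ a)
    (ha1 : a ≤ 1) {φ : ℝ} (hφ : |φ| ≤ Real.pi) :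
    |φ| ^ a * ‖rotPoissonDeriv r φ‖ ≤ 2 * Real.pi * (1 - r) ^ (a - 1) * poisson r φ := by
  have hd : 0 < 1 - r := sub_pos.2 h1
  have hP := poisson_nonneg h0 h1 φ
  rcases le_total |φ| (1 - r) with h | h
  · have h2 := mul_le_mul (Real.rpow_le_rpow (abs_nonneg φ) h ha0)
      (norm_rotPoissonDeriv_le_div h0 h1 φ) (norm_nonneg _) (by positivity)
    refine h2.trans ?_
    rw [Real.rpow_sub_one hd.ne']
    have h3 : 0 ≤ (1 - r) ^ a / (1 - r) * poisson r φ := by positivity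
    have h4 : (1 - r) ^ a * (2 / (1 - r) * poisson r φ) = 2 * ((1 - r) ^ a / (1 - r) * poisson r φ) := by
      ring
    rw [h4]
    nlinarith [Real.pi_gt_three]
  · have h2 := rpow_le_of_ge hd h ha1
    rw [Real.rpow_one] at h2
    calc |φ| ^ a * ‖rotPoissonDeriv r φ‖ ≤ ((1 - r) ^ (a - 1) * |φ|) * ‖rotPoissonDeriv r φ‖ := by
          gcongr
      _ = (1 - r) ^ (a - 1) * (|φ| * ‖rotPoissonDeriv r φ‖) := by ring
      _ ≤ (1 - r) ^ (a - 1) * (2 * Real.pi * poisson r φ) := by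
          exact mul_le_mul_of_nonneg_left (abs_mul_norm_rotPoissonDeriv_le h0 h1 hφ) (by positivity)
      _ = _ := by ring

/-! ### Hölder bounds and smoothing -/

/-- Bounds for the derivatives of order at most `k` and for the Hölder seminorm of the last. -/
structure HolderBounds (k : ℕ) (a N : ℝ) (f : ℝ → ℂ) : Prop where
  periodic : Function.Periodic f (2 * Real.pi)
  contDiff : ContDiff ℝ k f
  bound : ∀ l ≤ k, ∀ θ, ‖iteratedDeriv l f θ‖ ≤ N
  holder : ∀ θ θ', ‖iteratedDeriv k f θ - iteratedDeriv k f θ'‖ ≤ N * |θ - θ'| ^ a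

theorem iteratedDeriv_eq_of_hasDerivAt {E : Type*} [NormedAddCommGroup E] [NormedSpace ℝ E]
    {F : ℕ → ℝ → E} {k : ℕ} (h : ∀ l < k, ∀ θ, HasDerivAt (F l) (F (l + 1) θ) θ) :
    ∀ l ≤ k, iteratedDeriv l (F 0) = F l := by
  intro l
  induction l with
  | zero => exact fun _ => iteratedDeriv_zero
  | succ l ih =>
    intro hl
    rw [iteratedDeriv_succ, ih (Nat.le_of_succ_le hl)]
    exact funext fun θ => (h l hl θ).deriv

theorem contDiff_of_hasDerivAt {E : Type*} [NormedAddCommGroup E] [NormedSpace ℝ E]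
    {F : ℕ → ℝ → E} {k : ℕ} (h : ∀ l < k, ∀ θ, HasDerivAt (F l) (F (l + 1) θ) θ)
    (hc : ∀ l ≤ k, Continuous (F l)) : ContDiff ℝ k (F 0) := by
  have e := iteratedDeriv_eq_of_hasDerivAt h
  refine contDiff_nat_iff_iteratedDeriv.2 ⟨fun l hl => ?_, fun l hl θ => ?_⟩
  · rw [e l hl]; exact hc l hl
  · rw [e l hl.le]; exact (h l hl θ).differentiableAt

theorem _root_.ContDiff.hasDerivAt_iteratedDeriv {E : Type*} [NormedAddCommGroup E]
    [NormedSpace ℝ E] {f : ℝ → E} {k : ℕ} (hf : ContDiff ℝ k f) {l : ℕ} (hl : l < k) (θ : ℝ) :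
    HasDerivAt (iteratedDeriv l f) (iteratedDeriv (l + 1) f θ) θ := by
  rw [iteratedDeriv_succ]
  exact (hf.differentiable_iteratedDeriv l (by exact_mod_cast hl) θ).hasDerivAt

namespace HolderBounds

variable {k : ℕ} {a N : ℝ} {f : ℝ → ℂ}

theorem nonneg (hf : HolderBounds k a N f) : 0 ≤ N :=
  (norm_nonneg _).trans (hf.bound 0 (Nat.zero_le k) 0)

theorem continuous_iteratedDeriv (hf : HolderBounds k a N f) {l : ℕ} (hl : l ≤ k) :
    Continuous (iteratedDeriv l f) :=
  hf.contDiff.continuous_iteratedDeriv l (by exact_mod_cast hl)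

theorem continuous (hf : HolderBounds k a N f) : Continuous f := hf.contDiff.continuous

theorem iteratedDeriv_circleConv (hf : HolderBounds k a N f) {K : ℝ → ℂ} (hK : Continuous K)
    {l : ℕ} (hl : l ≤ k) :
    iteratedDeriv l (circleConv K f) = circleConv K (iteratedDeriv l f) := by
  have := iteratedDeriv_eq_of_hasDerivAt (F := fun l => circleConv K (iteratedDeriv l f)) (k := k)
    (fun l hl θ => hasDerivAt_circleConv hK (hf.contDiff.hasDerivAt_iteratedDeriv hl)
      (hf.continuous_iteratedDeriv hl) (iteratedDeriv_periodic hf.periodic _) θ) l hl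
  simpa only [iteratedDeriv_zero] using this

/-- A kernel dominated by `A` times a density of mean one multiplies every translation-invariant
bound by at most `A`; sup norms and Hölder seminorms of derivatives are of this kind. -/
theorem circleConv (hf : HolderBounds k a N f) {K : ℝ → ℂ} (hK : Continuous K) {p : ℝ → ℝ}
    (hp : Continuous p) (hint : ∫ φ in (-Real.pi)..Real.pi, p φ = 2 * Real.pi) {A : ℝ}
    (hle : ∀ φ, ‖K φ‖ ≤ A * p φ) : HolderBounds k a (A * N) (circleConv K f) where
  periodic := circleConv_periodic hf.periodic
  contDiff := by
    have := contDiff_of_hasDerivAt (F := fun l => Peskin.circleConv K (iteratedDeriv l f)) (k := k)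
      (fun l hl θ => hasDerivAt_circleConv hK (hf.contDiff.hasDerivAt_iteratedDeriv hl)
        (hf.continuous_iteratedDeriv hl) (iteratedDeriv_periodic hf.periodic _) θ)
      fun l hl => continuous_circleConv hK (hf.continuous_iteratedDeriv hl)
    simpa only [iteratedDeriv_zero] using this
  bound l hl θ := by
    rw [hf.iteratedDeriv_circleConv hK hl]
    refine norm_mean_le hp hint fun φ _ => ?_
    rw [norm_mul]
    refine (mul_le_mul (hle φ) (hf.bound l hl _) (norm_nonneg _)
      ((norm_nonneg _).trans (hle φ))).trans (le_of_eq (by ring))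
  holder θ θ' := by
    rw [hf.iteratedDeriv_circleConv hK le_rfl,
      circleConv_sub hK (hf.continuous_iteratedDeriv le_rfl)]
    refine norm_mean_le hp hint fun φ _ => ?_
    rw [norm_mul]
    have h := hf.holder (θ - φ) (θ' - φ)
    rw [sub_sub_sub_cancel_right] at h
    refine (mul_le_mul (hle φ) h (norm_nonneg _)
      ((norm_nonneg _).trans (hle φ))).trans (le_of_eq (by ring))

/-! ### Smoothing by the rotated Poisson kernel -/

section Smoothing

variable {r : ℝ}

theorem norm_deriv_circleConv_le (hf : HolderBounds k a N f) (ha0 : 0 ≤ a) (ha1 : a ≤ 1)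
    (h0 : 0 ≤ r) (h1 : r < 1) (θ : ℝ) :
    ‖Peskin.circleConv (rotPoissonDeriv r) (iteratedDeriv k f) θ‖ ≤
      2 * Real.pi * (1 - r) ^ (a - 1) * N := by
  have hc := hf.continuous_iteratedDeriv le_rfl
  have hK := continuous_rotPoissonDeriv h0 h1
  -- The derivative of a periodic kernel has mean zero, so the value at `θ` can be subtracted and
  -- the Hölder bound of the k-th derivative of `f` applies.
  have hz : ∫ φ in (-Real.pi)..Real.pi, rotPoissonDeriv r φ * iteratedDeriv k f θ = 0 := by
    rw [intervalIntegral.integral_mul_const, intervalIntegral.integral_eq_sub_of_hasDerivAt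
      (fun φ _ => hasDerivAt_rotPoisson h0 h1 φ) (hK.intervalIntegrable _ _)]
    have := rotPoisson_periodic r (-Real.pi)
    rw [show -Real.pi + 2 * Real.pi = Real.pi by ring] at this
    rw [this, sub_self, zero_mul]
  rw [Peskin.circleConv, ← sub_zero (∫ _ in _.._, _), ← hz, ← intervalIntegral.integral_sub
    (Continuous.intervalIntegrable (by fun_prop) _ _)
    (Continuous.intervalIntegrable (by fun_prop) _ _)]
  refine norm_mean_le (continuous_poisson h0 h1) (integral_poisson h0 h1) fun φ hφ => ?_
  have h := hf.holder (θ - φ) θ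
  rw [sub_sub_cancel_left, abs_neg] at h
  rw [← mul_sub, norm_mul]
  calc ‖rotPoissonDeriv r φ‖ * ‖iteratedDeriv k f (θ - φ) - iteratedDeriv k f θ‖
      ≤ ‖rotPoissonDeriv r φ‖ * (N * |φ| ^ a) := by gcongr
    _ = N * (|φ| ^ a * ‖rotPoissonDeriv r φ‖) := by ring
    _ ≤ N * (2 * Real.pi * (1 - r) ^ (a - 1) * poisson r φ) :=
        mul_le_mul_of_nonneg_left (rpow_mul_norm_rotPoissonDeriv_le h0 h1 ha0 ha1 hφ) hf.nonneg
    _ = _ := by ring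

theorem norm_deriv_circleConv_sub_le (hf : HolderBounds k a N f) (h0 : 0 ≤ r) (h1 : r < 1)
    (θ θ' : ℝ) :
    ‖Peskin.circleConv (rotPoissonDeriv r) (iteratedDeriv k f) θ -
      Peskin.circleConv (rotPoissonDeriv r) (iteratedDeriv k f) θ'‖ ≤
      2 / (1 - r) * (N * |θ - θ'| ^ a) := by
  have hc := hf.continuous_iteratedDeriv le_rfl
  rw [circleConv_sub (continuous_rotPoissonDeriv h0 h1) hc]
  refine norm_mean_le (continuous_poisson h0 h1) (integral_poisson h0 h1) fun φ hφ => ?_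
  have h := hf.holder (θ - φ) (θ' - φ)
  rw [sub_sub_sub_cancel_right] at h
  rw [norm_mul]
  exact (mul_le_mul (norm_rotPoissonDeriv_le_div h0 h1 φ) h (norm_nonneg _)
    ((norm_nonneg _).trans (norm_rotPoissonDeriv_le_div h0 h1 φ))).trans (le_of_eq (by ring))

theorem hasDerivAt_circleConv_rotPoisson (hf : HolderBounds k a N f) (h0 : 0 ≤ r) (h1 : r < 1)
    (θ : ℝ) : HasDerivAt (Peskin.circleConv (rotPoisson r) (iteratedDeriv k f))
      (Peskin.circleConv (rotPoissonDeriv r) (iteratedDeriv k f) θ) θ :=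
  hasDerivAt_circleConv_left (hasDerivAt_rotPoisson h0 h1) (continuous_rotPoissonDeriv h0 h1)
    (rotPoisson_periodic r) (rotPoissonDeriv_periodic r) (hf.continuous_iteratedDeriv le_rfl)
    (iteratedDeriv_periodic hf.periodic k) θ

theorem circleConv_rotPoisson (hf : HolderBounds k a N f) (h0 : 0 ≤ r) (h1 : r < 1) :
    HolderBounds k a (1 * N) (Peskin.circleConv (rotPoisson r) f) :=
  hf.circleConv (continuous_rotPoisson h0 h1) (continuous_poisson h0 h1) (integral_poisson h0 h1)
    fun φ => by rw [norm_rotPoisson h0 h1, one_mul]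

theorem circleConv_rotPoissonSub (hf : HolderBounds k a N f) (h0 : 0 ≤ r) (h1 : r < 1) :
    HolderBounds k a (2 * r * N) (Peskin.circleConv (rotPoissonSub r) f) :=
  hf.circleConv (continuous_rotPoissonSub h0 h1)
    (((continuous_poisson h0 h1).add continuous_const).div_const 2)
    (integral_poisson_add_one_div_two h0 h1) (norm_rotPoissonSub_le h0 h1)

theorem le_mul_rpow (hf : HolderBounds k a N f) (h0 : 0 ≤ r) (h1 : r < 1) {c d : ℝ} (hd : d ≤ 0)
    (hc : 1 ≤ c) : N ≤ c * (1 - r) ^ d * N := by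
  have h2 := Real.one_le_rpow_of_pos_of_le_one_of_nonpos (sub_pos.2 h1) (by linarith : 1 - r ≤ 1) hd
  exact le_mul_of_one_le_left hf.nonneg (one_le_mul_of_one_le_of_one_le hc h2)

/-- Smoothing which does not change the number of derivatives. -/
theorem smooth_of_le_one (hf : HolderBounds k a N f) (ha0 : 0 ≤ a) {b : ℝ} (hab : a ≤ b)
    (hb : b ≤ 1) (h0 : 0 ≤ r) (h1 : r < 1) :
    HolderBounds k b (4 * Real.pi * (1 - r) ^ (a - b) * N)
      (Peskin.circleConv (rotPoisson r) f) := by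
  have h := hf.circleConv_rotPoisson h0 h1
  have hd : 0 < 1 - r := sub_pos.2 h1
  have hpi : 1 ≤ 4 * Real.pi := by linarith [Real.pi_gt_three]
  have hN := hf.nonneg
  rw [one_mul] at h
  refine ⟨h.periodic, h.contDiff, fun l hl θ => (h.bound l hl θ).trans
    (hf.le_mul_rpow h0 h1 (sub_nonpos.2 hab) hpi), fun θ θ' => ?_⟩
  -- At distances above 1 - r the original Hölder bound is converted to the exponent `b`; below, the
  -- mean value inequality with the bound (1 - r)^{a-1} on the next derivative is used.
  rcases le_total (1 - r) |θ - θ'| with hle | hle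
  · calc _ ≤ N * |θ - θ'| ^ a := h.holder θ θ'
      _ ≤ N * ((1 - r) ^ (a - b) * |θ - θ'| ^ b) :=
        mul_le_mul_of_nonneg_left (rpow_le_of_ge hd hle hab) hN
      _ = 1 * ((1 - r) ^ (a - b) * N * |θ - θ'| ^ b) := by ring
      _ ≤ 4 * Real.pi * ((1 - r) ^ (a - b) * N * |θ - θ'| ^ b) := by gcongr
      _ = _ := by ring
  · rw [hf.iteratedDeriv_circleConv (continuous_rotPoisson h0 h1) le_rfl]
    have h2 := norm_sub_le_of_hasDerivAt (hf.hasDerivAt_circleConv_rotPoisson h0 h1)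
      (hf.norm_deriv_circleConv_le ha0 (hab.trans hb) h0 h1) θ θ'
    have h3 := rpow_le_of_le (abs_nonneg _) hle (ha0.trans hab) hb
    rw [Real.rpow_one] at h3
    calc _ ≤ 2 * Real.pi * (1 - r) ^ (a - 1) * N * |θ - θ'| := h2
      _ ≤ 2 * Real.pi * (1 - r) ^ (a - 1) * N * ((1 - r) ^ (1 - b) * |θ - θ'| ^ b) := by gcongr
      _ = 2 * (Real.pi * ((1 - r) ^ (a - 1) * (1 - r) ^ (1 - b)) * N * |θ - θ'| ^ b) := by ring
      _ = 2 * (Real.pi * (1 - r) ^ (a - b) * N * |θ - θ'| ^ b) := by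
        rw [← Real.rpow_add hd, sub_add_sub_cancel]
      _ ≤ 4 * (Real.pi * (1 - r) ^ (a - b) * N * |θ - θ'| ^ b) := by gcongr; norm_num
      _ = _ := by ring

/-- Smoothing which gains a derivative. -/
theorem smooth_succ (hf : HolderBounds k a N f) (ha1 : a ≤ 1) {b : ℝ} (hb : 0 ≤ b)
    (hba : b ≤ a) (h0 : 0 ≤ r) (h1 : r < 1) :
    HolderBounds (k + 1) b (4 * Real.pi * (1 - r) ^ (a - 1 - b) * N)
      (Peskin.circleConv (rotPoisson r) f) := by
  have h := hf.circleConv_rotPoisson h0 h1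
  have ha0 := hb.trans hba
  have hd : 0 < 1 - r := sub_pos.2 h1
  have hpi : 1 ≤ 4 * Real.pi := by linarith [Real.pi_gt_three]
  have hN := hf.nonneg
  rw [one_mul] at h
  have e := hf.iteratedDeriv_circleConv (continuous_rotPoisson h0 h1) (le_refl k)
  have e1 : iteratedDeriv (k + 1) (Peskin.circleConv (rotPoisson r) f) =
      Peskin.circleConv (rotPoissonDeriv r) (iteratedDeriv k f) := by
    rw [iteratedDeriv_succ, e]
    exact funext fun θ => (hf.hasDerivAt_circleConv_rotPoisson h0 h1 θ).deriv
  have hle1 : (1 - r) ^ (a - 1) ≤ (1 - r) ^ (a - 1 - b) :=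
    Real.rpow_le_rpow_of_exponent_ge hd (by linarith) (by linarith)
  have hk := hf.norm_deriv_circleConv_le ha0 ha1 h0 h1
  refine ⟨h.periodic, ?_, fun l hl θ => ?_, fun θ θ' => ?_⟩
  · refine contDiff_nat_iff_iteratedDeriv.2 ⟨fun l hl => ?_, fun l hl => ?_⟩
    · rcases Nat.le_succ_iff.1 hl with hl | rfl
      · exact h.continuous_iteratedDeriv hl
      · rw [e1]
        exact continuous_circleConv (continuous_rotPoissonDeriv h0 h1)
          (hf.continuous_iteratedDeriv le_rfl)
    · rcases Nat.lt_succ_iff_lt_or_eq.1 hl with hl | rfl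
      · exact fun θ => (h.contDiff.hasDerivAt_iteratedDeriv hl θ).differentiableAt
      · rw [e]
        exact fun θ => (hf.hasDerivAt_circleConv_rotPoisson h0 h1 θ).differentiableAt
  · rcases Nat.le_succ_iff.1 hl with hl | rfl
    · exact (h.bound l hl θ).trans (hf.le_mul_rpow h0 h1 (by linarith) hpi)
    · rw [e1]
      refine (hk θ).trans ?_
      gcongr
      norm_num
  · rw [e1]
    -- Here near points use the Hölder bound of `f` with the kernel derivative of size 1/(1 - r),
    -- and far points use the sup bound twice.
    rcases le_total |θ - θ'| (1 - r) with hle | hle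
    · have h3 := rpow_le_of_le (abs_nonneg _) hle hb hba
      calc _ ≤ 2 / (1 - r) * (N * |θ - θ'| ^ a) := hf.norm_deriv_circleConv_sub_le h0 h1 θ θ'
        _ ≤ 2 / (1 - r) * (N * ((1 - r) ^ (a - b) * |θ - θ'| ^ b)) := by gcongr
        _ = 2 * ((1 - r) ^ (a - b) / (1 - r) * N * |θ - θ'| ^ b) := by ring
        _ = 2 * ((1 - r) ^ (a - 1 - b) * N * |θ - θ'| ^ b) := by
          rw [← Real.rpow_sub_one hd.ne', sub_right_comm]
        _ ≤ 4 * Real.pi * ((1 - r) ^ (a - 1 - b) * N * |θ - θ'| ^ b) := by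
          gcongr; linarith [Real.pi_gt_three]
        _ = _ := by ring
    · have h3 := rpow_le_of_ge hd hle hb
      rw [Real.rpow_zero, zero_sub] at h3
      calc _ ≤ 2 * Real.pi * (1 - r) ^ (a - 1) * N + 2 * Real.pi * (1 - r) ^ (a - 1) * N :=
            (norm_sub_le _ _).trans (add_le_add (hk θ) (hk θ'))
        _ = 4 * Real.pi * (1 - r) ^ (a - 1) * N * 1 := by ring
        _ ≤ 4 * Real.pi * (1 - r) ^ (a - 1) * N * ((1 - r) ^ (-b) * |θ - θ'| ^ b) := by gcongr
        _ = 4 * Real.pi * ((1 - r) ^ (a - 1) * (1 - r) ^ (-b)) * N * |θ - θ'| ^ b := by ring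
        _ = _ := by rw [← Real.rpow_add hd, ← sub_eq_add_neg]

end Smoothing

end HolderBounds

/-! ### Passing between plane-valued and complex-valued functions -/

theorem deriv_toC (u : ℝ → Plane) (θ : ℝ) : deriv (fun s => toC (u s)) θ = toC (deriv u θ) := by
  by_cases h : DifferentiableAt ℝ u θ
  · exact (toC.toContinuousLinearEquiv.toContinuousLinearMap.hasFDerivAt.comp_hasDerivAt θ
      h.hasDerivAt).deriv
  · rw [deriv_zero_of_not_differentiableAt h, map_zero]
    exact deriv_zero_of_not_differentiableAt fun h2 => h (hasDerivAt_of_toC h2.hasDerivAt).differentiableAt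

theorem iteratedDeriv_toC (u : ℝ → Plane) (l : ℕ) :
    iteratedDeriv l (fun s => toC (u s)) = fun θ => toC (iteratedDeriv l u θ) := by
  induction l with
  | zero => simp only [iteratedDeriv_zero]
  | succ l ih =>
    rw [iteratedDeriv_succ, ih, iteratedDeriv_succ]
    exact funext fun θ => deriv_toC _ θ

/-- The factor 2 serves two purposes: for integer α the exponent is 0 and the Hölder bound is an
oscillation bound, and for other α it extends the seminorm to distances of 1 and more. -/
theorem MemHolder.holderBounds {α : ℝ} (hα : 0 ≤ α) {u : ℝ → Plane} (hu : MemHolder α u) :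
    HolderBounds ⌊α⌋₊ (α - ⌊α⌋₊) (2 * (holderNorm α u).toReal) (fun θ => toC (u θ)) := by
  obtain ⟨hp, hc, hn⟩ := hu
  set N := (holderNorm α u).toReal with hN
  have hN0 : 0 ≤ N := ENNReal.toReal_nonneg
  have hb : ∀ l ≤ ⌊α⌋₊, ∀ θ, ‖iteratedDeriv l u θ‖ ≤ N := fun l hl θ => norm_iteratedDeriv_le hn hl θ
  refine ⟨fun θ => by rw [hp θ], toC.toContinuousLinearEquiv.contDiff.comp hc, fun l hl θ => ?_,
    fun θ θ' => ?_⟩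
  · rw [iteratedDeriv_toC, toC.norm_map]
    linarith [hb l hl θ]
  · simp only [iteratedDeriv_toC]
    rw [← map_sub, toC.norm_map]
    by_cases h : α = (⌊α⌋₊ : ℝ)
    · rw [← h, sub_self, Real.rpow_zero, mul_one]
      refine (norm_sub_le _ _).trans ?_
      linarith [hb _ le_rfl θ, hb _ le_rfl θ']
    · exact norm_sub_le_of_local hN0 (sub_nonneg.2 (Nat.floor_le hα)) (hb _ le_rfl)
        (fun θ θ' h0 h1 => norm_iteratedDeriv_sub_le hn h h0 h1) θ θ'

theorem HolderBounds.memHolder {β N : ℝ} {f : ℝ → ℂ} (hf : HolderBounds ⌊β⌋₊ (β - ⌊β⌋₊) N f) :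
    MemHolder β (fun θ => toC.symm (f θ)) ∧
      holderNorm β (fun θ => toC.symm (f θ)) ≤ ENNReal.ofReal ((⌊β⌋₊ + 2) * N) := by
  have e : ∀ l θ, toC (iteratedDeriv l (fun θ => toC.symm (f θ)) θ) = iteratedDeriv l f θ :=
    fun l θ => by
      rw [← congrFun (iteratedDeriv_toC (fun θ => toC.symm (f θ)) l) θ]
      simp only [LinearIsometryEquiv.apply_symm_apply]
  have hle := holderNorm_le_of_bounds (α := β) (u := fun θ => toC.symm (f θ)) hf.nonneg
    (fun l hl θ => by rw [← toC.norm_map, e]; exact hf.bound l hl θ)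
    fun _ θ θ' _ _ => by rw [← toC.norm_map, map_sub, e, e]; exact hf.holder θ θ'
  exact ⟨⟨fun θ => congrArg toC.symm (hf.periodic θ), toC.symm.toContinuousLinearEquiv.contDiff.comp hf.contDiff,
    hle.trans_lt ENNReal.ofReal_lt_top⟩, hle⟩

theorem MemHolder.sub {α : ℝ} {u v : ℝ → Plane} (hu : MemHolder α u) (hv : MemHolder α v) :
    MemHolder α (fun θ => u θ - v θ) := by
  refine memHolder_of_bound (A := (holderNorm α u).toReal + (holderNorm α v).toReal)
    (fun θ => by simp only [hu.1 θ, hv.1 θ]) (hu.2.1.sub hv.2.1) fun hα θ θ' h0 h1 => ?_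
  rw [iteratedDeriv_fun_sub hu.2.1.contDiffAt hv.2.1.contDiffAt,
    iteratedDeriv_fun_sub hu.2.1.contDiffAt hv.2.1.contDiffAt, sub_sub_sub_comm, add_mul]
  exact (norm_sub_le _ _).trans (add_le_add (norm_iteratedDeriv_sub_le hu.2.2 hα h0 h1)
    (norm_iteratedDeriv_sub_le hv.2.2 hα h0 h1))

theorem projPi_eq_sub {w : ℝ → Plane}
    (hw : IntervalIntegrable (fun θ => toC (w θ)) volume 0 (2 * Real.pi)) :
    projPi w = fun θ => w θ - trigPoly {0, 1} (coeffC fun s => toC (w s)) θ := by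
  funext θ
  apply toC.injective
  rw [toC_projPi hw, map_sub, trigPoly, Finset.sum_pair zero_ne_one, Pi.add_apply, map_add,
    toC_mode, toC_mode, chr_zero, mul_one]

theorem MemHolder.continuous {α : ℝ} {w : ℝ → Plane} (hw : MemHolder α w) : Continuous w :=
  hw.2.1.continuous

theorem MemHolder.projPi {α : ℝ} {w : ℝ → Plane} (hw : MemHolder α w) :
    MemHolder α (projPi w) := by
  rw [projPi_eq_sub ((toC.continuous.comp hw.continuous).intervalIntegrable _ _)]
  exact hw.sub (memHolder_of_contDiff (trigPoly_periodic _ _) (contDiff_trigPoly _ _))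

theorem coeffC_projPi_eq_zero {w : ℝ → Plane} (hw : Continuous w) {m : ℤ} (hm : m = 0 ∨ m = 1) :
    coeffC (fun θ => toC (projPi w θ)) m = 0 := by
  have hi := (toC.continuous.comp hw).intervalIntegrable (μ := volume) 0 (2 * Real.pi)
  rw [projPi_eq_sub hi]
  simp only [map_sub]
  have ht := (toC.continuous.comp (contDiff_trigPoly {0, 1} (coeffC fun s => toC (w s))
    (n := 0)).continuous).intervalIntegrable (μ := volume) 0 (2 * Real.pi)
  rw [coeffC_sub (f := fun θ => toC (w θ)) (g := fun θ => toC (trigPoly {0, 1}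
    (coeffC fun s => toC (w s)) θ)) hi ht, coeffC_trigPoly, if_pos (by simpa using hm), sub_self]

/-! ### Decay of the semigroup -/

/-- Away from m = 0 the semigroup has the coefficients of a Poisson kernel centred at frequency 1;
the exceptional frequency 0 is removed by Π. -/
theorem exp_neg_lam_mul {m : ℤ} (hm : m ≠ 0) (t : ℝ) :
    Real.exp (-lam m * t) = Real.exp (-t / 4) ^ (m - 1).natAbs := by
  rw [← Real.exp_nat_mul]
  congr 1
  have h : ((m - 1).natAbs : ℝ) = m.sign * (m - 1) := by
    have h1 : (((m - 1).natAbs : ℤ)) = m.sign * (m - 1) := by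
      rcases lt_trichotomy m 0 with h | h | h
      · rw [Int.sign_eq_neg_one_of_neg h]; omega
      · exact absurd h hm
      · rw [Int.sign_eq_one_of_pos h]; omega
    have h2 := congrArg (Int.cast (R := ℝ)) h1
    rw [Int.cast_natCast] at h2
    rw [h2]
    push_cast
    ring
  rw [lam, h]
  ring

theorem le_one_sub_exp {x : ℝ} (h0 : 0 ≤ x) (h1 : x ≤ 1) : x / 2 ≤ 1 - Real.exp (-x) := by
  have h2 := Real.add_one_le_exp x
  have h3 : Real.exp (-x) ≤ 1 / (1 + x) := by
    rw [Real.exp_neg, ← one_div]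
    exact one_div_le_one_div_of_le (by linarith) (by linarith)
  have h4 : 1 / (1 + x) ≤ 1 - x / 2 := by
    rw [div_le_iff₀ (by linarith)]
    nlinarith
  linarith

/-- Since 1 - e^{-x} ≥ x/2 on [0, 1], the base is at least min(t, 1)/16. Its power is at most 16
times the larger of t^{-c} and 1. -/
theorem one_sub_exp_rpow_le {t τ c : ℝ} (ht : 0 < t) (hτ : τ = min t 1 / 2) (hc0 : 0 ≤ c)
    (hc1 : c ≤ 1) : (1 - Real.exp (-τ / 4)) ^ (-c) ≤ 16 * (1 / t ^ c + 1) := by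
  have hm : 0 < min t 1 := lt_min ht one_pos
  have hτ1 : τ ≤ 1 / 2 := by rw [hτ]; linarith [min_le_right t 1]
  have hle : min t 1 / 16 ≤ 1 - Real.exp (-τ / 4) := by
    have := le_one_sub_exp (x := τ / 4) (by rw [hτ]; positivity) (by linarith)
    rw [neg_div]
    rw [hτ] at this ⊢
    linarith
  refine (Real.rpow_le_rpow_of_nonpos (by positivity) hle (neg_nonpos.2 hc0)).trans ?_
  rw [Real.div_rpow hm.le (by norm_num), Real.rpow_neg (by norm_num : (0 : ℝ) ≤ 16), div_inv_eq_mul,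
    mul_comm]
  have h16 : (16 : ℝ) ^ c ≤ 16 := by
    simpa using Real.rpow_le_rpow_of_exponent_le (by norm_num : (1 : ℝ) ≤ 16) hc1
  have hmin : (min t 1) ^ (-c) ≤ 1 / t ^ c + 1 := by
    have hp : 0 < t ^ c := Real.rpow_pos_of_pos ht c
    rcases min_choice t 1 with h | h <;> rw [h]
    · rw [Real.rpow_neg ht.le, one_div]; linarith
    · rw [Real.one_rpow]
      have : 0 < 1 / t ^ c := by positivity
      linarith
  gcongr

/-- As β - α ≤ 1, the integer part grows by at most one. If it does not grow, only the Hölder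
exponent is raised; if it does, the remaining exponent is at most that of α. -/
theorem HolderBounds.smooth_floor {α β N : ℝ} {f : ℝ → ℂ} (hα : 0 ≤ α) (hαβ : 0 ≤ β - α)
    (hβ : β - α ≤ 1) (hf : HolderBounds ⌊α⌋₊ (α - ⌊α⌋₊) N f) {r : ℝ} (h0 : 0 ≤ r) (h1 : r < 1) :
    HolderBounds ⌊β⌋₊ (β - ⌊β⌋₊) (4 * Real.pi * (1 - r) ^ (-(β - α)) * N)
      (Peskin.circleConv (rotPoisson r) f) := by
  have ha0 : 0 ≤ α - ⌊α⌋₊ := sub_nonneg.2 (Nat.floor_le hα)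
  have ha1 : α - ⌊α⌋₊ ≤ 1 := by linarith [Nat.lt_floor_add_one α]
  have hβ0 : 0 ≤ β := by linarith
  rcases lt_or_ge (β - ⌊α⌋₊) 1 with h | h
  · have e : ⌊β⌋₊ = ⌊α⌋₊ := (Nat.floor_eq_iff hβ0).2 ⟨by linarith, by linarith⟩
    have := hf.smooth_of_le_one ha0 (b := β - ⌊α⌋₊) (by linarith) h.le h0 h1
    rw [e, show -(β - α) = α - ⌊α⌋₊ - (β - ⌊α⌋₊) by ring]
    exact this
  · have e : ⌊β⌋₊ = ⌊α⌋₊ + 1 := (Nat.floor_eq_iff hβ0).2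
      ⟨by push_cast; linarith, by push_cast; linarith [Nat.lt_floor_add_one α]⟩
    have := hf.smooth_succ ha1 (b := β - (⌊α⌋₊ + 1 : ℕ)) (by push_cast; linarith)
      (by push_cast; linarith) h0 h1
    rw [e, show -(β - α) = α - ⌊α⌋₊ - 1 - (β - (⌊α⌋₊ + 1 : ℕ)) by push_cast; ring]
    exact this

/-- The two Poisson factors multiply, so smoothing and decay can be taken from different parts of
the time interval. The hypothesis at frequency 1 hides the subtracted constant. -/
theorem coeffC_circleConv_circleConv {f : ℝ → ℂ} (hf : Continuous f)
    (hp : Function.Periodic f (2 * Real.pi)) (hz : coeffC f 1 = 0) {r s : ℝ} (h0 : 0 ≤ r)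
    (h1 : r < 1) (hs0 : 0 ≤ s) (hs1 : s < 1) (m : ℤ) :
    coeffC (circleConv (rotPoisson r) (circleConv (rotPoissonSub s) f)) m =
      ((r * s : ℝ) : ℂ) ^ (m - 1).natAbs * coeffC f m := by
  rw [coeffC_circleConv (continuous_rotPoisson h0 h1) (rotPoisson_periodic r)
    (continuous_circleConv (continuous_rotPoissonSub hs0 hs1) hf) (circleConv_periodic hp),
    coeffC_circleConv (continuous_rotPoissonSub hs0 hs1) (rotPoissonSub_periodic s) hf hp]
  rcases eq_or_ne m 1 with rfl | hm
  · rw [hz]; simp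
  · rw [coeffC_rotPoisson h0 h1, coeffC_rotPoissonSub hs0 hs1 hm, Complex.ofReal_mul, mul_pow]
    ring

theorem semigroup_decay {T : ℝ≥0 → L2 →L[ℝ] L2} (hT : IsSemigroupOf graphL T) {α β : ℝ}
    (hα : 0 ≤ α) (hαβ : 0 ≤ β - α) (hβ : β - α ≤ 1) :
    ∃ C : ℝ, 0 < C ∧ ∀ w : ℝ → Plane, MemHolder α w → MemHolder α (projPi w) ∧
      ∀ t : ℝ≥0, 0 < t → ∃ v : ℝ → Plane, MemHolder β v ∧ T t (toL2 (projPi w)) = toL2 v ∧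
        holderNorm β v ≤
          ENNReal.ofReal (C * Real.exp (-(t : ℝ) / 4) * (1 / (t : ℝ) ^ (β - α) + 1)) *
            holderNorm α (projPi w) := by
  -- The constant is 4π from smoothing, 16 from the power of 1 - r, and three factors 2, from the
  -- mean of the kernel P_s - 1, from e^{τ/4}, and from the passage to `HolderBounds`; ⌊β⌋ + 2
  -- counts the terms of the norm.
  refine ⟨(⌊β⌋₊ + 2) * (512 * Real.pi), by positivity, fun w hw => ⟨hw.projPi, fun t ht => ?_⟩⟩
  have ht0 : (0 : ℝ) < t := by exact_mod_cast ht
  have hu := hw.projPi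
  set u := projPi w with hu_def
  set N := (holderNorm α u).toReal with hN
  have hN0 : 0 ≤ N := ENNReal.toReal_nonneg
  set f : ℝ → ℂ := fun θ => toC (u θ) with hf_def
  have hf : HolderBounds ⌊α⌋₊ (α - ⌊α⌋₊) (2 * N) f := hu.holderBounds hα
  -- The smoothing time is comparable to t for small t, giving the power of t, and at most 1/2, so
  -- that the remaining time loses only a bounded factor in e^{-t/4}.
  set τ : ℝ := min (t : ℝ) 1 / 2 with hτ
  have hτ0 : 0 < τ := half_pos (lt_min ht0 one_pos)
  have hτt : τ < t := by rw [hτ]; linarith [min_le_left (t : ℝ) 1]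
  have hτ1 : τ ≤ 1 / 2 := by rw [hτ]; linarith [min_le_right (t : ℝ) 1]
  have hr1 : Real.exp (-τ / 4) < 1 := (Real.exp_lt_exp.2 (by linarith)).trans_eq Real.exp_zero
  have hs1 : Real.exp (-(t - τ) / 4) < 1 := (Real.exp_lt_exp.2 (by linarith)).trans_eq Real.exp_zero
  have hr0 := (Real.exp_pos (-τ / 4)).le
  have hs0 := (Real.exp_pos (-(t - τ) / 4)).le
  have hg := (hf.circleConv_rotPoissonSub hs0 hs1).smooth_floor hα hαβ hβ hr0 hr1
  obtain ⟨hmem, hnorm⟩ := hg.memHolder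
  refine ⟨_, hmem, ?_, hnorm.trans ?_⟩
  · refine coef_ext fun m => ?_
    rw [coef_semigroup hT, coef_toL2 (Continuous.memLp_circle hu.continuous 2),
      coef_toL2 (Continuous.memLp_circle hmem.continuous 2)]
    simp only [LinearIsometryEquiv.apply_symm_apply]
    rw [coeffC_circleConv_circleConv hf.continuous hf.periodic
      (coeffC_projPi_eq_zero hw.continuous (Or.inr rfl)) hr0 hr1 hs0 hs1, ← Real.exp_add]
    -- At m = 0 the semigroup and the Poisson product have different multipliers, but the
    -- coefficient is zero.
    rcases eq_or_ne m 0 with rfl | hm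
    · rw [coeffC_projPi_eq_zero hw.continuous (Or.inl rfl), smul_zero, mul_zero]
    · rw [exp_neg_lam_mul hm, Complex.real_smul, Complex.ofReal_pow,
        show -τ / 4 + -(t - τ) / 4 = -(t : ℝ) / 4 by ring]
  · rw [← ENNReal.ofReal_toReal hu.2.2.ne, ← ENNReal.ofReal_mul (by positivity)]
    refine ENNReal.ofReal_le_ofReal ?_
    have h2 : Real.exp (-(t - τ) / 4) ≤ 2 * Real.exp (-(t : ℝ) / 4) := by
      have h3 : Real.exp (-(t - τ) / 4) = Real.exp (τ / 4) * Real.exp (-(t : ℝ) / 4) := by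
        rw [← Real.exp_add]; congr 1; ring
      have h4 : Real.exp (τ / 4) ≤ 2 := by
        have h5 := Real.exp_bound_div_one_sub_of_interval (x := τ / 4) (by linarith) (by linarith)
        refine h5.trans ?_
        rw [div_le_iff₀ (by linarith)]
        linarith
      rw [h3]
      gcongr
    have h6 := one_sub_exp_rpow_le ht0 hτ hαβ hβ
    have hd : 0 < 1 - Real.exp (-τ / 4) := sub_pos.2 hr1
    calc (⌊β⌋₊ + 2) * (4 * Real.pi * (1 - Real.exp (-τ / 4)) ^ (-(β - α)) *
          (2 * Real.exp (-(t - τ) / 4) * (2 * N)))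
        ≤ (⌊β⌋₊ + 2) * (4 * Real.pi * (16 * (1 / (t : ℝ) ^ (β - α) + 1)) *
          (2 * (2 * Real.exp (-(t : ℝ) / 4)) * (2 * N))) := by gcongr
      _ = _ := by ring

end

end Peskin

/-! ### The main theorem -/

theorem proposition4p2 :
    -- the principal values defining the operators exist
    (∀ (γ : ℝ) (Y : ℝ → Peskin.Plane), 0 < γ → γ < 1 → Peskin.MemHolder (1 + γ) Y →
      ∀ θ, Peskin.HasHilbertAt (deriv Y) θ (Peskin.hilbert (deriv Y) θ)) ∧
    -- the linearization at every circle is `R_θ Λ R_θ⁻¹ Π`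
    (∀ A B C₁ C₂ : ℝ, 0 < A ^ 2 + B ^ 2 →
      ∀ (γ : ℝ) (Y : ℝ → Peskin.Plane), 0 < γ → γ < 1 → Peskin.MemHolder (1 + γ) Y →
        Peskin.HasLinearization (Peskin.circle A B C₁ C₂) Y (Peskin.circleOp Y)) ∧
    -- eigenspaces in `C^{1,γ}`; the case `k = 0` is the kernel
    (∀ A B C₁ C₂ : ℝ, 0 < A ^ 2 + B ^ 2 → ∀ γ : ℝ, 0 < γ → γ < 1 →
      ∀ (k : ℕ) (Y : ℝ → Peskin.Plane),
        (Peskin.MemHolder (1 + γ) Y ∧ Peskin.HasLinearization (Peskin.circle A B C₁ C₂) Y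
            (fun θ => (-(k : ℝ) / 4) • Y θ)) ↔
          Y ∈ Submodule.span ℝ (Peskin.modes k)) ∧
    -- eigenspaces in `L²`
    (∀ (k : ℕ) (f : Peskin.L2), (f, (-(k : ℝ) / 4) • f) ∈ Peskin.graphL ↔
      f ∈ Submodule.span ℝ (Peskin.toL2 '' Peskin.modes k)) ∧
    -- their dimensions
    (∀ k : ℕ, Module.finrank ℝ (Submodule.span ℝ (Peskin.toL2 '' Peskin.modes k)) =
      if k = 1 then 2 else 4) ∧
    -- the eigenfunctions form a complete orthogonal set in `L²`
    (∀ u ∈ ⋃ k, Peskin.modes k, ∀ v ∈ ⋃ k, Peskin.modes k, u ≠ v →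
      inner ℝ (Peskin.toL2 u) (Peskin.toL2 v) = 0) ∧
    (Submodule.span ℝ (Peskin.toL2 '' ⋃ k, Peskin.modes k)).topologicalClosure = ⊤ ∧
    -- the eigenvalues exhaust the spectrum on `L²`
    (∀ z : ℂ, ¬ Peskin.InResolventSet Peskin.graphL z ↔ ∃ k : ℕ, z = -(k : ℂ) / 4) ∧
    -- the operator generates a unique strongly continuous semigroup on `L²`
    (∃! T : ℝ≥0 → Peskin.L2 →L[ℝ] Peskin.L2, Peskin.IsSemigroupOf Peskin.graphL T) ∧
    -- decay of the semigroup
    (∀ T : ℝ≥0 → Peskin.L2 →L[ℝ] Peskin.L2, Peskin.IsSemigroupOf Peskin.graphL T →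
      ∀ α β : ℝ, 0 ≤ α → 0 ≤ β - α → β - α ≤ 1 →
        ∃ C : ℝ, 0 < C ∧ ∀ w : ℝ → Peskin.Plane, Peskin.MemHolder α w →
          Peskin.MemHolder α (Peskin.projPi w) ∧
          ∀ t : ℝ≥0, 0 < t → ∃ v : ℝ → Peskin.Plane, Peskin.MemHolder β v ∧
            T t (Peskin.toL2 (Peskin.projPi w)) = Peskin.toL2 v ∧
            Peskin.holderNorm β v ≤
              ENNReal.ofReal (C * Real.exp (-(t : ℝ) / 4) * (1 / (t : ℝ) ^ (β - α) + 1)) *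
                Peskin.holderNorm α (Peskin.projPi w)) := by
  refine ⟨fun γ Y hγ0 hγ hY θ => ?_, fun A B C₁ C₂ hAB γ Y hγ0 hγ hY => ?_,
    fun A B C₁ C₂ hAB γ hγ0 hγ k Y => Peskin.eigenspace_classical hAB hγ0 hγ k Y,
    Peskin.eigenspace_L2, Peskin.finrank_eigenspace,
    fun u hu v hv huv => Peskin.inner_modes_eq_zero hu hv huv,
    Peskin.span_modes_topologicalClosure, Peskin.spectrum_graphL, Peskin.existsUnique_semigroup,
    fun T hT α β hα hαβ hβ => Peskin.semigroup_decay hT hα hαβ hβ⟩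
  · obtain ⟨M, hM⟩ := hY.exists_holderOne hγ0 hγ
    have hc : Continuous (deriv Y) := hM.contDiff.continuous_deriv le_rfl
    rw [Peskin.hilbert_eq_hilbertInt hM.nonneg hγ0 hγ.le hc hM.norm_deriv_sub_le]
    exact Peskin.hasHilbertAt_of_holder hM.nonneg hγ0 hγ.le hc hM.norm_deriv_sub_le θ
  · obtain ⟨M, hM⟩ := hY.exists_holderOne hγ0 hγ
    exact Peskin.hasLinearization_circle hM hγ0 hγ.le C₁ C₂ hAB
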